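/- Let $0<p\le 1$. For a metric space $M$, a linear combination $m=\sum_i a_i(\delta(x_i)-\delta(y_i))$ of differences of point masses is called a molecule, and $\mathcal F_p(M)$ (the Lipschitz free $p$-space) is the completion of the space of molecules for the $p$-norm $\|m\|=\inf\big(\sum_i|a_i|^p d(x_i,y_i)^p\big)^{1/p}$, the infimum being over all such representations of $m$. For $N\subset M$ the canonical map $\mathcal F_p(N)\to\mathcal F_p(M)$ is the bounded linear map with $\delta(x)-\delta(y)\mapsto\delta(x)-\delta(y)$. For $p$-normed spaces, $X\simeq_C Y$ means that there are mutually inverse bounded linear maps $S:X\to Y$, $T:Y\to X$ with $\|S\|\,\|T\|\le C$; $X$ is $K$-complemented in $Y$ (via $S$) if there are bounded linear maps $S:X\to Y$, $T:Y\to X$ with $TS=\mathrm{Id}_X$ and $\|S\|\,\|T\|\le K$. A subset $N\subset M$ is complementably $p$-amenable in $M$ with constant $K$ if $\mathcal F_p(N)$ is $K$-complemented in $\mathcal F_p(M)$ via the canonical map. $(\bigoplus_{n} X_n)_p$ is the $\ell_p$-sum, and $\ell_p(X)=(\bigoplus_{n\in\mathbb N}X)_p$. For a pointed metric space $(M,d,0)$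 and $A\subset(0,\infty)$ put $M_A=\{x: d(0,x)\in A\}$ and $M_A^*=\{0\}\cup M_A$. Let $\mathbb N_*=\{0,1,2,\dots\}$. **(1) Annuli growing outward.** Let $R,\lambda,\mu,K_1,K_2,K_3>1$ and $\alpha>0$. There is a constant $C\ge 1$, depending only on $p,R,\lambda,\mu,K_1,K_2,K_3,\alpha$, such that the following holds whenever $N$ is a countable set, $\phi:N\to\mathbb N_*$ is unbounded, $0<c_1<c_3<c_2<\infty$ satisfy $\log_R(c_2/c_1)>\lambda$ and $\log_R(c_3/c_1)>\alpha$, and $(M,d,0)$ is an infinite pointed metric space such that, with $A_n=(c_1R^n,c_2R^n]$ and $B_n=(c_1\mu^{-1}R^n,c_2\mu R^n]$ for $n\in\mathbb N_*$: * $d(0,x)>c_1$ for all $x\in M\setminus\{0\}$; * $\mathcal F_p(M_{A_n})$ is $K_1$-complemented in $\mathcal F_p(M_{A_m})$ whenever $0\le n\le m$; * $\mathcal F_p(M_{(c_1,c_3]})$ is $K_2$-complemented in $\mathcal F_p(M_{A_0})$; * for all $n$ large enough, $M_{A_n}$ is complementably $p$-amenable in $M_{B_n}$ with constant $K_3$.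 Then * (a) $\mathcal F_p(M)\simeq_C\ell_p(\mathcal F_p(M))$; * (b) $\mathcal F_p(M)\simeq_C\big(\bigoplus_{n\in N}\mathcal F_p(M^*_{A_{\phi(n)}})\big)_p$, provided that $M_{A_{\phi(n)}}\ne\emptyset$ for infinitely many $n\in N$; * (c) $\big(\bigoplus_{n\in N}\mathcal F_p(M^*_{A_{\phi(n)}})\big)_p\simeq_C\big(\bigoplus_{n\in N}\mathcal F_p(M_{A_{\phi(n)}})\big)_p$, provided that some $M_{A_k}$, $k\in\mathbb N_*$, has at least two points. (The proviso of (c) implies that of (b).) **(2) Annuli shrinking inward.** Let $R,\lambda,\mu,K_1,K_2,K_3>1$ and $\alpha>0$. There is a constant $C\ge 1$, depending only on $p,R,\lambda,\mu,K_1,K_2,K_3,\alpha$, such that (a), (b), (c) hold, with the same provisos, whenever $N$ is a countable set, $\phi:N\to\mathbb N_*$ is unbounded, $0<c_1<c_3<c_2<\infty$ satisfy $\log_R(c_2/c_1)>\lambda$ and $\log_R(c_3/c_1)>\alpha$, and $(M,d,0)$ is an infinite pointed metric space such that, now with $A_n=(c_1R^{-n},c_2R^{-n}]$ and $B_n=(c_1\mu^{-1}R^{-n},c_2\mu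 R^{-n}]$ for $n\in\mathbb N_*$: * $d(0,x)\le c_2$ for all $x\in M\setminus\{0\}$; * $\mathcal F_p(M_{A_n})$ is $K_1$-complemented in $\mathcal F_p(M_{A_m})$ whenever $0\le n\le m$; * $\mathcal F_p(M_{(c_3,c_2]})$ is $K_2$-complemented in $\mathcal F_p(M_{A_0})$; * for all $n$ large enough, $M_{A_n}$ is complementably $p$-amenable in $M_{B_n}$ with constant $K_3$. **(3) Two-sided.** Let $R,\lambda,\mu,K_1,K_2>1$. There is a constant $C\ge 1$, depending only on $p,R,\lambda,\mu,K_1,K_2$, such that the following holds whenever $c_1,c_2>0$ satisfy $\log_R(c_2/c_1)\ge\lambda$ and $(M,d,0)$ is an infinite pointed metric space such that, with $A_n=(c_1R^n,c_2R^n]$ and $B_n=(c_1\mu^{-1}R^n,c_2\mu R^n)$ for $n\in\mathbb Z$: * $\mathcal F_p(M_{A_n})\simeq_{K_1}\mathcal F_p(M_{A_0})$ for all $n\in\mathbb Z$; * $M_{A_n}$ is complementably $p$-amenable in $M_{B_n}$ with constant $K_2$ for all $n\in\mathbb Z$. Then * $\mathcal F_p(M)\simeq_C\ell_p(\mathcal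 F_p(M))$; * $\ell_p(\mathcal F_p(M))\simeq_C\ell_p(\mathcal F_p(M^*_{(c_1,c_2]}))$, provided that $M_{(c_1,c_2]}\neq\emptyset$; * $\ell_p(\mathcal F_p(M^*_{(c_1,c_2]}))\simeq_C\ell_p(\mathcal F_p(M_{(c_1,c_2]}))$, provided that $M_{(c_1,c_2]}$ has at least two points. -/

import Mathlib

/-!
Lipschitz free `p`-spaces, `0 < p ≤ 1`.

Throughout, a `p`-normed space is represented by a Mathlib `NormedAddCommGroup` whose norm is the
`p`-th *power* of the `p`-norm, so that the `p`-norm of `x` is `qnorm p x = ‖x‖ ^ (1 / p)`.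
-/

open scoped NNReal ENNReal

universe u v w

noncomputable section

namespace LipFree

/-! ### `p`-normed spaces -/

/-- `X` is a real `p`-normed space whose `p`-norm is `x ↦ ‖x‖ ^ (1 / p)`.
(The `p`-triangle inequality is the triangle inequality for `‖·‖`.) -/
class PNormed (p : Set.Ioc (0 : ℝ) 1) (X : Type*) [NormedAddCommGroup X] [Module ℝ X] : Prop where
  norm_smul_eq : ∀ (a : ℝ) (x : X), ‖a • x‖ = |a| ^ (p : ℝ) * ‖x‖

/-- The `p`-norm of a `p`-normed space. -/
def qnorm (p : Set.Ioc (0 : ℝ) 1) {X : Type*} [NormedAddCommGroup X] (x : X) : ℝ :=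
  ‖x‖ ^ (1 / (p : ℝ))

section Operators

variable (p : Set.Ioc (0 : ℝ) 1)
variable {X : Type*} [NormedAddCommGroup X] [Module ℝ X]
variable {Y : Type*} [NormedAddCommGroup Y] [Module ℝ Y]

/-- The linear operator `S` is bounded with operator norm (with respect to the `p`-norms) at most
`a`. -/
def OpBound (a : ℝ) (S : X →ₗ[ℝ] Y) : Prop :=
  0 ≤ a ∧ ∀ x, qnorm p (S x) ≤ a * qnorm p x

/-- `X` is `K`-complemented in `Y` via `S`: there is a bounded linear `T` with `T ∘ S = Id` and
`‖S‖ ‖T‖ ≤ K`. -/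
def ComplementedVia (K : ℝ) (S : X →ₗ[ℝ] Y) : Prop :=
  ∃ (T : Y →ₗ[ℝ] X) (a b : ℝ), OpBound p a S ∧ OpBound p b T ∧ a * b ≤ K ∧ T ∘ₗ S = LinearMap.id

end Operators

/-- `X` is `K`-complemented in `Y`. -/
def Complemented (p : Set.Ioc (0 : ℝ) 1) (K : ℝ)
    (X : Type*) [NormedAddCommGroup X] [Module ℝ X]
    (Y : Type*) [NormedAddCommGroup Y] [Module ℝ Y] : Prop :=
  ∃ S : X →ₗ[ℝ] Y, ComplementedVia p K S

/-- `X` and `Y` are `K`-isomorphic: there are bounded linear maps `S : X → Y` and `T : Y → X`,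
inverse to each other, with `‖S‖ ‖T‖ ≤ K`. -/
def Isom (p : Set.Ioc (0 : ℝ) 1) (K : ℝ)
    (X : Type*) [NormedAddCommGroup X] [Module ℝ X]
    (Y : Type*) [NormedAddCommGroup Y] [Module ℝ Y] : Prop :=
  ∃ (S : X →ₗ[ℝ] Y) (T : Y →ₗ[ℝ] X) (a b : ℝ), OpBound p a S ∧ OpBound p b T ∧ a * b ≤ K ∧
    T ∘ₗ S = LinearMap.id ∧ S ∘ₗ T = LinearMap.id

/-! ### `ℓ_p`-sums -/

/-- The `ℓ_p`-sum of a family of `p`-normed spaces: the families `x` for which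
`∑ (qnorm p (x i)) ^ p = ∑ ‖x i‖` converges, normed by that sum (see `LpSum.qnorm_eq`). -/
def LpSum (_p : Set.Ioc (0 : ℝ) 1) {ι : Type v} (X : ι → Type w)
    [∀ i, NormedAddCommGroup (X i)] : Type (max v w) :=
  lp X 1

namespace LpSum

variable {p : Set.Ioc (0 : ℝ) 1} {ι : Type v} {X : ι → Type w} [∀ i, NormedAddCommGroup (X i)]

instance : NormedAddCommGroup (LpSum p X) := inferInstanceAs (NormedAddCommGroup (lp X 1))

/-- The `i`-th coordinate. -/
def coord (x : LpSum p X) (i : ι) : X i := (show lp X 1 from x) i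

theorem ext {x y : LpSum p X} (h : ∀ i, coord x i = coord y i) : x = y :=
  lp.ext (funext h)

theorem summable_norm (x : LpSum p X) : Summable fun i => ‖coord x i‖ := by
  have h := (lp.memℓp (show lp X 1 from x)).summable (by norm_num)
  simpa [coord] using h

theorem norm_eq (x : LpSum p X) : ‖x‖ = ∑' i, ‖coord x i‖ := by
  have h := lp.norm_eq_tsum_rpow (p := 1) (by norm_num) (show lp X 1 from x)
  simp only [ENNReal.toReal_one, Real.rpow_one, div_one] at h
  exact h

/-- An element of the `ℓ_p`-sum from its coordinates. -/
def mk (x : ∀ i, X i) (h : Summable fun i => ‖x i‖) : LpSum p X :=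
  (⟨x, memℓp_gen (by simpa using h)⟩ : lp X 1)

@[simp] theorem coord_mk (x : ∀ i, X i) (h : Summable fun i => ‖x i‖) (i : ι) :
    coord (mk (p := p) x h) i = x i := rfl

@[simp] theorem coord_add (x y : LpSum p X) (i : ι) :
    coord (x + y) i = coord x i + coord y i := rfl

@[simp] theorem coord_zero (i : ι) : coord (0 : LpSum p X) i = 0 := rfl

/-- The `p`-norm of the `ℓ_p`-sum is `(∑ ‖x i‖_p ^ p) ^ (1 / p)`. -/
theorem qnorm_eq (x : LpSum p X) :
    qnorm p x = (∑' i, qnorm p (coord x i) ^ (p : ℝ)) ^ (1 / (p : ℝ)) := by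
  have hp : (p : ℝ) ≠ 0 := p.2.1.ne'
  have h (i : ι) : qnorm p (coord x i) ^ (p : ℝ) = ‖coord x i‖ := by
    rw [qnorm, ← Real.rpow_mul (norm_nonneg _), one_div, inv_mul_cancel₀ hp, Real.rpow_one]
  simp only [h]
  rw [qnorm, norm_eq]

variable [∀ i, Module ℝ (X i)] [∀ i, PNormed p (X i)]

instance : SMul ℝ (LpSum p X) where
  smul a x := mk (fun i => a • coord x i) (by
    simp only [PNormed.norm_smul_eq (p := p)]
    exact (summable_norm x).mul_left _)

@[simp] theorem coord_smul (a : ℝ) (x : LpSum p X) (i : ι) :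
    coord (a • x) i = a • coord x i := rfl

instance : Module ℝ (LpSum p X) where
  one_smul x := ext fun i => by simp
  mul_smul a b x := ext fun i => by simp [mul_smul]
  smul_zero a := ext fun i => by simp
  smul_add a x y := ext fun i => by simp
  add_smul a b x := ext fun i => by simp [add_smul]
  zero_smul x := ext fun i => by simp

instance : PNormed p (LpSum p X) where
  norm_smul_eq a x := by
    rw [norm_eq, norm_eq, ← tsum_mul_left]
    exact tsum_congr fun i => by rw [coord_smul, PNormed.norm_smul_eq (p := p)]

end LpSum

/-! ### Molecules -/

/-- The real vector space of molecules on `X`: finitely supported functions `m : X → ℝ` with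
`∑ m(x) = 0`. Once a base point `o` is chosen, it is freely spanned by the evaluations
`δ(x) = 1_x - 1_o`, `x ≠ o`, with `δ(o) = 0`; hence it does not depend on the base point. -/
def Mol (_p : Set.Ioc (0 : ℝ) 1) (X : Type u) : Type u :=
  LinearMap.ker (Finsupp.linearCombination ℝ (fun _ : X => (1 : ℝ)))

namespace Mol

variable {p : Set.Ioc (0 : ℝ) 1} {X : Type u} {Y : Type v}

instance : AddCommGroup (Mol p X) := inferInstanceAs (AddCommGroup (LinearMap.ker _))
instance : Module ℝ (Mol p X) := inferInstanceAs (Module ℝ (LinearMap.ker _))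

/-- The elementary molecule `1_x - 1_y`, i.e. `δ(x) - δ(y)`. -/
def atom (x y : X) : Mol p X :=
  (⟨Finsupp.single x 1 - Finsupp.single y 1, by simp⟩ :
    LinearMap.ker (Finsupp.linearCombination ℝ (fun _ : X => (1 : ℝ))))

/-- Push-forward of molecules; it maps `δ(x) - δ(y)` to `δ(f x) - δ(f y)`. -/
def map (f : X → Y) : Mol p X →ₗ[ℝ] Mol p Y :=
  LinearMap.restrict (Finsupp.lmapDomain ℝ ℝ f) (by
    intro m hm
    simp only [LinearMap.mem_ker] at hm ⊢
    rw [Finsupp.lmapDomain_apply, Finsupp.linearCombination_mapDomain]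
    exact hm)

@[simp] theorem map_atom (f : X → Y) (x y : X) :
    map f (atom x y : Mol p X) = atom (f x) (f y) := by
  apply Subtype.ext
  change Finsupp.lmapDomain ℝ ℝ f (Finsupp.single x 1 - Finsupp.single y 1) = _
  rw [map_sub]
  simp [atom]

/-- The molecule `∑ a (δ(x) - δ(y))`, the sum being over the entries `(a, x, y)` of `l`. -/
def ofList (l : List (ℝ × X × X)) : Mol p X :=
  (l.map fun t => t.1 • atom t.2.1 t.2.2).sum

theorem ofList_append (l l' : List (ℝ × X × X)) :
    (ofList (l ++ l') : Mol p X) = ofList l + ofList l' := by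
  simp [ofList]

theorem smul_ofList (c : ℝ) (l : List (ℝ × X × X)) :
    c • (ofList l : Mol p X) = ofList (l.map fun t => (c * t.1, t.2)) := by
  induction l with
  | nil => simp [ofList]
  | cons t l ih => simp_all [ofList, mul_smul]

theorem map_ofList (f : X → Y) (l : List (ℝ × X × X)) :
    map f (ofList l : Mol p X) = ofList (l.map fun t => (t.1, f t.2.1, f t.2.2)) := by
  induction l with
  | nil => simp [ofList]
  | cons t l ih => simp_all [ofList]

/-- Every molecule is a linear combination of elementary ones. -/
theorem exists_ofList (m : Mol p X) : ∃ l, ofList l = m := by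
  rcases isEmpty_or_nonempty X with hX | ⟨⟨o⟩⟩
  · exact ⟨[], Subtype.ext (Subsingleton.elim _ _)⟩
  · have key : ∀ g : X →₀ ℝ, ∃ l : List (ℝ × X × X),
        ((ofList l : Mol p X) : LinearMap.ker _).1
          = g - Finsupp.single o (Finsupp.linearCombination ℝ (fun _ : X => (1 : ℝ)) g) := by
      intro g
      induction g using Finsupp.induction_linear with
      | zero => exact ⟨[], by simp [ofList]; rfl⟩
      | add g h hg hh =>
        obtain ⟨l, hl⟩ := hg
        obtain ⟨l', hl'⟩ := hh
        refine ⟨l ++ l', ?_⟩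
        rw [ofList_append]
        change ((ofList l : Mol p X) : LinearMap.ker _).1 +
          ((ofList l' : Mol p X) : LinearMap.ker _).1 = _
        rw [hl, hl', map_add, Finsupp.single_add]
        abel
      | single x a =>
        refine ⟨[(a, x, o)], ?_⟩
        simp only [ofList, List.map_cons, List.map_nil, List.sum_cons, List.sum_nil, add_zero]
        change a • (Finsupp.single x (1 : ℝ) - Finsupp.single o 1) = _
        simp [smul_sub]
    obtain ⟨l, hl⟩ := key (Subtype.val (p := fun g => g ∈ LinearMap.ker _) m)
    refine ⟨l, Subtype.ext (hl.trans ?_)⟩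
    have hm : Finsupp.linearCombination ℝ (fun _ : X => (1 : ℝ))
        (Subtype.val (p := fun g => g ∈ LinearMap.ker _) m) = 0 :=
      Subtype.property (p := fun g => g ∈ LinearMap.ker _) m
    rw [hm]
    simp

variable [PseudoMetricSpace X] [PseudoMetricSpace Y]

/-- The cost `∑ (|a| d(x, y)) ^ p` of a representation `∑ a (δ(x) - δ(y))`. -/
def cost (p : Set.Ioc (0 : ℝ) 1) (l : List (ℝ × X × X)) : ℝ :=
  (l.map fun t => (|t.1| * dist t.2.1 t.2.2) ^ (p : ℝ)).sum

theorem cost_nonneg (l : List (ℝ × X × X)) : 0 ≤ cost p l := by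
  refine List.sum_nonneg fun c hc => ?_
  obtain ⟨t, -, rfl⟩ := List.mem_map.1 hc
  positivity

theorem cost_append (l l' : List (ℝ × X × X)) : cost p (l ++ l') = cost p l + cost p l' := by
  simp [cost]

theorem cost_smul (c : ℝ) (l : List (ℝ × X × X)) :
    cost p (l.map fun t => (c * t.1, t.2)) = |c| ^ (p : ℝ) * cost p l := by
  induction l with
  | nil => simp [cost]
  | cons t l ih =>
    simp only [cost, List.map_cons, List.sum_cons] at ih ⊢
    rw [ih, abs_mul, mul_assoc, Real.mul_rpow (by positivity) (by positivity)]
    ring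

theorem cost_map_le {K : ℝ≥0} {f : X → Y} (hf : LipschitzWith K f) (l : List (ℝ × X × X)) :
    cost p (l.map fun t => (t.1, f t.2.1, f t.2.2)) ≤ (K : ℝ) ^ (p : ℝ) * cost p l := by
  induction l with
  | nil => simp [cost]
  | cons t l ih =>
    simp only [cost, List.map_cons, List.sum_cons] at ih ⊢
    rw [mul_add]
    refine add_le_add ?_ ih
    rw [← Real.mul_rpow (by positivity) (by positivity)]
    refine Real.rpow_le_rpow (by positivity) ?_ p.2.1.le
    calc |t.1| * dist (f t.2.1) (f t.2.2) ≤ |t.1| * (K * dist t.2.1 t.2.2) := by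
          gcongr; exact hf.dist_le_mul _ _
      _ = _ := by ring

/-- The `p`-th power of the `p`-norm of a molecule `m`: the infimum of `∑ (|a| d(x, y)) ^ p` over
all representations `m = ∑ a (δ(x) - δ(y))`. -/
def gauge (m : Mol p X) : ℝ :=
  sInf {c | ∃ l : List (ℝ × X × X), ofList l = m ∧ cost p l = c}

theorem gauge_le {m : Mol p X} {l : List (ℝ × X × X)} (h : ofList l = m) :
    gauge m ≤ cost p l :=
  csInf_le ⟨0, by rintro c ⟨l, -, rfl⟩; exact cost_nonneg l⟩ ⟨l, h, rfl⟩

theorem le_gauge {m : Mol p X} {b : ℝ}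
    (h : ∀ l : List (ℝ × X × X), ofList l = m → b ≤ cost p l) : b ≤ gauge m := by
  obtain ⟨l, hl⟩ := exists_ofList m
  refine le_csInf ⟨_, l, hl, rfl⟩ ?_
  rintro c ⟨l, hl, rfl⟩
  exact h l hl

theorem gauge_nonneg (m : Mol p X) : 0 ≤ gauge m := le_gauge fun l _ => cost_nonneg l

theorem gauge_zero : gauge (0 : Mol p X) = 0 :=
  le_antisymm (by simpa [cost] using gauge_le (p := p) (X := X) (m := 0) (l := []) rfl)
    (gauge_nonneg _)

theorem gauge_add_le (m m' : Mol p X) : gauge (m + m') ≤ gauge m + gauge m' := by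
  rw [← sub_le_iff_le_add]
  refine le_gauge fun l hl => ?_
  rw [sub_le_comm]
  refine le_gauge fun l' hl' => ?_
  rw [sub_le_iff_le_add, add_comm, ← cost_append]
  exact gauge_le (by rw [ofList_append, hl, hl'])

theorem gauge_smul_le (c : ℝ) (m : Mol p X) : gauge (c • m) ≤ |c| ^ (p : ℝ) * gauge m := by
  rcases eq_or_ne c 0 with rfl | hc
  · simp [gauge_zero, Real.zero_rpow p.2.1.ne']
  have hc' : 0 < |c| ^ (p : ℝ) := Real.rpow_pos_of_pos (abs_pos.2 hc) _
  rw [← div_le_iff₀' hc']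
  refine le_gauge fun l hl => ?_
  rw [div_le_iff₀' hc', ← cost_smul]
  exact gauge_le (by rw [← smul_ofList, hl])

theorem gauge_smul (c : ℝ) (m : Mol p X) : gauge (c • m) = |c| ^ (p : ℝ) * gauge m := by
  refine le_antisymm (gauge_smul_le c m) ?_
  rcases eq_or_ne c 0 with rfl | hc
  · simp [gauge_zero, Real.zero_rpow p.2.1.ne']
  have hc' : 0 < |c| ^ (p : ℝ) := Real.rpow_pos_of_pos (abs_pos.2 hc) _
  have h := gauge_smul_le c⁻¹ (c • m)
  rwa [inv_smul_smul₀ hc, abs_inv, Real.inv_rpow (abs_nonneg c), ← div_eq_inv_mul,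
    le_div_iff₀' hc'] at h

theorem gauge_map_le {K : ℝ≥0} {f : X → Y} (hf : LipschitzWith K f) (m : Mol p X) :
    gauge (map f m) ≤ (K : ℝ) ^ (p : ℝ) * gauge m := by
  rcases eq_or_ne K 0 with rfl | hK
  · obtain ⟨l, hl⟩ := exists_ofList m
    refine (gauge_le (by rw [← map_ofList, hl])).trans ((cost_map_le hf l).trans ?_)
    simp [Real.zero_rpow p.2.1.ne']
  · have hK' : 0 < (K : ℝ) ^ (p : ℝ) := Real.rpow_pos_of_pos (NNReal.coe_pos.2 hK.bot_lt) _
    rw [← div_le_iff₀' hK']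
    refine le_gauge fun l hl => ?_
    rw [div_le_iff₀' hK']
    exact (gauge_le (by rw [← map_ofList, hl])).trans (cost_map_le hf l)

instance : SeminormedAddCommGroup (Mol p X) :=
  AddGroupSeminorm.toSeminormedAddCommGroup
    { toFun := gauge
      map_zero' := gauge_zero
      add_le' := gauge_add_le
      neg' := fun m => by
        have h := gauge_smul (-1) m
        simpa using h }

theorem norm_def (m : Mol p X) : ‖m‖ = gauge m := rfl

theorem norm_smul_eq (c : ℝ) (m : Mol p X) : ‖c • m‖ = |c| ^ (p : ℝ) * ‖m‖ := gauge_smul c m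

instance : UniformContinuousConstSMul ℝ (Mol p X) where
  uniformContinuous_const_smul c := by
    have h : LipschitzWith (Real.toNNReal (|c| ^ (p : ℝ))) fun m : Mol p X => c • m := by
      refine LipschitzWith.of_dist_le_mul fun m m' => ?_
      rw [dist_eq_norm, dist_eq_norm, ← smul_sub, norm_smul_eq,
        Real.coe_toNNReal _ (by positivity)]
    exact h.uniformContinuous

/-- The push-forward by a Lipschitz map, as a continuous linear map. -/
def mapL {K : ℝ≥0} (f : X → Y) (hf : LipschitzWith K f) : Mol p X →L[ℝ] Mol p Y :=
  { map f with
    cont := by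
      have h : LipschitzWith (Real.toNNReal ((K : ℝ) ^ (p : ℝ))) (map f : Mol p X → Mol p Y) := by
        refine LipschitzWith.of_dist_le_mul fun m m' => ?_
        rw [dist_eq_norm, dist_eq_norm, ← map_sub, Real.coe_toNNReal _ (by positivity)]
        exact gauge_map_le hf _
      exact h.continuous }

end Mol

/-! ### Lipschitz free `p`-spaces -/

/-- The Lipschitz free `p`-space `F_p(X)`: the completion of the space of molecules for the
`p`-norm `‖m‖ = inf (∑ (|a| d(x, y)) ^ p) ^ (1 / p)` over all `m = ∑ a (δ(x) - δ(y))`. -/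
abbrev FreeSpace (p : Set.Ioc (0 : ℝ) 1) (X : Type u) [PseudoMetricSpace X] : Type u :=
  UniformSpace.Completion (Mol p X)

namespace FreeSpace

variable {p : Set.Ioc (0 : ℝ) 1} {X : Type u} {Y : Type v} [PseudoMetricSpace X]
  [PseudoMetricSpace Y]

instance : PNormed p (FreeSpace p X) where
  norm_smul_eq a x := by
    induction x using UniformSpace.Completion.induction_on with
    | hp =>
      exact isClosed_eq (continuous_norm.comp (continuous_const_smul a))
        (continuous_const.mul continuous_norm)
    | ih m =>
      rw [← UniformSpace.Completion.coe_smul, UniformSpace.Completion.norm_coe,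
        UniformSpace.Completion.norm_coe, Mol.norm_smul_eq]

/-- `δ(x) - δ(y)` as an element of `F_p(X)`. -/
def atom (p : Set.Ioc (0 : ℝ) 1) (x y : X) : FreeSpace p X := ((Mol.atom x y : Mol p X) : _)

/-- The canonical linearization `L_f : F_p(X) → F_p(Y)` of a Lipschitz map `f`: the bounded linear
operator with `L_f (δ(x) - δ(y)) = δ(f x) - δ(f y)`. -/
def linearization (p : Set.Ioc (0 : ℝ) 1) {K : ℝ≥0} (f : X → Y) (hf : LipschitzWith K f) :
    FreeSpace p X →L[ℝ] FreeSpace p Y :=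
  (Mol.mapL f hf : Mol p X →L[ℝ] Mol p Y).completion

theorem linearization_atom {K : ℝ≥0} (f : X → Y) (hf : LipschitzWith K f) (x y : X) :
    linearization p f hf (atom p x y) = atom p (f x) (f y) := by
  have h := ContinuousLinearMap.completion_apply_coe (Mol.mapL f hf : Mol p X →L[ℝ] Mol p Y)
    (Mol.atom x y)
  refine h.trans ?_
  exact congrArg _ (Mol.map_atom f x y)

theorem qnorm_atom_le (x y : X) : qnorm p (atom p x y) ≤ dist x y := by
  have h : ‖atom p x y‖ ≤ dist x y ^ (p : ℝ) := by
    rw [atom, UniformSpace.Completion.norm_coe, Mol.norm_def]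
    refine (Mol.gauge_le (l := [(1, x, y)]) (by simp [Mol.ofList])).trans ?_
    simp [Mol.cost]
  rw [qnorm]
  calc ‖atom p x y‖ ^ (1 / (p : ℝ)) ≤ (dist x y ^ (p : ℝ)) ^ (1 / (p : ℝ)) :=
        Real.rpow_le_rpow (norm_nonneg _) h (by have := p.2.1; positivity)
    _ = dist x y := by
        rw [← Real.rpow_mul dist_nonneg, mul_one_div_cancel p.2.1.ne', Real.rpow_one]

/-- The universal property that characterizes `F_p(X)` among `p`-Banach spaces: every `L`-Lipschitz
map `f` from `X` to a `p`-Banach space extends uniquely to a bounded linear operator `T` with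
`T (δ(x) - δ(y)) = f x - f y`, and `‖T‖ ≤ L`. -/
theorem existsUnique_lift {Z : Type w} [NormedAddCommGroup Z] [Module ℝ Z] [PNormed p Z]
    [CompleteSpace Z] (f : X → Z) {L : ℝ} (hL : 0 ≤ L)
    (hf : ∀ x y, qnorm p (f x - f y) ≤ L * dist x y) :
    (∃! T : FreeSpace p X →L[ℝ] Z, ∀ x y, T (atom p x y) = f x - f y) ∧
      ∃ T : FreeSpace p X →L[ℝ] Z, (∀ x y, T (atom p x y) = f x - f y) ∧
        OpBound p L T.toLinearMap := by
  have hp := p.2.1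
  have : UniformContinuousConstSMul ℝ Z := ⟨fun c => by
    have h : LipschitzWith (Real.toNNReal (|c| ^ (p : ℝ))) fun m : Z => c • m := by
      refine LipschitzWith.of_dist_le_mul fun m m' => ?_
      rw [dist_eq_norm, dist_eq_norm, ← smul_sub, PNormed.norm_smul_eq (p := p),
        Real.coe_toNNReal _ (by positivity)]
    exact h.uniformContinuous⟩
  have hf' (x y : X) : ‖f x - f y‖ ≤ L ^ (p : ℝ) * dist x y ^ (p : ℝ) := by
    rw [← Real.mul_rpow hL dist_nonneg]
    refine le_trans (le_of_eq ?_) (Real.rpow_le_rpow (by unfold qnorm; positivity) (hf x y) hp.le)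
    rw [qnorm, ← Real.rpow_mul (norm_nonneg _), one_div, inv_mul_cancel₀ hp.ne', Real.rpow_one]
  let g : Mol p X →ₗ[ℝ] Z := (Finsupp.linearCombination ℝ f) ∘ₗ (LinearMap.ker _).subtype
  have hg (x y : X) : g (Mol.atom x y) = f x - f y := by
    change Finsupp.linearCombination ℝ f (Finsupp.single x 1 - Finsupp.single y 1) = _
    simp
  have hgl (l : List (ℝ × X × X)) : ‖g (Mol.ofList l)‖ ≤ L ^ (p : ℝ) * Mol.cost p l := by
    induction l with
    | nil => simp [Mol.ofList, Mol.cost]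
    | cons t l ih =>
      simp only [Mol.ofList, Mol.cost, List.map_cons, List.sum_cons] at ih ⊢
      rw [map_add, map_smul, hg, mul_add]
      refine (norm_add_le _ _).trans (add_le_add ?_ ih)
      rw [PNormed.norm_smul_eq (p := p), Real.mul_rpow (abs_nonneg _) dist_nonneg, mul_left_comm]
      exact mul_le_mul_of_nonneg_left (hf' _ _) (by positivity)
  have hgm (m : Mol p X) : ‖g m‖ ≤ L ^ (p : ℝ) * ‖m‖ := by
    rcases hL.eq_or_lt with rfl | hL
    · obtain ⟨l, rfl⟩ := Mol.exists_ofList m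
      refine (hgl l).trans ?_
      simp [Real.zero_rpow hp.ne']
    · have hL' : 0 < L ^ (p : ℝ) := Real.rpow_pos_of_pos hL _
      rw [← div_le_iff₀' hL']
      refine Mol.le_gauge fun l hl => ?_
      rw [div_le_iff₀' hL', ← hl]
      exact hgl l
  let G : Mol p X →L[ℝ] Z :=
    { g with
      cont := by
        have h : LipschitzWith (Real.toNNReal (L ^ (p : ℝ))) g := by
          refine LipschitzWith.of_dist_le_mul fun m m' => ?_
          rw [dist_eq_norm, dist_eq_norm, ← map_sub, Real.coe_toNNReal _ (by positivity)]
          exact hgm _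
        exact h.continuous }
  have hT (m : Mol p X) : G.fromCompletion (m : FreeSpace p X) = g m :=
    ContinuousLinearMap.fromCompletion_apply_coe G m
  have hTa (x y : X) : G.fromCompletion (atom p x y) = f x - f y := (hT _).trans (hg x y)
  refine ⟨⟨G.fromCompletion, hTa, fun S hS => ?_⟩, G.fromCompletion, hTa, hL, fun z => ?_⟩
  · ext z
    induction z using UniformSpace.Completion.induction_on with
    | hp => exact isClosed_eq S.continuous G.fromCompletion.continuous
    | ih m =>
      obtain ⟨l, rfl⟩ := Mol.exists_ofList m
      induction l with
      | nil =>
        change S ((0 : Mol p X) : FreeSpace p X) = G.fromCompletion ((0 : Mol p X) : FreeSpace p X)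
        rw [UniformSpace.Completion.coe_zero, map_zero, map_zero]
      | cons t l ih =>
        have e : ((Mol.ofList (t :: l) : Mol p X) : FreeSpace p X)
            = t.1 • atom p t.2.1 t.2.2 + ((Mol.ofList l : Mol p X) : FreeSpace p X) := by
          rw [atom, ← UniformSpace.Completion.coe_smul, ← UniformSpace.Completion.coe_add]
          simp [Mol.ofList]
        rw [e, map_add, map_add, map_smul, map_smul, ih, hS, hTa]
  · have hz : ‖G.fromCompletion z‖ ≤ L ^ (p : ℝ) * ‖z‖ := by
      induction z using UniformSpace.Completion.induction_on with
      | hp =>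
        exact isClosed_le (continuous_norm.comp G.fromCompletion.continuous)
          (continuous_const.mul continuous_norm)
      | ih m =>
        rw [hT, UniformSpace.Completion.norm_coe]
        exact hgm m
    calc ‖G.fromCompletion z‖ ^ (1 / (p : ℝ)) ≤ (L ^ (p : ℝ) * ‖z‖) ^ (1 / (p : ℝ)) :=
          Real.rpow_le_rpow (norm_nonneg _) hz (by positivity)
      _ = L * ‖z‖ ^ (1 / (p : ℝ)) := by
          rw [Real.mul_rpow (by positivity) (norm_nonneg _), ← Real.rpow_mul hL,
            mul_one_div_cancel hp.ne', Real.rpow_one]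

end FreeSpace

/-! ### Complementable amenability and annuli -/

/-- For `s ⊆ t` in a metric space, `s` is complementably `p`-amenable in `t` with constant `K`:
`F_p(s)` is `K`-complemented in `F_p(t)` via the canonical map. -/
def ComplAmenable (p : Set.Ioc (0 : ℝ) 1) {M : Type u} [PseudoMetricSpace M] (K : ℝ)
    (s t : Set M) : Prop :=
  ∃ h : s ⊆ t, ComplementedVia p K
    (FreeSpace.linearization p (Set.inclusion h)
      (LipschitzWith.id.restrict s : LipschitzWith 1 (Set.inclusion h))).toLinearMap

/-- `M_A = {x : d(o, x) ∈ A}` for a metric space `M` with base point `o`. -/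
def annulus {M : Type u} [PseudoMetricSpace M] (o : M) (A : Set ℝ) : Set M :=
  {x | dist o x ∈ A}

/-- `M_A^* = {o} ∪ M_A`. -/
def annulusStar {M : Type u} [PseudoMetricSpace M] (o : M) (A : Set ℝ) : Set M :=
  insert o (annulus o A)

end LipFree

end

/-! Every space in the conclusions is isomorphic to one model V (`AnnularSystem.model`): the
`ℓ_p`-sum of countably many copies of each `F_p({o} ∪ a_n)`, where the `a_n` are the annuli. Since ℕ
× ℕ ≃ ℕ, V is isometric to `ℓ_p(V)`. By Pełczyński's decomposition method (`NormIso.of_normCompl`),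
a space is then isomorphic to V once each is complemented in the other, and the isomorphism constant
depends only on the complementation constants.

F_p(M) inside V. Consecutive annuli overlap by a fixed amount on the scale `log d(o, ·)`, so a
partition of unity (w_n) subordinate to them exists whose members are Lipschitz in `log d(o, ·)`.
The map `δ(x) - δ(o) ↦ (w_n(x) (δ(x) - δ(o)))_n` is bounded, because varying the weight costs
`|w_n(x) - w_n(y)| d(o, y)`, which is of the order of `d(x, y)`. Adding up the components is a left
inverse (`exists_localization`, `AnnularSystem.normCompl_sum`).

V inside F_p(M). Adding the base point to an annulus adds one dimension to the free space
(`normIso_insert`), so `F_p({o} ∪ a_n)` is uniformly complemented in `F_p({o} ∪ a_m)` for nonempty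
`a_m` with `le n m`. The summands of V can therefore be sent to annuli `a_m` with pairwise disjoint
neighbourhoods `b_m`, each `a_m` amenable in `b_m`. Cutoffs that are 1 on `a_m` and live in `b_m`,
followed by retractions of `F_p(b_m)` onto `F_p(a_m)`, project F_p(M) onto the sum
(`AnnularSystem.normCompl_of_separated`).

The sums over N embed into V summand by summand, and V embeds into them because each n is dominated
by infinitely many of their indices. When the base points are missing, the lost dimension is
recovered from a second summand (`AnnularSystem.normIso_sum`).

`AnnularSystem` isolates what these arguments need. The three cases differ in the index set, the
relation `le`, and a truncation of the logarithmic coordinate at the end where the annuli stop. All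
estimates use p-th powers of p-norms, for which the ordinary triangle inequality holds; p-norms
return only through an exponent `1 / p` at the end. -/

open scoped NNReal ENNReal

noncomputable section

namespace LipFree

/-! ### Bounds in terms of the `p`-th powers of the `p`-norms -/

section NormBound

variable {X : Type*} [NormedAddCommGroup X] [Module ℝ X]
variable {Y : Type*} [NormedAddCommGroup Y] [Module ℝ Y]
variable {Z : Type*} [NormedAddCommGroup Z] [Module ℝ Z]

/-- `‖S x‖ ≤ c ‖x‖` for all `x`; here `‖·‖` is the `p`-th power of the `p`-norm. -/
def NormBound (c : ℝ) (S : X →ₗ[ℝ] Y) : Prop := ∀ x, ‖S x‖ ≤ c * ‖x‖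

theorem NormBound.continuous {c : ℝ} {S : X →ₗ[ℝ] Y} (h : NormBound c S) : Continuous S :=
  AddMonoidHomClass.continuous_of_bound S c h

theorem NormBound.mono {c d : ℝ} {S : X →ₗ[ℝ] Y} (h : NormBound c S) (hcd : c ≤ d) :
    NormBound d S := fun x => (h x).trans (mul_le_mul_of_nonneg_right hcd (norm_nonneg _))

theorem NormBound.comp {c d : ℝ} {S : X →ₗ[ℝ] Y} {T : Y →ₗ[ℝ] Z} (hd : 0 ≤ d)
    (hT : NormBound d T) (hS : NormBound c S) : NormBound (d * c) (T ∘ₗ S) := fun x =>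
  (hT _).trans (by rw [mul_assoc]; exact mul_le_mul_of_nonneg_left (hS x) hd)

theorem NormBound.sub {c d : ℝ} {S T : X →ₗ[ℝ] Y}
    (hS : NormBound c S) (hT : NormBound d T) : NormBound (c + d) (S - T) := fun x => by
  rw [add_mul]
  exact (norm_sub_le _ _).trans (add_le_add (hS x) (hT x))

theorem normBound_id : NormBound 1 (LinearMap.id : X →ₗ[ℝ] X) := fun x => by simp

theorem NormBound.opBound {c : ℝ} {S : X →ₗ[ℝ] Y} (p : Set.Ioc (0 : ℝ) 1) (hc : 0 ≤ c)
    (h : NormBound c S) : OpBound p (c ^ (1 / (p : ℝ))) S := by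
  refine ⟨by positivity, fun x => ?_⟩
  rw [qnorm, qnorm, ← Real.mul_rpow hc (norm_nonneg _)]
  exact Real.rpow_le_rpow (norm_nonneg _) (h x) (by have := p.2.1; positivity)

theorem OpBound.normBound {a : ℝ} {S : X →ₗ[ℝ] Y} {p : Set.Ioc (0 : ℝ) 1}
    (h : OpBound p a S) : NormBound (a ^ (p : ℝ)) S := fun x => by
  have hp := p.2.1
  have key := Real.rpow_le_rpow (by unfold qnorm; positivity) (h.2 x) hp.le
  rw [qnorm, qnorm, Real.mul_rpow h.1 (by positivity), ← Real.rpow_mul (norm_nonneg _),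
    ← Real.rpow_mul (norm_nonneg _), one_div, inv_mul_cancel₀ hp.ne', Real.rpow_one,
    Real.rpow_one] at key
  exact key

end NormBound

/-- `X` embeds into `Y` with a left inverse, both maps being bounded by `c`. -/
def NormCompl (c : ℝ) (X : Type*) [NormedAddCommGroup X] [Module ℝ X]
    (Y : Type*) [NormedAddCommGroup Y] [Module ℝ Y] : Prop :=
  ∃ (S : X →ₗ[ℝ] Y) (T : Y →ₗ[ℝ] X), NormBound c S ∧ NormBound c T ∧ ∀ x, T (S x) = x

/-- `X` and `Y` are isomorphic, both maps being bounded by `c`. -/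
def NormIso (c : ℝ) (X : Type*) [NormedAddCommGroup X] [Module ℝ X]
    (Y : Type*) [NormedAddCommGroup Y] [Module ℝ Y] : Prop :=
  ∃ (S : X →ₗ[ℝ] Y) (T : Y →ₗ[ℝ] X), NormBound c S ∧ NormBound c T ∧
    (∀ x, T (S x) = x) ∧ ∀ y, S (T y) = y

/-! ### Calculus of complemented embeddings and isomorphisms -/

section Basic

variable {X : Type*} [NormedAddCommGroup X] [Module ℝ X]
variable {Y : Type*} [NormedAddCommGroup Y] [Module ℝ Y]
variable {Z : Type*} [NormedAddCommGroup Z] [Module ℝ Z]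
variable {X' : Type*} [NormedAddCommGroup X'] [Module ℝ X']
variable {Y' : Type*} [NormedAddCommGroup Y'] [Module ℝ Y']
variable {c d : ℝ}

theorem NormCompl.mono (h : NormCompl c X Y) (hcd : c ≤ d) : NormCompl d X Y := by
  obtain ⟨S, T, hS, hT, e⟩ := h
  exact ⟨S, T, hS.mono hcd, hT.mono hcd, e⟩

theorem NormCompl.trans (hc : 0 ≤ c) (hd : 0 ≤ d) (h : NormCompl c X Y) (h' : NormCompl d Y Z) :
    NormCompl (c * d) X Z := by
  obtain ⟨S, T, hS, hT, e⟩ := h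
  obtain ⟨S', T', hS', hT', e'⟩ := h'
  exact ⟨S' ∘ₗ S, T ∘ₗ T', (hS'.comp hd hS).mono (mul_comm d c).le, hT.comp hc hT',
    fun x => by simp [e, e']⟩

theorem NormCompl.of_subsingleton [Subsingleton X] (hc : 0 ≤ c) : NormCompl c X Y :=
  ⟨0, 0, fun x => by simpa using by positivity, fun x => by simpa using by positivity,
    fun x => Subsingleton.elim _ _⟩

theorem NormCompl.refl : NormCompl 1 X X :=
  ⟨LinearMap.id, LinearMap.id, normBound_id, normBound_id, fun _ => rfl⟩

theorem NormCompl.subsingleton (h : NormCompl c X Y) [Subsingleton Y] : Subsingleton X := by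
  obtain ⟨S, T, -, -, e⟩ := h
  exact ⟨fun x y => by rw [← e x, ← e y, Subsingleton.elim (S x) (S y)]⟩

theorem NormCompl.prod (hc : 0 ≤ c) (h : NormCompl c X Y) (h' : NormCompl c X' Y') :
    NormCompl c (X × X') (Y × Y') := by
  obtain ⟨S, T, hS, hT, e⟩ := h
  obtain ⟨S', T', hS', hT', e'⟩ := h'
  refine ⟨S.prodMap S', T.prodMap T', fun x => ?_, fun x => ?_, fun x => by simp [e, e']⟩
  · exact max_le ((hS _).trans (mul_le_mul_of_nonneg_left (norm_fst_le x) hc))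
      ((hS' _).trans (mul_le_mul_of_nonneg_left (norm_snd_le x) hc))
  · exact max_le ((hT _).trans (mul_le_mul_of_nonneg_left (norm_fst_le x) hc))
      ((hT' _).trans (mul_le_mul_of_nonneg_left (norm_snd_le x) hc))

theorem NormCompl.prod_left (X' : Type*) [NormedAddCommGroup X'] [Module ℝ X'] :
    NormCompl 1 X (X × X') :=
  ⟨LinearMap.inl ℝ X X', LinearMap.fst ℝ X X', fun x => by simp [Prod.norm_def],
    fun x => by simpa using norm_fst_le x, fun x => by simp⟩

theorem NormIso.compl (h : NormIso c X Y) : NormCompl c X Y := by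
  obtain ⟨S, T, hS, hT, e, -⟩ := h
  exact ⟨S, T, hS, hT, e⟩

theorem NormIso.symm (h : NormIso c X Y) : NormIso c Y X := by
  obtain ⟨S, T, hS, hT, e, e'⟩ := h
  exact ⟨T, S, hT, hS, e', e⟩

theorem NormIso.trans (hc : 0 ≤ c) (hd : 0 ≤ d) (h : NormIso c X Y) (h' : NormIso d Y Z) :
    NormIso (c * d) X Z := by
  obtain ⟨S, T, hS, hT, e, f⟩ := h
  obtain ⟨S', T', hS', hT', e', f'⟩ := h'
  exact ⟨S' ∘ₗ S, T ∘ₗ T', (hS'.comp hd hS).mono (mul_comm d c).le, hT.comp hc hT',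
    fun x => by simp [e, e'], fun x => by simp [f, f']⟩

theorem NormIso.prodComm : NormIso 1 (X × Y) (Y × X) :=
  ⟨(LinearEquiv.prodComm ℝ X Y).toLinearMap, (LinearEquiv.prodComm ℝ Y X).toLinearMap,
    fun x => by simp [Prod.norm_def, max_comm], fun x => by simp [Prod.norm_def, max_comm],
    fun x => rfl, fun x => rfl⟩

theorem NormIso.prod_right (hc : 1 ≤ c) (h : NormIso c X Y) : NormIso c (Z × X) (Z × Y) := by
  obtain ⟨S, T, hS, hT, e, f⟩ := h
  refine ⟨LinearMap.id.prodMap S, LinearMap.id.prodMap T, fun x => ?_, fun x => ?_,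
    fun x => by simp [e], fun x => by simp [f]⟩
  · exact max_le ((norm_fst_le x).trans (le_mul_of_one_le_left (norm_nonneg _) hc))
      ((hS _).trans (mul_le_mul_of_nonneg_left (norm_snd_le x) (by linarith)))
  · exact max_le ((norm_fst_le x).trans (le_mul_of_one_le_left (norm_nonneg _) hc))
      ((hT _).trans (mul_le_mul_of_nonneg_left (norm_snd_le x) (by linarith)))

theorem NormIso.isom (p : Set.Ioc (0 : ℝ) 1) (hc : 0 ≤ c) (h : NormIso c X Y) {C : ℝ}
    (hC : c ^ (1 / (p : ℝ)) * c ^ (1 / (p : ℝ)) ≤ C) : Isom p C X Y := by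
  obtain ⟨S, T, hS, hT, e, f⟩ := h
  exact ⟨S, T, _, _, hS.opBound p hc, hT.opBound p hc, hC, LinearMap.ext e, LinearMap.ext f⟩

theorem OpBound.comp {p : Set.Ioc (0 : ℝ) 1} {a b : ℝ} {S : X →ₗ[ℝ] Y} {T : Y →ₗ[ℝ] Z}
    (hT : OpBound p b T) (hS : OpBound p a S) : OpBound p (b * a) (T ∘ₗ S) :=
  ⟨mul_nonneg hT.1 hS.1, fun x => (hT.2 _).trans (by
    rw [mul_assoc]
    exact mul_le_mul_of_nonneg_left (hS.2 x) hT.1)⟩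

/-- Only the product of the two norms is controlled, so S is divided and T multiplied by the bound
`a` of S. If `a = 0`, then S = 0 and X is trivial. -/
theorem Complemented.normCompl {p : Set.Ioc (0 : ℝ) 1} {K : ℝ} (hK : 1 ≤ K) [PNormed p X]
    [PNormed p Y] (h : Complemented p K X Y) : NormCompl (K ^ (p : ℝ)) X Y := by
  have hp := p.2.1
  have hK' : 1 ≤ K ^ (p : ℝ) := Real.one_le_rpow hK hp.le
  obtain ⟨S, T, a, b, hS, hT, hab, e⟩ := h
  have e' (x : X) : T (S x) = x := LinearMap.congr_fun e x
  rcases hS.1.eq_or_lt with ha | ha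
  · have : Subsingleton X := by
      have hz (x : X) : x = 0 := by
        have h1 := hS.normBound x
        rw [← ha, Real.zero_rpow hp.ne', zero_mul] at h1
        rw [← e' x, norm_le_zero_iff.1 h1, map_zero]
      exact ⟨fun x y => (hz x).trans (hz y).symm⟩
    exact NormCompl.of_subsingleton (by linarith)
  · have ha' : 0 < a ^ (p : ℝ) := Real.rpow_pos_of_pos ha _
    refine ⟨a⁻¹ • S, a • T, fun x => ?_, fun y => ?_, fun x => ?_⟩
    · rw [LinearMap.smul_apply, PNormed.norm_smul_eq (p := p), abs_inv, abs_of_pos ha,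
        Real.inv_rpow ha.le]
      refine le_trans ?_ (le_mul_of_one_le_left (norm_nonneg _) hK')
      rw [inv_mul_le_iff₀ ha']
      exact hS.normBound x
    · rw [LinearMap.smul_apply, PNormed.norm_smul_eq (p := p), abs_of_pos ha]
      refine (mul_le_mul_of_nonneg_left (hT.normBound y) ha'.le).trans ?_
      rw [← mul_assoc, ← Real.mul_rpow ha.le hT.1]
      exact mul_le_mul_of_nonneg_right
        (Real.rpow_le_rpow (mul_nonneg ha.le hT.1) hab hp.le) (norm_nonneg _)
    · simp [smul_smul, ha.ne', e']

theorem Isom.complemented {p : Set.Ioc (0 : ℝ) 1} {K : ℝ} (h : Isom p K X Y) :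
    Complemented p K X Y := by
  obtain ⟨S, T, a, b, hS, hT, hab, e, -⟩ := h
  exact ⟨S, T, a, b, hS, hT, hab, e⟩

theorem Complemented.trans {p : Set.Ioc (0 : ℝ) 1} {K K' : ℝ} (h : Complemented p K X Y)
    (h' : Complemented p K' Y Z) : Complemented p (K * K') X Z := by
  obtain ⟨S, T, a, b, hS, hT, hab, e⟩ := h
  obtain ⟨S', T', a', b', hS', hT', hab', e'⟩ := h'
  refine ⟨S' ∘ₗ S, T ∘ₗ T', a' * a, b * b', hS'.comp hS, hT.comp hT', ?_, ?_⟩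
  · have h1 := mul_nonneg hS.1 hT.1
    have h2 := mul_nonneg hS'.1 hT'.1
    calc a' * a * (b * b') = a * b * (a' * b') := by ring
      _ ≤ K * K' := mul_le_mul hab hab' h2 (h1.trans hab)
  · refine LinearMap.ext fun x => ?_
    exact (congrArg T (LinearMap.congr_fun e' (S x))).trans (LinearMap.congr_fun e x)

theorem Isom.symm {p : Set.Ioc (0 : ℝ) 1} {K : ℝ} (h : Isom p K X Y) : Isom p K Y X := by
  obtain ⟨S, T, a, b, hS, hT, hab, e, f⟩ := h
  exact ⟨T, S, b, a, hT, hS, by rwa [mul_comm], f, e⟩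

end Basic

/-! ### Operators on `ℓ_p`-sums -/

namespace LpSum

variable {p : Set.Ioc (0 : ℝ) 1} {ι : Type v} {X : ι → Type w} [∀ i, NormedAddCommGroup (X i)]

instance [∀ i, CompleteSpace (X i)] : CompleteSpace (LpSum p X) :=
  inferInstanceAs (CompleteSpace (lp X 1))

theorem sum_norm_coord_le (x : LpSum p X) (s : Finset ι) : ∑ i ∈ s, ‖coord x i‖ ≤ ‖x‖ := by
  rw [norm_eq]
  exact (summable_norm x).sum_le_tsum s fun _ _ => norm_nonneg _

theorem norm_coord_le (x : LpSum p X) (i : ι) : ‖coord x i‖ ≤ ‖x‖ := by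
  simpa using sum_norm_coord_le x {i}

theorem norm_le_of_sum_le {x : LpSum p X} {c : ℝ}
    (h : ∀ s : Finset ι, ∑ i ∈ s, ‖coord x i‖ ≤ c) : ‖x‖ ≤ c := by
  rw [norm_eq]
  exact (summable_norm x).tsum_le_of_sum_le h

theorem sum_norm_comp_coordL_le [∀ i, Module ℝ (X i)] {Y : ι → Type*} [∀ i, NormedAddCommGroup (Y i)]
    [∀ i, Module ℝ (Y i)] {c : ℝ} (hc : 0 ≤ c) {S : ∀ i, X i →ₗ[ℝ] Y i}
    (hS : ∀ i, NormBound c (S i)) (z : LpSum p X) (s : Finset ι) :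
    ∑ i ∈ s, ‖S i (coord z i)‖ ≤ c * ‖z‖ := by
  refine (Finset.sum_le_sum fun i _ => hS i _).trans ?_
  rw [← Finset.mul_sum]
  exact mul_le_mul_of_nonneg_left (sum_norm_coord_le z s) hc

variable [∀ i, Module ℝ (X i)] [∀ i, PNormed p (X i)]

/-- The `i`-th coordinate as a linear map. -/
def coordL (i : ι) : LpSum p X →ₗ[ℝ] X i where
  toFun x := coord x i
  map_add' _ _ := rfl
  map_smul' _ _ := rfl

@[simp] theorem coordL_apply (i : ι) (x : LpSum p X) : coordL i x = coord x i := rfl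

theorem normBound_coordL (i : ι) : NormBound 1 (coordL i : LpSum p X →ₗ[ℝ] X i) := fun x => by
  simpa using norm_coord_le x i

open Classical in
/-- The canonical embedding of the `i`-th summand. -/
def single (i : ι) : X i →ₗ[ℝ] LpSum p X where
  toFun x := mk (Pi.single i x) (summable_of_ne_finset_zero (s := {i}) fun j hj => by
    rw [Pi.single_eq_of_ne (by simpa using hj), norm_zero])
  map_add' x y := ext fun j => by simp [Pi.single_add]
  map_smul' a x := ext fun j => by simp [Pi.single_smul]

@[simp] theorem coord_single_same (i : ι) (x : X i) : coord (single (p := p) i x) i = x := by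
  simp [single]

theorem coord_single_ne {i j : ι} (h : j ≠ i) (x : X i) :
    coord (single (p := p) i x) j = 0 := by
  classical
  exact Pi.single_eq_of_ne h x

theorem norm_single (i : ι) (x : X i) : ‖single (p := p) i x‖ = ‖x‖ := by
  rw [norm_eq, tsum_eq_single i, coord_single_same]
  intro j hj
  rw [coord_single_ne hj, norm_zero]

theorem hasSum_single (x : LpSum p X) : HasSum (fun i => single i (coord x i)) x := by
  classical
  exact lp.hasSum_single (p := 1) (by norm_num) (show lp X 1 from x)

variable {Z : Type*} [NormedAddCommGroup Z] [Module ℝ Z]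

theorem hom_ext {S T : LpSum p X →ₗ[ℝ] Z} {c d : ℝ} (hS : NormBound c S) (hT : NormBound d T)
    (h : ∀ i x, S (single i x) = T (single i x)) : S = T := by
  refine LinearMap.ext fun x => ?_
  have h1 := (hasSum_single x).map S hS.continuous
  have h2 := (hasSum_single x).map T hT.continuous
  refine h1.unique ?_
  have e : (S ∘ fun i => single i (coord x i)) = T ∘ fun i => single i (coord x i) :=
    funext fun i => h i _
  rwa [e]

/-- The operator on the `ℓ_p`-sum with given restrictions to the summands. -/
theorem exists_desc [PNormed p Z] [CompleteSpace Z] {c : ℝ} {S : ∀ i, X i →ₗ[ℝ] Z}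
    (hS : ∀ i, NormBound c (S i)) :
    ∃ U : LpSum p X →ₗ[ℝ] Z, NormBound c U ∧ ∀ i x, U (single i x) = S i x := by
  have hsn (x : LpSum p X) : Summable fun i => ‖S i (coord x i)‖ :=
    Summable.of_nonneg_of_le (fun _ => norm_nonneg _) (fun i => hS i _)
      ((summable_norm x).mul_left c)
  have hs (x : LpSum p X) : Summable fun i => S i (coord x i) := (hsn x).of_norm
  refine ⟨⟨⟨fun x => ∑' i, S i (coord x i), fun x y => ?_⟩, fun a x => ?_⟩, fun x => ?_,
    fun i x => ?_⟩
  · simp only [coord_add, map_add]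
    exact (hs x).tsum_add (hs y)
  · have hb : NormBound (|a| ^ (p : ℝ)) (a • LinearMap.id : Z →ₗ[ℝ] Z) := fun z =>
      (PNormed.norm_smul_eq (p := p) a z).le
    have h := (hs x).hasSum.map (a • LinearMap.id : Z →ₗ[ℝ] Z) hb.continuous
    simpa [Function.comp_def] using h.tsum_eq
  · refine (norm_tsum_le_tsum_norm (hsn x)).trans ?_
    rw [norm_eq, ← tsum_mul_left]
    exact (hsn x).tsum_le_tsum (fun i => hS i _) ((summable_norm x).mul_left c)
  · refine (tsum_eq_single i fun j hj => ?_).trans ?_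
    · rw [coord_single_ne hj, map_zero]
    · rw [coord_single_same]

/-- The operator into the `ℓ_p`-sum with given coordinates. -/
theorem exists_pi {c : ℝ} {T : ∀ i, Z →ₗ[ℝ] X i}
    (hT : ∀ z (s : Finset ι), ∑ i ∈ s, ‖T i z‖ ≤ c * ‖z‖) :
    ∃ U : Z →ₗ[ℝ] LpSum p X, NormBound c U ∧ ∀ z i, coord (U z) i = T i z := by
  have hs (z : Z) : Summable fun i => ‖T i z‖ :=
    summable_of_sum_le (fun _ => norm_nonneg _) (hT z)
  exact ⟨⟨⟨fun z => mk (fun i => T i z) (hs z), fun x y => ext fun i => by simp⟩,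
    fun a x => ext fun i => by simp⟩, fun z => norm_le_of_sum_le (hT z), fun z i => rfl⟩

/-- A biorthogonal system of embeddings and projections complements the `ℓ_p`-sum. -/
theorem normCompl_of_biorthogonal [PNormed p Z] [CompleteSpace Z] {c : ℝ}
    (S : ∀ i, X i →ₗ[ℝ] Z) (T : ∀ i, Z →ₗ[ℝ] X i) (hS : ∀ i, NormBound c (S i))
    (hT : ∀ z (s : Finset ι), ∑ i ∈ s, ‖T i z‖ ≤ c * ‖z‖)
    (h : ∀ i x, T i (S i x) = x) (h' : ∀ i j, j ≠ i → ∀ x, T j (S i x) = 0) :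
    NormCompl c (LpSum p X) Z := by
  rcases lt_or_ge c 0 with hc | hc
  -- A negative bound forces every summand to vanish.
  · have : Subsingleton (LpSum p X) := by
      refine ⟨fun x y => ext fun i => ?_⟩
      have hz (x : X i) : x = 0 := by
        have := (norm_nonneg _).trans (hS i x)
        exact norm_eq_zero.1 (le_antisymm (by nlinarith [norm_nonneg x]) (norm_nonneg _))
      rw [hz (coord x i), hz (coord y i)]
    refine ⟨0, 0, fun x => ?_, fun z => ?_, fun x => Subsingleton.elim _ _⟩
    · simp [Subsingleton.elim x 0]
    · simpa using hT z ∅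
  obtain ⟨U, hU, eU⟩ := exists_desc (p := p) hS
  obtain ⟨V, hV, eV⟩ := exists_pi (p := p) hT
  refine ⟨U, V, hU, hV, fun x => ?_⟩
  have key : V ∘ₗ U = LinearMap.id := by
    refine hom_ext (hV.comp hc hU) normBound_id fun i x => ext fun j => ?_
    rw [LinearMap.comp_apply, eU, eV, LinearMap.id_apply]
    rcases eq_or_ne j i with rfl | hj
    · rw [h, coord_single_same]
    · rw [h' i j hj, coord_single_ne hj]
  exact LinearMap.congr_fun key x

variable {κ : Type*} {Y : κ → Type*} [∀ k, NormedAddCommGroup (Y k)] [∀ k, Module ℝ (Y k)]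
  [∀ k, PNormed p (Y k)]

theorem normCompl_of_injective [∀ k, CompleteSpace (Y k)] {c : ℝ} (hc : 0 ≤ c) {σ : ι → κ}
    (hσ : Function.Injective σ) (h : ∀ i, NormCompl c (X i) (Y (σ i))) :
    NormCompl c (LpSum p X) (LpSum p Y) := by
  choose S T hS hT e using h
  refine normCompl_of_biorthogonal (fun i => single (σ i) ∘ₗ S i) (fun i => T i ∘ₗ coordL (σ i))
    (fun i x => ?_) (fun z s => ?_) (fun i x => ?_) fun i j hj x => ?_
  · rw [LinearMap.comp_apply, norm_single]
    exact hS i x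
  · refine (Finset.sum_le_sum fun i _ => hT i _).trans ?_
    rw [← Finset.mul_sum]
    refine mul_le_mul_of_nonneg_left ?_ hc
    have := sum_norm_coord_le z (s.map ⟨σ, hσ⟩)
    rwa [Finset.sum_map] at this
  · simp [e]
  · simp [coord_single_ne (hσ.ne hj)]

/-- This serves summands that need room in two target summands at once. The factor 2 compares the
maximum norm of the product with the sum of the norms of its two components. -/
theorem normCompl_of_injective_prod [∀ k, CompleteSpace (Y k)] {c : ℝ} (hc : 0 ≤ c)
    {σ : ι × Bool → κ} (hσ : Function.Injective σ)
    (h : ∀ i, NormCompl c (X i) (Y (σ (i, false)) × Y (σ (i, true)))) :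
    NormCompl (2 * c) (LpSum p X) (LpSum p Y) := by
  choose S T hS hT e using h
  have hft (i j : ι) : σ (i, false) ≠ σ (j, true) := hσ.ne (by simp)
  have htf (i j : ι) : σ (i, true) ≠ σ (j, false) := hσ.ne (by simp)
  refine normCompl_of_biorthogonal
    (fun i => (single (σ (i, false))).coprod (single (σ (i, true))) ∘ₗ S i)
    (fun i => T i ∘ₗ (coordL (σ (i, false))).prod (coordL (σ (i, true))))
    (fun i x => ?_) (fun z s => ?_) (fun i x => ?_) fun i j hj x => ?_
  · rw [LinearMap.comp_apply, LinearMap.coprod_apply]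
    refine (norm_add_le _ _).trans ?_
    rw [norm_single, norm_single]
    linarith [(norm_fst_le (S i x)).trans (hS i x), (norm_snd_le (S i x)).trans (hS i x)]
  · have h1 (i : ι) : ‖T i (coord z (σ (i, false)), coord z (σ (i, true)))‖ ≤
        c * (‖coord z (σ (i, false))‖ + ‖coord z (σ (i, true))‖) := by
      refine (hT i _).trans (mul_le_mul_of_nonneg_left ?_ hc)
      exact max_le (le_add_of_nonneg_right (norm_nonneg _))
        (le_add_of_nonneg_left (norm_nonneg _))
    refine (Finset.sum_le_sum fun i _ => h1 i).trans ?_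
    rw [← Finset.mul_sum, Finset.sum_add_distrib]
    have hf : Function.Injective fun i => σ (i, false) := fun i j h => by simpa using hσ h
    have ht : Function.Injective fun i => σ (i, true) := fun i j h => by simpa using hσ h
    have h2 := sum_norm_coord_le z (s.map ⟨_, hf⟩)
    have h3 := sum_norm_coord_le z (s.map ⟨_, ht⟩)
    rw [Finset.sum_map] at h2 h3
    simp only [Function.Embedding.coeFn_mk] at h2 h3
    nlinarith
  · simp [coord_single_ne (hft i i), coord_single_ne (htf i i), e]
  · have h1 : σ (j, false) ≠ σ (i, false) := hσ.ne (by simp [hj])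
    have h2 : σ (j, true) ≠ σ (i, true) := hσ.ne (by simp [hj])
    simp [coord_single_ne (hft j i), coord_single_ne (htf j i), coord_single_ne h1,
      coord_single_ne h2]
    exact (T j).map_zero

theorem normIso_congr {Y : ι → Type*} [∀ i, NormedAddCommGroup (Y i)] [∀ i, Module ℝ (Y i)]
    [∀ i, PNormed p (Y i)] {c : ℝ} (hc : 0 ≤ c) (h : ∀ i, NormIso c (X i) (Y i)) :
    NormIso c (LpSum p X) (LpSum p Y) := by
  choose S T hS hT e f using h
  obtain ⟨U, hU, eU⟩ := exists_pi (p := p) (T := fun i => S i ∘ₗ coordL i)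
    (sum_norm_comp_coordL_le (p := p) hc hS)
  obtain ⟨V, hV, eV⟩ := exists_pi (p := p) (T := fun i => T i ∘ₗ coordL i)
    (sum_norm_comp_coordL_le (p := p) hc hT)
  exact ⟨U, V, hU, hV, fun x => ext fun i => by simp [eU, eV, e],
    fun x => ext fun i => by simp [eU, eV, f]⟩

/-! ### Rearranging iterated `ℓ_p`-sums -/

section Nat

variable {I : Type v} (X : I → Type w) [∀ i, NormedAddCommGroup (X i)]

theorem coord_congr_fst {J : Type*} (x : LpSum p fun q : J × I => X q.2) {j k : J} (h : j = k)
    (i : I) : coord x (j, i) = coord x (k, i) := by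
  subst h
  rfl

variable [∀ i, Module ℝ (X i)] [∀ i, PNormed p (X i)]

theorem normIso_reindex {J J' : Type*} (e : J ≃ J') :
    NormIso 1 (LpSum p fun q : J × I => X q.2) (LpSum p fun q : J' × I => X q.2) := by
  have h1 (x : LpSum p fun q : J' × I => X q.2) :
      HasSum (fun q : J × I => ‖coord x (e q.1, q.2)‖) ‖x‖ := by
    have h := (summable_norm x).hasSum
    rw [← norm_eq] at h
    exact ((e.prodCongr (Equiv.refl I)).hasSum_iff (f := fun q => ‖coord x q‖)).2 h
  have h2 (x : LpSum p fun q : J × I => X q.2) :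
      HasSum (fun q : J' × I => ‖coord x (e.symm q.1, q.2)‖) ‖x‖ := by
    have h := (summable_norm x).hasSum
    rw [← norm_eq] at h
    exact ((e.symm.prodCongr (Equiv.refl I)).hasSum_iff (f := fun q => ‖coord x q‖)).2 h
  refine ⟨⟨⟨fun x => mk (fun q => coord x (e.symm q.1, q.2)) (h2 x).summable,
      fun x y => ext fun q => by simp⟩, fun a x => ext fun q => by simp⟩,
    ⟨⟨fun x => mk (fun q => coord x (e q.1, q.2)) (h1 x).summable,
      fun x y => ext fun q => by simp⟩, fun a x => ext fun q => by simp⟩,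
    fun x => ?_, fun x => ?_, fun x => ext fun q => ?_, fun x => ext fun q => ?_⟩
  · rw [one_mul, norm_eq]
    exact (h2 x).tsum_eq.le
  · rw [one_mul, norm_eq]
    exact (h1 x).tsum_eq.le
  · exact coord_congr_fst X x (e.symm_apply_apply q.1) q.2
  · exact coord_congr_fst X x (e.apply_symm_apply q.1) q.2

/-- Fubini for nonnegative series: both norms are the sum of the same family over a triple product.
-/
theorem normIso_curry {J J' : Type*} :
    NormIso 1 (LpSum p fun q : (J × J') × I => X q.2)
      (LpSum p fun _ : J => LpSum p fun q : J' × I => X q.2) := by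
  have h1 (x : LpSum p fun q : (J × J') × I => X q.2) :
      HasSum (fun r : J × (J' × I) => ‖coord x ((r.1, r.2.1), r.2.2)‖) ‖x‖ := by
    have h := (summable_norm x).hasSum
    rw [← norm_eq] at h
    exact ((Equiv.prodAssoc J J' I).symm.hasSum_iff (f := fun q => ‖coord x q‖)).2 h
  have h2 (z : LpSum p fun _ : J => LpSum p fun q : J' × I => X q.2) :
      HasSum (fun r : J × (J' × I) => ‖coord (coord z r.1) r.2‖) ‖z‖ := by
    have hs : Summable fun r : J × (J' × I) => ‖coord (coord z r.1) r.2‖ := by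
      refine (summable_prod_of_nonneg fun _ => norm_nonneg _).2
        ⟨fun i => summable_norm (coord z i), ?_⟩
      simpa only [← norm_eq] using summable_norm z
    have hz : ‖z‖ = ∑' r : J × (J' × I), ‖coord (coord z r.1) r.2‖ := by
      rw [hs.tsum_prod, norm_eq]
      simp only [← norm_eq]
    rw [hz]
    exact hs.hasSum
  have h3 (z : LpSum p fun _ : J => LpSum p fun q : J' × I => X q.2) :
      HasSum (fun q : (J × J') × I => ‖coord (coord z q.1.1) (q.1.2, q.2)‖) ‖z‖ :=
    (Equiv.prodAssoc J J' I).hasSum_iff.2 (h2 z)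
  let f (x : LpSum p fun q : (J × J') × I => X q.2) (i : J) : LpSum p fun q : J' × I => X q.2 :=
    mk (fun q => coord x ((i, q.1), q.2)) ((h1 x).summable.prod_factor i)
  have hf (x : LpSum p fun q : (J × J') × I => X q.2) (i : J) :
      ‖f x i‖ = ∑' q : J' × I, ‖coord x ((i, q.1), q.2)‖ := norm_eq _
  have hfs (x : LpSum p fun q : (J × J') × I => X q.2) : Summable fun i => ‖f x i‖ := by
    simp only [hf]
    exact (h1 x).summable.prod
  have hfc (x : LpSum p fun q : (J × J') × I => X q.2) (i : J) (q : J' × I) :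
      coord (f x i) q = coord x ((i, q.1), q.2) := coord_mk _ _ _
  clear_value f
  refine ⟨⟨⟨fun x => mk (f x) (hfs x), fun x y => ext fun i => ext fun q => by simp [hfc]⟩,
      fun a x => ext fun i => ext fun q => by simp [hfc]⟩,
    ⟨⟨fun z => mk (fun q => coord (coord z q.1.1) (q.1.2, q.2)) (h3 z).summable,
      fun x y => ext fun q => by simp⟩, fun a x => ext fun q => by simp⟩,
    fun x => ?_, fun z => ?_, fun x => ext fun q => by simp [hfc],
    fun z => ext fun i => ext fun q => by simp [hfc]⟩
  · rw [one_mul, ← (h1 x).tsum_eq, (h1 x).summable.tsum_prod, norm_eq]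
    exact (tsum_congr (hf x)).le
  · rw [one_mul, norm_eq]
    exact (h3 z).tsum_eq.le

/-- `ℕ` copies of an `ℕ`-fold sum are again that sum. -/
theorem normIso_nat_prod :
    NormIso 1 (LpSum p fun q : ℕ × I => X q.2)
      (LpSum p fun _ : ℕ => LpSum p fun q : ℕ × I => X q.2) := by
  have h := (normIso_reindex (p := p) X Nat.pairEquiv.symm).trans zero_le_one zero_le_one
    (normIso_curry (p := p) X)
  rwa [one_mul] at h

end Nat

end LpSum

/-! ### The decomposition method -/

section Pelczynski

variable {p : Set.Ioc (0 : ℝ) 1}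
variable {V : Type*} [NormedAddCommGroup V] [Module ℝ V] [PNormed p V]
variable {Y : Type*} [NormedAddCommGroup Y] [Module ℝ Y]

open LpSum in
/-- If `Y` is complemented in `V` then `Y ⊕ ℓ_p(V) ≃ ℓ_p(V)`. -/
theorem NormCompl.normIso_prod_lpSum {c : ℝ} (hc : 0 ≤ c) (h : NormCompl c Y V) :
    NormIso (1 + c + 2 * (c * c)) (Y × LpSum p fun _ : ℕ => V) (LpSum p fun _ : ℕ => V) := by
  obtain ⟨S, T, hS, hT, e⟩ := h
  have hST : NormBound (c * c) (S ∘ₗ T) := hS.comp hc hT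
  let Q : V →ₗ[ℝ] V := LinearMap.id - S ∘ₗ T
  have hQ : NormBound (1 + c * c) Q := normBound_id.sub hST
  -- V splits as `S(Y) ⊕ ker T`, and Q projects onto `ker T`. The map f moves the `S(Y)`-components
  -- one place to the right, puts the extra copy of Y in the vacant place 0 and leaves the `ker
  -- T`-components alone; g moves them back. The part f' of f isolates the shifted components for
  -- the estimates.
  let f (x : Y × LpSum p fun _ : ℕ => V) : ℕ → V
    | 0 => S x.1 + Q (coord x.2 0)
    | n + 1 => S (T (coord x.2 n)) + Q (coord x.2 (n + 1))
  let g (u : LpSum p fun _ : ℕ => V) (n : ℕ) : V := Q (coord u n) + S (T (coord u (n + 1)))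
  let f' (x : Y × LpSum p fun _ : ℕ => V) : ℕ → V
    | 0 => S x.1
    | n + 1 => S (T (coord x.2 n))
  have hcn (z : LpSum p fun _ : ℕ => V) : Summable fun n => ‖coord z n‖ := summable_norm z
  have hQs (z : LpSum p fun _ : ℕ => V) : Summable fun n => ‖Q (coord z n)‖ :=
    Summable.of_nonneg_of_le (fun _ => norm_nonneg _) (fun n => hQ _) ((hcn z).mul_left _)
  have hSTs (z : LpSum p fun _ : ℕ => V) : Summable fun n => ‖S (T (coord z n))‖ :=
    Summable.of_nonneg_of_le (fun _ => norm_nonneg _) (fun n => hST _) ((hcn z).mul_left _)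
  have hQt (z : LpSum p fun _ : ℕ => V) : ∑' n, ‖Q (coord z n)‖ ≤ (1 + c * c) * ‖z‖ := by
    rw [norm_eq, ← tsum_mul_left]
    exact (hQs z).tsum_le_tsum (fun n => hQ _) ((hcn z).mul_left _)
  have hSTt (z : LpSum p fun _ : ℕ => V) : ∑' n, ‖S (T (coord z n))‖ ≤ (c * c) * ‖z‖ := by
    rw [norm_eq, ← tsum_mul_left]
    exact (hSTs z).tsum_le_tsum (fun n => hST _) ((hcn z).mul_left _)
  have hf's (x : Y × LpSum p fun _ : ℕ => V) : Summable fun n => ‖f' x n‖ :=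
    (summable_nat_add_iff 1).1 (hSTs x.2)
  have hf't (x : Y × LpSum p fun _ : ℕ => V) :
      ∑' n, ‖f' x n‖ = ‖S x.1‖ + ∑' n, ‖S (T (coord x.2 n))‖ := (hf's x).tsum_eq_zero_add
  have hfe (x : Y × LpSum p fun _ : ℕ => V) (n : ℕ) : f x n = f' x n + Q (coord x.2 n) := by
    cases n <;> rfl
  have hfn (x : Y × LpSum p fun _ : ℕ => V) (n : ℕ) :
      ‖f x n‖ ≤ ‖f' x n‖ + ‖Q (coord x.2 n)‖ := by
    rw [hfe]
    exact norm_add_le _ _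
  have hfs (x : Y × LpSum p fun _ : ℕ => V) : Summable fun n => ‖f x n‖ :=
    Summable.of_nonneg_of_le (fun _ => norm_nonneg _) (hfn x) ((hf's x).add (hQs x.2))
  have hST1 (u : LpSum p fun _ : ℕ => V) : Summable fun n => ‖S (T (coord u (n + 1)))‖ :=
    (summable_nat_add_iff 1).2 (hSTs u)
  have hgn (u : LpSum p fun _ : ℕ => V) (n : ℕ) :
      ‖g u n‖ ≤ ‖Q (coord u n)‖ + ‖S (T (coord u (n + 1)))‖ := norm_add_le _ _
  have hgs (u : LpSum p fun _ : ℕ => V) : Summable fun n => ‖g u n‖ :=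
    Summable.of_nonneg_of_le (fun _ => norm_nonneg _) (hgn u) ((hQs u).add (hST1 u))
  have hTQ (v : V) : T (Q v) = 0 := by simp [Q, e]
  have hQS (y : Y) : Q (S y) = 0 := by simp [Q, e]
  have hQQ (v : V) : Q (Q v) = Q v := by simp [Q, e]
  have hQST (v : V) : Q v + S (T v) = v := by simp [Q]
  refine ⟨⟨⟨fun x => mk (f x) (hfs x), fun x y => ext fun n => ?_⟩, fun a x => ext fun n => ?_⟩,
    ⟨⟨fun u => (T (coord u 0), mk (g u) (hgs u)), fun x y => Prod.ext ?_ (ext fun n => ?_)⟩,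
      fun a x => Prod.ext ?_ (ext fun n => ?_)⟩,
    fun x => ?_, fun u => ?_, fun x => Prod.ext ?_ (ext fun n => ?_), fun u => ext fun n => ?_⟩
  · cases n <;> simp [f] <;> abel
  · cases n <;> simp [f]
  · simp
  · simp [g]; abel
  · simp
  · simp [g]
  · have h1 := (hfs x).tsum_le_tsum (hfn x) ((hf's x).add (hQs x.2))
    rw [(hf's x).tsum_add (hQs x.2), hf't] at h1
    have h2 : ‖mk (p := p) (f x) (hfs x)‖ = ∑' n, ‖f x n‖ := norm_eq _
    have h3 := hS x.1
    have h4 := hSTt x.2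
    have h5 := hQt x.2
    have h6 : c * ‖x.1‖ ≤ c * ‖x‖ := mul_le_mul_of_nonneg_left (norm_fst_le x) hc
    have h7 : (1 + 2 * (c * c)) * ‖x.2‖ ≤ (1 + 2 * (c * c)) * ‖x‖ :=
      mul_le_mul_of_nonneg_left (norm_snd_le x) (by positivity)
    change ‖mk (p := p) (f x) (hfs x)‖ ≤ _
    linarith
  · have h1 := (hgs u).tsum_le_tsum (hgn u) ((hQs u).add (hST1 u))
    rw [(hQs u).tsum_add (hST1 u)] at h1
    have h2 : ‖mk (p := p) (g u) (hgs u)‖ = ∑' n, ‖g u n‖ := norm_eq _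
    have h3 := (hSTs u).tsum_eq_zero_add
    have h4 := hSTt u
    have h5 := hQt u
    have h6 : ‖T (coord u 0)‖ ≤ c * ‖u‖ :=
      (hT _).trans (mul_le_mul_of_nonneg_left (norm_coord_le u 0) hc)
    have h7 := norm_nonneg (S (T (coord u 0)))
    have h8 := norm_nonneg u
    refine max_le ?_ ?_
    · refine h6.trans ?_
      nlinarith [mul_nonneg (mul_nonneg hc hc) h8]
    · change ‖mk (p := p) (g u) (hgs u)‖ ≤ _
      nlinarith [mul_nonneg hc h8]
  · simp [f, hTQ, e]
  · change Q (f x n) + S (T (f x (n + 1))) = coord x.2 n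
    rw [show f x (n + 1) = S (T (coord x.2 n)) + Q (coord x.2 (n + 1)) from rfl]
    have : Q (f x n) = Q (coord x.2 n) := by
      rw [hfe, map_add, hQQ]
      cases n <;> simp [f', hQS]
    rw [this, map_add, e, hTQ, add_zero, hQST]
  · cases n with
    | zero => simp [f, g, hQS, hQQ, add_comm, hQST]
    | succ n => simp [f, g, hQS, hQQ, hTQ, e, add_comm, hQST]

/-- If `V ≃ V ⊕ V` is complemented in `Y` then `V ⊕ Y ≃ Y`. -/
theorem NormCompl.normIso_prod {c d : ℝ} (hc : 0 ≤ c) (hd : 0 ≤ d) (h : NormCompl c V Y)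
    (hV : NormIso d V (V × V)) : NormIso (1 + c + d * c + c * c + d * (c * c)) (V × Y) Y := by
  obtain ⟨S, T, hS, hT, e⟩ := h
  obtain ⟨A, B, hA, hB, e1, e2⟩ := hV
  have hdc := mul_nonneg hd hc
  have hcc := mul_nonneg hc hc
  have hdcc := mul_nonneg hd hcc
  -- Here Y splits as `S(V) ⊕ ker T`: the extra V is merged with `S(V)` through `V × V ≃ V`, and the
  -- component `y - S (T y)` in `ker T` is kept.
  refine ⟨⟨⟨fun x => S (B (x.1, T x.2)) + (x.2 - S (T x.2)), fun x y => ?_⟩, fun a x => ?_⟩,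
    ⟨⟨fun y => ((A (T y)).1, S (A (T y)).2 + (y - S (T y))), fun x y => ?_⟩, fun a x => ?_⟩,
    fun x => ?_, fun y => ?_, fun x => ?_, fun y => ?_⟩
  · have : ((x + y).1, T (x + y).2) = (x.1, T x.2) + (y.1, T y.2) := by simp
    rw [this, Prod.snd_add, map_add, map_add, map_add, map_add]
    abel
  · have : ((a • x).1, T (a • x).2) = a • (x.1, T x.2) := by simp
    change S (B ((a • x).1, T (a • x).2)) + ((a • x).2 - S (T (a • x).2)) =
      a • (S (B (x.1, T x.2)) + (x.2 - S (T x.2)))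
    rw [this, Prod.smul_snd, map_smul, map_smul, map_smul, map_smul, smul_add, smul_sub]
  · refine Prod.ext (by simp) ?_
    simp only [map_add, Prod.snd_add]
    abel
  · refine Prod.ext (by simp) ?_
    simp only [map_smul, Prod.smul_snd, RingHom.id_apply, smul_add, smul_sub]
  · have h1 := hS (B (x.1, T x.2))
    have h2 := mul_le_mul_of_nonneg_left (hB (x.1, T x.2)) hc
    have h3 : ‖(x.1, T x.2)‖ ≤ (1 + c) * ‖x‖ := by
      refine max_le ?_ ((hT x.2).trans ?_)
      · nlinarith [norm_fst_le x, norm_nonneg x]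
      · nlinarith [norm_snd_le x, norm_nonneg x, norm_nonneg x.2]
    have h4 := mul_le_mul_of_nonneg_left h3 hdc
    have h5 := norm_sub_le x.2 (S (T x.2))
    have h6 := (hS (T x.2)).trans (mul_le_mul_of_nonneg_left (hT x.2) hc)
    have h7 := mul_le_mul_of_nonneg_left (norm_snd_le x) hcc
    have h8 := mul_nonneg hc (norm_nonneg x)
    have h9 := norm_snd_le x
    refine (norm_add_le _ _).trans ?_
    nlinarith
  · have h1 := (hA (T y)).trans (mul_le_mul_of_nonneg_left (hT y) hd)
    have h2 := norm_fst_le (A (T y))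
    have h3 := norm_snd_le (A (T y))
    have h4 := mul_le_mul_of_nonneg_left (h3.trans h1) hc
    have h5 := hS (A (T y)).2
    have h6 := (hS (T y)).trans (mul_le_mul_of_nonneg_left (hT y) hc)
    have h7 := norm_sub_le y (S (T y))
    have hy := norm_nonneg y
    have h8 := mul_nonneg hc hy
    have h9 := mul_nonneg hcc hy
    have h10 := mul_nonneg hdcc hy
    have h11 := mul_nonneg hdc hy
    refine max_le ?_ ((norm_add_le _ _).trans ?_)
    · refine h2.trans (h1.trans ?_)
      nlinarith
    · nlinarith
  · have h1 : T (S (B (x.1, T x.2)) + (x.2 - S (T x.2))) = B (x.1, T x.2) := by simp [e]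
    refine Prod.ext ?_ ?_
    · change (A (T (S (B (x.1, T x.2)) + (x.2 - S (T x.2))))).1 = x.1
      rw [h1, e2]
    · change S (A (T (S (B (x.1, T x.2)) + (x.2 - S (T x.2))))).2 +
        ((S (B (x.1, T x.2)) + (x.2 - S (T x.2))) -
          S (T (S (B (x.1, T x.2)) + (x.2 - S (T x.2))))) = x.2
      rw [h1, e2]
      abel
  · have h1 : T (S (A (T y)).2 + (y - S (T y))) = (A (T y)).2 := by simp [e]
    change S (B ((A (T y)).1, T (S (A (T y)).2 + (y - S (T y))))) +
      ((S (A (T y)).2 + (y - S (T y))) - S (T (S (A (T y)).2 + (y - S (T y))))) = y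
    rw [h1, Prod.mk.eta, e1]
    abel

/-- The constant of the decomposition method. -/
def pelczynskiConst (c : ℝ) : ℝ :=
  (1 + c + 4 * c + c * c + 4 * (c * c)) * (1 * (1 * ((1 + c + 2 * (c * c)) * 1)))

theorem one_le_pelczynskiConst {c : ℝ} (hc : 0 ≤ c) : 1 ≤ pelczynskiConst c := by
  unfold pelczynskiConst
  rw [one_mul, one_mul, mul_one]
  exact one_le_mul_of_one_le_of_one_le (by nlinarith) (by nlinarith)

/-- Pełczyński's decomposition method. -/
theorem NormIso.of_normCompl {c : ℝ} (hc : 0 ≤ c) (hV : NormIso 1 V (LpSum p fun _ : ℕ => V))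
    (h : NormCompl c Y V) (h' : NormCompl c V Y) : NormIso (pelczynskiConst c) Y V := by
  -- V is trivially complemented in itself, and `1 + c + 2 * (c * c)` is 4 at c = 1. Hence `V ≃
  -- ℓ_p(V) ≃ V × ℓ_p(V) ≃ V × V`.
  have h1 : NormIso 4 (V × LpSum p fun _ : ℕ => V) (LpSum p fun _ : ℕ => V) := by
    have := NormCompl.normIso_prod_lpSum (p := p) zero_le_one (NormCompl.refl (X := V))
    norm_num at this
    exact this
  have h2 : NormIso 4 V (V × V) := by
    have := (hV.trans zero_le_one (by norm_num) h1.symm).trans (by norm_num) zero_le_one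
      (hV.symm.prod_right (Z := V) le_rfl)
    norm_num at this
    exact this
  -- The chain is `Y ≃ V × Y ≃ Y × V ≃ Y × ℓ_p(V) ≃ ℓ_p(V) ≃ V`; `pelczynskiConst` multiplies its
  -- constants in this order.
  refine NormIso.trans (by positivity) (by positivity) (h'.normIso_prod hc (by norm_num) h2).symm ?_
  refine NormIso.trans zero_le_one (by positivity) NormIso.prodComm ?_
  refine NormIso.trans zero_le_one (by positivity) (hV.prod_right le_rfl) ?_
  exact (h.normIso_prod_lpSum hc).trans (by positivity) zero_le_one hV.symm

end Pelczynski

namespace FreeSpace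

variable {p : Set.Ioc (0 : ℝ) 1} {X : Type u} {Y : Type v} [PseudoMetricSpace X]
  [PseudoMetricSpace Y] {Z : Type w} [NormedAddCommGroup Z] [Module ℝ Z]

/-! ### Operators on free spaces -/

/-- The universal property in terms of p-th powers: the Lipschitz constant is `c ^ (1 / p)`, which
becomes c again in the bound for T. -/
theorem exists_lift [PNormed p Z] [CompleteSpace Z] (f : X → Z) {c : ℝ} (hc : 0 ≤ c)
    (hf : ∀ x y, ‖f x - f y‖ ≤ c * dist x y ^ (p : ℝ)) :
    ∃ T : FreeSpace p X →ₗ[ℝ] Z, NormBound c T ∧ ∀ x y, T (atom p x y) = f x - f y := by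
  have hp := p.2.1
  have hcp : (c ^ (1 / (p : ℝ))) ^ (p : ℝ) = c := by
    rw [← Real.rpow_mul hc, one_div, inv_mul_cancel₀ hp.ne', Real.rpow_one]
  obtain ⟨-, T, hT, hb⟩ := existsUnique_lift (p := p) f (L := c ^ (1 / (p : ℝ)))
    (by positivity) fun x y => by
      have h := Real.rpow_le_rpow (norm_nonneg _) (hf x y) (one_div_pos.2 hp).le
      rwa [Real.mul_rpow hc (by positivity), ← Real.rpow_mul dist_nonneg, mul_one_div_cancel hp.ne',
        Real.rpow_one] at h
  refine ⟨T.toLinearMap, ?_, hT⟩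
  have h := hb.normBound
  rwa [hcp] at h

theorem hom_ext {S T : FreeSpace p X →ₗ[ℝ] Z} {c d : ℝ} (hS : NormBound c S)
    (hT : NormBound d T) (h : ∀ x y, S (atom p x y) = T (atom p x y)) : S = T := by
  refine LinearMap.ext fun z => ?_
  induction z using UniformSpace.Completion.induction_on with
  | hp => exact isClosed_eq hS.continuous hT.continuous
  | ih m =>
    obtain ⟨l, rfl⟩ := Mol.exists_ofList m
    induction l with
    | nil =>
      change S ((0 : Mol p X) : FreeSpace p X) = T ((0 : Mol p X) : FreeSpace p X)
      rw [UniformSpace.Completion.coe_zero, map_zero, map_zero]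
    | cons t l ih =>
      have e : ((Mol.ofList (t :: l) : Mol p X) : FreeSpace p X)
          = t.1 • atom p t.2.1 t.2.2 + ((Mol.ofList l : Mol p X) : FreeSpace p X) := by
        rw [atom, ← UniformSpace.Completion.coe_smul, ← UniformSpace.Completion.coe_add]
        simp [Mol.ofList]
      rw [e, map_add, map_add, map_smul, map_smul, ih, h]

theorem _root_.LipFree.Mol.atom_sub_atom {X : Type u} (x y z : X) :
    (Mol.atom x z - Mol.atom y z : Mol p X) = Mol.atom x y := by
  apply Subtype.ext
  change (Finsupp.single x (1 : ℝ) - Finsupp.single z 1) -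
    (Finsupp.single y (1 : ℝ) - Finsupp.single z 1) = Finsupp.single x 1 - Finsupp.single y 1
  abel

theorem atom_sub_atom (x y z : X) : atom p x z - atom p y z = atom p x y := by
  rw [atom, atom, atom, ← UniformSpace.Completion.coe_sub, Mol.atom_sub_atom]

@[simp] theorem atom_self (x : X) : atom p x x = 0 := by
  rw [← atom_sub_atom x x x, sub_self]

theorem atom_add_atom (x y z : X) : atom p x y + atom p y z = atom p x z := by
  rw [← atom_sub_atom x y z, sub_add_cancel]

/-- Bounded operators are determined by their values at the points `δ(x) - δ(o)`. -/
theorem hom_ext_of_base (o : X) {S T : FreeSpace p X →ₗ[ℝ] Z} {c d : ℝ} (hS : NormBound c S)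
    (hT : NormBound d T) (h : ∀ x, S (atom p x o) = T (atom p x o)) : S = T :=
  hom_ext hS hT fun x y => by rw [← atom_sub_atom x y o, map_sub, map_sub, h, h]

theorem norm_atom_le (x y : X) : ‖atom p x y‖ ≤ dist x y ^ (p : ℝ) := by
  rw [atom, UniformSpace.Completion.norm_coe, Mol.norm_def]
  refine (Mol.gauge_le (l := [(1, x, y)]) (by simp [Mol.ofList])).trans ?_
  simp [Mol.cost]

/-- The canonical embedding of `X` is isometric for the `p`-norm. -/
theorem norm_atom (x y : X) : ‖atom p x y‖ = dist x y ^ (p : ℝ) := by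
  refine le_antisymm (norm_atom_le x y) ?_
  rw [atom, UniformSpace.Completion.norm_coe, Mol.norm_def]
  have hp := p.2.1
  -- The 1-Lipschitz function `dist · y` attains `dist x y` on the atom. Subadditivity of `t ↦ t ^
  -- p` for p ≤ 1 bounds the p-th power of its linear extension by the cost of any representation.
  let φ : Mol p X →ₗ[ℝ] ℝ :=
    (Finsupp.linearCombination ℝ fun z => dist z y) ∘ₗ (LinearMap.ker _).subtype
  have hφ (a b : X) : φ (Mol.atom a b) = dist a y - dist b y := by
    change Finsupp.linearCombination ℝ (fun z => dist z y)
      (Finsupp.single a 1 - Finsupp.single b 1) = _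
    simp
  have key (l : List (ℝ × X × X)) : |φ (Mol.ofList l)| ^ (p : ℝ) ≤ Mol.cost p l := by
    induction l with
    | nil => simp [Mol.ofList, Mol.cost, Real.zero_rpow hp.ne']
    | cons t l ih =>
      simp only [Mol.ofList, Mol.cost, List.map_cons, List.sum_cons] at ih ⊢
      rw [map_add, map_smul, hφ, smul_eq_mul]
      refine (Real.rpow_le_rpow (abs_nonneg _) (abs_add_le _ _) hp.le).trans ?_
      refine (Real.rpow_add_le_add_rpow (abs_nonneg _) (abs_nonneg _) hp.le p.2.2).trans ?_
      refine add_le_add ?_ ih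
      rw [abs_mul]
      exact Real.rpow_le_rpow (by positivity)
        (mul_le_mul_of_nonneg_left (abs_dist_sub_le _ _ _) (abs_nonneg _)) hp.le
  refine Mol.le_gauge fun l hl => ?_
  have h := key l
  rwa [hl, hφ, dist_self, sub_zero, abs_of_nonneg dist_nonneg] at h

theorem subsingleton (hX : ∀ x y : X, dist x y = 0) : Subsingleton (FreeSpace p X) := by
  have h0 (x y : X) : atom p x y = 0 := by
    rw [← norm_eq_zero, norm_atom, hX, Real.zero_rpow p.2.1.ne']
  have h : (LinearMap.id : FreeSpace p X →ₗ[ℝ] FreeSpace p X) = 0 :=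
    hom_ext normBound_id (d := 0) (fun z => by simp) fun x y => by simp [h0]
  exact ⟨fun x y => (LinearMap.congr_fun h x).trans (LinearMap.congr_fun h y).symm⟩

theorem normBound_linearization (f : X → Y) (hf : LipschitzWith 1 f) :
    NormBound 1 (linearization p f hf).toLinearMap := fun z => by
  change ‖linearization p f hf z‖ ≤ 1 * ‖z‖
  induction z using UniformSpace.Completion.induction_on with
  | hp =>
    exact isClosed_le (continuous_norm.comp (linearization p f hf).continuous)
      (continuous_const.mul continuous_norm)
  | ih m =>
    have h : linearization p f hf (m : FreeSpace p X) = (Mol.map f m : Mol p Y) :=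
      ContinuousLinearMap.completion_apply_coe (Mol.mapL f hf : Mol p X →L[ℝ] Mol p Y) m
    rw [h, UniformSpace.Completion.norm_coe, UniformSpace.Completion.norm_coe]
    simpa [Mol.norm_def] using Mol.gauge_map_le hf m

end FreeSpace

theorem rpow_le_self_of_one_le (p : Set.Ioc (0 : ℝ) 1) {a : ℝ} (ha : 1 ≤ a) :
    a ^ (p : ℝ) ≤ a := by
  simpa using Real.rpow_le_rpow_of_exponent_le ha p.2.2

/-! ### Subsets -/

section Subset

variable {M : Type u} [PseudoMetricSpace M]

/-- The canonical map `F_p(s) → F_p(t)` for `s ⊆ t`. -/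
def incl (p : Set.Ioc (0 : ℝ) 1) {s t : Set M} (h : s ⊆ t) : FreeSpace p s →ₗ[ℝ] FreeSpace p t :=
  (FreeSpace.linearization p (Set.inclusion h)
    (LipschitzWith.id.restrict s : LipschitzWith 1 (Set.inclusion h))).toLinearMap

/-- The canonical map `F_p(s) → F_p(M)`. -/
def inclUniv (p : Set.Ioc (0 : ℝ) 1) (s : Set M) : FreeSpace p s →ₗ[ℝ] FreeSpace p M :=
  (FreeSpace.linearization p Subtype.val (LipschitzWith.subtype_val s)).toLinearMap

variable {p : Set.Ioc (0 : ℝ) 1}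

@[simp] theorem incl_atom {s t : Set M} (h : s ⊆ t) (x y : s) :
    incl p h (FreeSpace.atom p x y) = FreeSpace.atom p (Set.inclusion h x) (Set.inclusion h y) :=
  FreeSpace.linearization_atom _ _ _ _

@[simp] theorem inclUniv_atom (s : Set M) (x y : s) :
    inclUniv p s (FreeSpace.atom p x y) = FreeSpace.atom p (x : M) (y : M) :=
  FreeSpace.linearization_atom _ _ _ _

theorem normBound_incl {s t : Set M} (h : s ⊆ t) : NormBound 1 (incl p h) :=
  FreeSpace.normBound_linearization _ _

theorem normBound_inclUniv (s : Set M) : NormBound 1 (inclUniv p s) :=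
  FreeSpace.normBound_linearization _ _

/-- The canonical map is prescribed and cannot be rescaled, but it preserves the norm of every `δ(x)
- δ(y)`. So its bound `a` is at least 1 once s has two points at positive distance, and then `b ≤ a
* b ≤ K`. Otherwise `F_p(s)` is trivial and T = 0 serves. -/
theorem ComplAmenable.exists_retraction {s t : Set M} {K : ℝ} (hK : 1 ≤ K)
    (h : ComplAmenable p K s t) : ∃ (hst : s ⊆ t) (T : FreeSpace p t →ₗ[ℝ] FreeSpace p s),
      NormBound K T ∧ ∀ z, T (incl p hst z) = z := by
  have hp := p.2.1
  obtain ⟨hst, T, a, b, hS, hT, hab, e⟩ := h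
  have e' (z : FreeSpace p s) : T (incl p hst z) = z := LinearMap.congr_fun e z
  by_cases hs : ∀ x y : s, dist x y = 0
  · have := FreeSpace.subsingleton (p := p) hs
    refine ⟨hst, 0, fun z => ?_, fun z => Subsingleton.elim _ _⟩
    simpa using by positivity
  · push Not at hs
    obtain ⟨x, y, hxy⟩ := hs
    have hd : 0 < dist x y := lt_of_le_of_ne dist_nonneg (Ne.symm hxy)
    have h1 : ‖incl p hst (FreeSpace.atom p x y)‖ ≤ a ^ (p : ℝ) * ‖FreeSpace.atom p x y‖ :=
      hS.normBound _
    rw [incl_atom, FreeSpace.norm_atom, FreeSpace.norm_atom] at h1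
    have h2 : dist (Set.inclusion hst x) (Set.inclusion hst y) = dist x y := rfl
    rw [h2] at h1
    have h3 : 1 ≤ a ^ (p : ℝ) :=
      le_of_mul_le_mul_right (by simpa using h1) (Real.rpow_pos_of_pos hd _)
    have ha : 1 ≤ a := by
      by_contra! ha
      exact absurd h3 (not_le.2 (Real.rpow_lt_one hS.1 ha hp))
    have hb : b ≤ K := by nlinarith [hT.1]
    refine ⟨hst, T, hT.normBound.mono ?_, e'⟩
    exact (Real.rpow_le_rpow hT.1 hb hp.le).trans (rpow_le_self_of_one_le p hK)

end Subset

/-! ### The one-dimensional space -/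

/-- A one-dimensional `p`-Banach space. -/
abbrev Line (p : Set.Ioc (0 : ℝ) 1) : Type := FreeSpace p ({0, 1} : Set ℝ)

namespace Line

/-- The unit vector. -/
def unit (p : Set.Ioc (0 : ℝ) 1) : Line p :=
  FreeSpace.atom p (⟨1, by simp⟩ : ({0, 1} : Set ℝ)) ⟨0, by simp⟩

variable {p : Set.Ioc (0 : ℝ) 1}

theorem norm_unit : ‖unit p‖ = 1 := by
  rw [unit, FreeSpace.norm_atom, Subtype.dist_eq]
  simp

variable {Z : Type w} [NormedAddCommGroup Z] [Module ℝ Z]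

theorem hom_ext {S T : Line p →ₗ[ℝ] Z} {c d : ℝ} (hS : NormBound c S) (hT : NormBound d T)
    (h : S (unit p) = T (unit p)) : S = T := by
  refine FreeSpace.hom_ext_of_base ⟨0, by simp⟩ hS hT ?_
  rintro ⟨x, rfl | rfl⟩
  · simp
  · exact h

theorem exists_map [PNormed p Z] [CompleteSpace Z] (v : Z) :
    ∃ T : Line p →ₗ[ℝ] Z, NormBound ‖v‖ T ∧ T (unit p) = v := by
  obtain ⟨T, hT, e⟩ := FreeSpace.exists_lift (p := p) (fun t : ({0, 1} : Set ℝ) => (t : ℝ) • v)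
    (norm_nonneg v) fun s t => by
      rw [← sub_smul, PNormed.norm_smul_eq (p := p), mul_comm, Subtype.dist_eq, Real.dist_eq]
  exact ⟨T, hT, by simp [unit, e]⟩

/-- Scalar Lipschitz functions linearize into `Line p` rather than ℝ, whose usual norm is not the
p-th power of a p-norm when p < 1. -/
theorem exists_functional {X : Type u} [PseudoMetricSpace X] (F : X → ℝ) {L : ℝ} (hL : 0 ≤ L)
    (hF : ∀ x y, |F x - F y| ≤ L * dist x y) :
    ∃ T : FreeSpace p X →ₗ[ℝ] Line p, NormBound (L ^ (p : ℝ)) T ∧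
      ∀ x y, T (FreeSpace.atom p x y) = (F x - F y) • unit p := by
  obtain ⟨T, hT, e⟩ := FreeSpace.exists_lift (p := p) (fun x => F x • unit p)
    (Real.rpow_nonneg hL (p : ℝ)) fun x y => by
      rw [← sub_smul, PNormed.norm_smul_eq (p := p), norm_unit, mul_one,
        ← Real.mul_rpow hL dist_nonneg]
      exact Real.rpow_le_rpow (abs_nonneg _) (hF x y) p.2.1.le
  exact ⟨T, hT, fun x y => by rw [e, sub_smul]⟩

theorem not_subsingleton : ¬ Subsingleton (Line p) := fun _ => by
  have h := norm_unit (p := p)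
  rw [Subsingleton.elim (unit p) 0, norm_zero] at h
  exact zero_ne_one h

/-- The normalized atom spans the line, and the functional induced by `dist · y` takes the value 1
on it. -/
theorem normCompl {X : Type u} [PseudoMetricSpace X] {x y : X} (hxy : dist x y ≠ 0) :
    NormCompl 1 (Line p) (FreeSpace p X) := by
  have hd : 0 < dist x y := lt_of_le_of_ne dist_nonneg (Ne.symm hxy)
  obtain ⟨S, hS, eS⟩ := exists_map (p := p) ((dist x y)⁻¹ • FreeSpace.atom p x y)
  obtain ⟨T, hT, eT⟩ := exists_functional (p := p) (fun z => dist z y) zero_le_one fun z z' => by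
    rw [one_mul]
    exact abs_dist_sub_le _ _ _
  rw [Real.one_rpow] at hT
  have h1 : ‖(dist x y)⁻¹ • FreeSpace.atom p x y‖ = 1 := by
    rw [PNormed.norm_smul_eq (p := p), FreeSpace.norm_atom, abs_of_pos (inv_pos.2 hd),
      ← Real.mul_rpow (inv_pos.2 hd).le hd.le, inv_mul_cancel₀ hxy, Real.one_rpow]
  rw [h1] at hS
  refine ⟨S, T, hS, hT, fun z => ?_⟩
  have key : T ∘ₗ S = LinearMap.id := by
    refine hom_ext (hT.comp zero_le_one hS) normBound_id ?_
    rw [LinearMap.comp_apply, eS, map_smul, eT, dist_self, sub_zero, smul_smul,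
      inv_mul_cancel₀ hxy, one_smul, LinearMap.id_apply]
  exact LinearMap.congr_fun key z

end Line

/-! ### Adding the base point -/

section Star

variable {p : Set.Ioc (0 : ℝ) 1} {M : Type u} [PseudoMetricSpace M]

/-- The decomposition is `δ(x) - δ(o) = (δ(x) - δ(x₀)) + (δ(x₀) - δ(o))`. As x₀ is nearest to o up
to a factor 2, sending o to x₀ and fixing a is a 3-Lipschitz retraction, because `d(x, x₀) ≤ d(x, o)
+ d(o, x₀) ≤ 3 d(x, o)`. It gives the first component. -/
theorem normIso_insert {a : Set M} {o x₀ : M} (hx₀ : x₀ ∈ a) (h0 : 0 < dist o x₀)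
    (h2 : ∀ x ∈ a, dist o x₀ ≤ 2 * dist o x) :
    NormIso 3 (FreeSpace p ↥(insert o a)) (FreeSpace p a × Line p) := by
  classical
  have hoa : o ∉ a := fun h => by
    have := h2 o h
    rw [dist_self] at this
    linarith
  let o' : ↥(insert o a) := ⟨o, Set.mem_insert o a⟩
  let r (x : ↥(insert o a)) : a := if h : (x : M) ∈ a then ⟨x, h⟩ else ⟨x₀, hx₀⟩
  have hcase (x : ↥(insert o a)) : x = o' ∨ (x : M) ∈ a :=
    x.2.imp_left Subtype.ext
  have hr {x : ↥(insert o a)} (h : (x : M) ∈ a) : r x = ⟨x, h⟩ := dif_pos h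
  have hro : r o' = ⟨x₀, hx₀⟩ := dif_neg hoa
  have hrd1 {x : ↥(insert o a)} (h : (x : M) ∈ a) : dist (r x) (r o') ≤ 3 * dist x o' := by
    rw [hr h, hro, Subtype.dist_eq, Subtype.dist_eq]
    change dist (x : M) x₀ ≤ 3 * dist (x : M) o
    have h3 := h2 x h
    have h4 := dist_triangle (x : M) o x₀
    rw [dist_comm o (x : M)] at h3
    linarith
  have hrd (x y : ↥(insert o a)) : dist (r x) (r y) ≤ 3 * dist x y := by
    rcases hcase x with rfl | hx <;> rcases hcase y with rfl | hy
    · simp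
    · rw [dist_comm, dist_comm o' y]
      exact hrd1 hy
    · exact hrd1 hx
    · rw [hr hx, hr hy]
      change dist (x : M) y ≤ 3 * dist (x : M) y
      linarith [dist_nonneg (x := (x : M)) (y := y)]
  obtain ⟨R, hR, eR⟩ := FreeSpace.exists_lift (p := p) (c := 3)
    (fun x => FreeSpace.atom p (r x) ⟨x₀, hx₀⟩) (by norm_num) fun x y => by
      rw [FreeSpace.atom_sub_atom, FreeSpace.norm_atom]
      refine (Real.rpow_le_rpow dist_nonneg (hrd x y) p.2.1.le).trans ?_
      rw [Real.mul_rpow (by norm_num) dist_nonneg]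
      exact mul_le_mul_of_nonneg_right (rpow_le_self_of_one_le p (by norm_num)) (by positivity)
  -- The second component comes from a function constant on a, so that it kills `F_p(a)`. Its jump
  -- at o is `d(o, x₀) ≤ 2 d(o, x)`, which makes it 2-Lipschitz.
  let F (x : ↥(insert o a)) : ℝ := if (x : M) ∈ a then dist o x₀ else 0
  have hFa {x : ↥(insert o a)} (h : (x : M) ∈ a) : F x = dist o x₀ := if_pos h
  have hFo : F o' = 0 := if_neg hoa
  have hF1 {x : ↥(insert o a)} (h : (x : M) ∈ a) : |F x - F o'| ≤ 2 * dist x o' := by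
    rw [hFa h, hFo, sub_zero, abs_of_pos h0, dist_comm x o']
    exact h2 x h
  obtain ⟨f, hf, ef⟩ := Line.exists_functional (p := p) F zero_le_two fun x y => by
    rcases hcase x with rfl | hx <;> rcases hcase y with rfl | hy
    · simp
    · rw [abs_sub_comm, dist_comm]
      exact hF1 hy
    · exact hF1 hx
    · rw [hFa hx, hFa hy, sub_self, abs_zero]
      positivity
  let i : a ⊆ insert o a := Set.subset_insert o a
  let x₀' : ↥(insert o a) := ⟨x₀, i hx₀⟩
  have hrx : r x₀' = ⟨x₀, hx₀⟩ := hr (x := x₀') hx₀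
  have hFx : F x₀' = dist o x₀ := hFa (x := x₀') hx₀
  obtain ⟨g, hg, eg⟩ := Line.exists_map (p := p) ((dist o x₀)⁻¹ • FreeSpace.atom p x₀' o')
  have hu : ‖(dist o x₀)⁻¹ • FreeSpace.atom p x₀' o'‖ = 1 := by
    rw [PNormed.norm_smul_eq (p := p), FreeSpace.norm_atom, dist_comm x₀']
    change |(dist o x₀)⁻¹| ^ (p : ℝ) * dist o x₀ ^ (p : ℝ) = 1
    rw [abs_of_pos (inv_pos.2 h0), ← Real.mul_rpow (inv_pos.2 h0).le h0.le,
      inv_mul_cancel₀ h0.ne', Real.one_rpow]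
  rw [hu] at hg
  have hE := normBound_incl (p := p) i
  have hf' : NormBound 2 f := hf.mono (rpow_le_self_of_one_le p one_le_two)
  have hRf : NormBound 3 (R.prod f) := fun z =>
    max_le (hR z) ((hf' z).trans (mul_le_mul_of_nonneg_right (by norm_num) (norm_nonneg _)))
  have hEg : NormBound 3 ((incl p i).coprod g) := fun z => by
    rw [LinearMap.coprod_apply]
    refine (norm_add_le _ _).trans ?_
    have h1 := hE z.1
    have h2 := hg z.2
    linarith [norm_fst_le z, norm_snd_le z, norm_nonneg z]
  refine ⟨R.prod f, (incl p i).coprod g, hRf, hEg, fun z => ?_, fun z => Prod.ext ?_ ?_⟩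
  · have key : (incl p i).coprod g ∘ₗ R.prod f = LinearMap.id := by
      refine FreeSpace.hom_ext_of_base o' (hEg.comp (by norm_num) hRf) normBound_id fun x => ?_
      rw [LinearMap.comp_apply, LinearMap.prod_apply, Function.prod_apply, LinearMap.coprod_apply, eR, ef,
        LinearMap.id_apply, FreeSpace.atom_sub_atom, incl_atom, map_smul, eg, hro, hFo]
      rcases hcase x with rfl | hx
      · rw [hro, hFo, FreeSpace.atom_self, FreeSpace.atom_self, sub_self, zero_smul, add_zero]
      · rw [hr hx, hFa hx, sub_zero, smul_inv_smul₀ h0.ne']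
        exact FreeSpace.atom_add_atom x x₀' o'
    exact LinearMap.congr_fun key z
  · have k1 : R ∘ₗ incl p i = LinearMap.id := by
      refine FreeSpace.hom_ext (hR.comp (by norm_num) hE) normBound_id fun x y => ?_
      rw [LinearMap.comp_apply, incl_atom, eR, FreeSpace.atom_sub_atom, LinearMap.id_apply,
        hr (x := Set.inclusion i x) x.2, hr (x := Set.inclusion i y) y.2]
    have k2 : R ∘ₗ g = 0 := by
      refine Line.hom_ext (hR.comp (by norm_num) hg) (d := 0) (fun x => by simp) ?_
      rw [LinearMap.comp_apply, eg, map_smul, eR, hrx, hro, sub_self, smul_zero,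
        LinearMap.zero_apply]
    have e1 := LinearMap.congr_fun k1 z.1
    have e2 := LinearMap.congr_fun k2 z.2
    simp only [LinearMap.comp_apply] at e1 e2
    simp [e1, e2]
  · have k1 : f ∘ₗ incl p i = 0 := by
      refine FreeSpace.hom_ext (hf'.comp (by norm_num) hE) (d := 0) (fun x => by simp)
        fun x y => ?_
      rw [LinearMap.comp_apply, incl_atom, ef, hFa (x := Set.inclusion i x) x.2,
        hFa (x := Set.inclusion i y) y.2, sub_self, zero_smul, LinearMap.zero_apply]
    have k2 : f ∘ₗ g = LinearMap.id := by
      refine Line.hom_ext (hf'.comp (by norm_num) hg) normBound_id ?_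
      rw [LinearMap.comp_apply, eg, map_smul, ef, hFx, hFo, sub_zero, inv_smul_smul₀ h0.ne',
        LinearMap.id_apply]
    have e1 := LinearMap.congr_fun k1 z.1
    have e2 := LinearMap.congr_fun k2 z.2
    simp only [LinearMap.comp_apply] at e1 e2
    simp [e1, e2]

/-- A retraction `F_p(t) → F_p(a)` restricts to `F_p({o} ∪ s) → F_p({o} ∪ a)` if the points of
`s ⊆ t` are not much closer to `o` than those of `a`. -/
theorem exists_retraction_insert {a s t : Set M} {o x₀ : M} {K κ : ℝ} (hK : 0 ≤ K) (hκ : 0 ≤ κ)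
    (hx₀ : x₀ ∈ a) (hat : a ⊆ t) (hst : s ⊆ t) (hκs : ∀ x ∈ s, dist o x₀ ≤ κ * dist o x)
    (h0 : 0 < dist o x₀) {T : FreeSpace p t →ₗ[ℝ] FreeSpace p a} (hT : NormBound K T)
    (e : ∀ z, T (incl p hat z) = z) :
    ∃ P : FreeSpace p ↥(insert o s) →ₗ[ℝ] FreeSpace p ↥(insert o a),
      NormBound (K * (1 + κ) + (1 + κ)) P ∧ ∀ (x : M) (hx : x ∈ a) (hxs : x ∈ s),
        P (FreeSpace.atom p ⟨x, Or.inr hxs⟩ ⟨o, Or.inl rfl⟩) =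
          FreeSpace.atom p ⟨x, Or.inr hx⟩ ⟨o, Or.inl rfl⟩ := by
  classical
  have hp := p.2.1
  have hos : o ∉ s := fun h => by
    have := hκs o h
    rw [dist_self] at this
    linarith
  let os : ↥(insert o s) := ⟨o, Set.mem_insert o s⟩
  let oa : ↥(insert o a) := ⟨o, Set.mem_insert o a⟩
  let i : a ⊆ insert o a := Set.subset_insert o a
  let x₀' : ↥(insert o a) := ⟨x₀, i hx₀⟩
  let u := FreeSpace.atom p x₀' oa
  have hu : ‖u‖ = dist o x₀ ^ (p : ℝ) := by
    rw [FreeSpace.norm_atom, dist_comm]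
    rfl
  -- T knows nothing about o, so it is applied to `δ(x) - δ(x₀)` and the path from x₀ to o is added
  -- by hand. Inside s the added term u cancels; between s and o both terms cost at most a multiple
  -- of `d(o, x)`, by the hypothesis with κ.
  let f (x : ↥(insert o s)) : FreeSpace p ↥(insert o a) :=
    if h : (x : M) ∈ s then incl p i (T (FreeSpace.atom p ⟨x, hst h⟩ ⟨x₀, hat hx₀⟩)) + u else 0
  have hcase (x : ↥(insert o s)) : x = os ∨ (x : M) ∈ s :=
    x.2.imp_left Subtype.ext
  have hfo : f os = 0 := dif_neg hos
  have hfs {x : ↥(insert o s)} (h : (x : M) ∈ s) :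
      f x = incl p i (T (FreeSpace.atom p ⟨x, hst h⟩ ⟨x₀, hat hx₀⟩)) + u := dif_pos h
  have hE := normBound_incl (p := p) i
  have hb (x y : t) : ‖incl p i (T (FreeSpace.atom p x y))‖ ≤ K * dist x y ^ (p : ℝ) := by
    have h1 := hE (T (FreeSpace.atom p x y))
    rw [one_mul] at h1
    rw [← FreeSpace.norm_atom]
    exact h1.trans (hT _)
  have hκ1 : (1 + κ) ^ (p : ℝ) ≤ 1 + κ := rpow_le_self_of_one_le p (by linarith)
  have hf1 {x : ↥(insert o s)} (h : (x : M) ∈ s) :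
      ‖f x - f os‖ ≤ (K * (1 + κ) + (1 + κ)) * dist x os ^ (p : ℝ) := by
    rw [hfs h, hfo, sub_zero]
    change _ ≤ _ * dist (x : M) o ^ (p : ℝ)
    have h1 := hb ⟨x, hst h⟩ ⟨x₀, hat hx₀⟩
    change _ ≤ K * dist (x : M) x₀ ^ (p : ℝ) at h1
    have h2 := hκs x h
    rw [dist_comm o (x : M)] at h2
    have hd : 0 ≤ dist (x : M) o := dist_nonneg
    have h3 : dist (x : M) x₀ ≤ (1 + κ) * dist (x : M) o := by
      linarith [dist_triangle (x : M) o x₀]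
    have h4 : dist o x₀ ≤ (1 + κ) * dist (x : M) o := by linarith
    have h5 (r : ℝ) (hr : 0 ≤ r) (hr' : r ≤ (1 + κ) * dist (x : M) o) :
        r ^ (p : ℝ) ≤ (1 + κ) * dist (x : M) o ^ (p : ℝ) := by
      refine (Real.rpow_le_rpow hr hr' hp.le).trans ?_
      rw [Real.mul_rpow (by linarith) hd]
      exact mul_le_mul_of_nonneg_right hκ1 (by positivity)
    have h6 := mul_le_mul_of_nonneg_left (h5 _ dist_nonneg h3) hK
    have h7 := h5 _ dist_nonneg h4
    refine (norm_add_le _ _).trans ?_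
    rw [hu]
    linarith
  obtain ⟨P, hP, eP⟩ := FreeSpace.exists_lift (p := p) (c := K * (1 + κ) + (1 + κ)) f
    (by positivity) fun x y => by
      rcases hcase x with rfl | hx <;> rcases hcase y with rfl | hy
      · rw [sub_self, norm_zero]
        positivity
      · rw [norm_sub_rev, dist_comm]
        exact hf1 hy
      · exact hf1 hx
      · rw [hfs hx, hfs hy, add_sub_add_right_eq_sub, ← map_sub, ← map_sub,
          FreeSpace.atom_sub_atom]
        refine (hb _ _).trans ?_
        change _ * dist (x : M) y ^ (p : ℝ) ≤ _ * dist (x : M) y ^ (p : ℝ)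
        refine mul_le_mul_of_nonneg_right ?_ (by positivity)
        nlinarith
  refine ⟨P, hP, fun x hx hxs => ?_⟩
  change P (FreeSpace.atom p ⟨x, Or.inr hxs⟩ os) = _
  rw [eP, hfo, sub_zero, hfs (x := ⟨x, Or.inr hxs⟩) hxs]
  have h1 := e (FreeSpace.atom p ⟨x, hx⟩ ⟨x₀, hx₀⟩)
  rw [incl_atom] at h1
  change T (FreeSpace.atom p ⟨x, hst hxs⟩ ⟨x₀, hat hx₀⟩) = _ at h1
  rw [h1, incl_atom]
  exact FreeSpace.atom_add_atom _ _ _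

end Star

/-! ### Localization -/

section Weights

variable {p : Set.Ioc (0 : ℝ) 1} {M : Type u} [PseudoMetricSpace M] {ι : Type v}

/-- The operator linearizes `x ↦ (w i x (δ(x) - δ(o)))_i`. The hypothesis `hLip` is the Lipschitz
condition natural for functions of `log d(o, ·)`: a weight may vary faster near o, where `δ(x) -
δ(o)` is small. Two points meet at most 4 nonzero coordinates, each contributing at most `(2 + L)
d(x, y) ^ p`. -/
theorem exists_localization {s : ι → Set M} {w : ι → M → ℝ} {o : M} {L : ℝ} (hL : 0 ≤ L)
    (hw0 : ∀ i x, 0 ≤ w i x) (hw1 : ∀ i x, w i x ≤ 1) (hs : ∀ i x, w i x ≠ 0 → x ∈ insert o (s i))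
    (hLip : ∀ i x y, |w i x - w i y| * min (dist o x) (dist o y) ≤ L * dist x y)
    (hfin : ∀ x, ∃ F : Finset ι, F.card ≤ 2 ∧ ∀ i ∉ F, w i x = 0) :
    ∃ T : FreeSpace p M →ₗ[ℝ] LpSum p fun i => FreeSpace p ↥(insert o (s i)),
      NormBound (4 * (2 + L)) T ∧
      (∀ i x, w i x = 0 → LpSum.coord (T (FreeSpace.atom p x o)) i = 0) ∧
      ∀ i x (hx : x ∈ insert o (s i)), LpSum.coord (T (FreeSpace.atom p x o)) i =
        w i x • FreeSpace.atom p (⟨x, hx⟩ : ↥(insert o (s i))) ⟨o, Or.inl rfl⟩ := by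
  classical
  have hp := p.2.1
  let g (x : M) (i : ι) : FreeSpace p ↥(insert o (s i)) :=
    if h : x ∈ insert o (s i) then
      w i x • FreeSpace.atom p (⟨x, h⟩ : ↥(insert o (s i))) ⟨o, Or.inl rfl⟩ else 0
  have hg {x : M} {i : ι} (h : x ∈ insert o (s i)) :
      g x i = w i x • FreeSpace.atom p (⟨x, h⟩ : ↥(insert o (s i))) ⟨o, Or.inl rfl⟩ := dif_pos h
  have hg0 {x : M} {i : ι} (h : w i x = 0) : g x i = 0 := by
    by_cases hx : x ∈ insert o (s i)
    · rw [hg hx, h, zero_smul]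
    · exact dif_neg hx
  have hgo (i : ι) : g o i = 0 := by
    rw [hg (Or.inl rfl), FreeSpace.atom_self, smul_zero]
  have hsum (x : M) : Summable fun i => ‖g x i‖ := by
    obtain ⟨F, -, hF⟩ := hfin x
    exact summable_of_ne_finset_zero (s := F) fun i hi => by rw [hg0 (hF i hi), norm_zero]
  -- The minimum in `hLip` can be replaced by `d(o, y)`: the two differ by at most `d(x, y)`, and
  -- weights vary by at most 1.
  have hd (i : ι) (x y : M) : |w i x - w i y| * dist o y ≤ (1 + L) * dist x y := by
    have h1 : |w i x - w i y| ≤ 1 := by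
      rw [abs_le]
      constructor <;> linarith [hw0 i x, hw1 i x, hw0 i y, hw1 i y]
    have h2 : dist o y ≤ min (dist o x) (dist o y) + dist x y := by
      rcases min_choice (dist o x) (dist o y) with h | h <;> rw [h]
      · exact dist_triangle o x y
      · linarith [dist_nonneg (x := x) (y := y)]
    have h3 := mul_le_mul_of_nonneg_left h2 (abs_nonneg (w i x - w i y))
    have h4 := mul_le_mul_of_nonneg_right h1 (dist_nonneg (x := x) (y := y))
    linarith [hLip i x y]
  have hdp (i : ι) (x y : M) :
      |w i x - w i y| ^ (p : ℝ) * dist o y ^ (p : ℝ) ≤ (1 + L) * dist x y ^ (p : ℝ) := by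
    rw [← Real.mul_rpow (abs_nonneg _) dist_nonneg]
    refine (Real.rpow_le_rpow (by positivity) (hd i x y) hp.le).trans ?_
    rw [Real.mul_rpow (by linarith) dist_nonneg]
    exact mul_le_mul_of_nonneg_right (rpow_le_self_of_one_le p (by linarith)) (by positivity)
  have hsm (i : ι) (c : ℝ) {y : M} (hy : y ∈ insert o (s i)) :
      ‖c • FreeSpace.atom p (⟨y, hy⟩ : ↥(insert o (s i))) ⟨o, Or.inl rfl⟩‖ =
        |c| ^ (p : ℝ) * dist o y ^ (p : ℝ) := by
    rw [PNormed.norm_smul_eq (p := p), FreeSpace.norm_atom, dist_comm]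
    rfl
  have hout (i : ι) (x y : M) (hx : x ∉ insert o (s i)) :
      ‖g x i - g y i‖ ≤ (2 + L) * dist x y ^ (p : ℝ) := by
    have hwx : w i x = 0 := not_not.1 fun h => hx (hs i x h)
    rw [hg0 hwx, zero_sub, norm_neg]
    by_cases hy : y ∈ insert o (s i)
    · rw [hg hy, hsm]
      have := hdp i x y
      rw [hwx, zero_sub, abs_neg] at this
      refine this.trans (mul_le_mul_of_nonneg_right (by linarith) (by positivity))
    · rw [hg0 (not_not.1 fun h => hy (hs i y h)), norm_zero]
      positivity
  have hgd (i : ι) (x y : M) : ‖g x i - g y i‖ ≤ (2 + L) * dist x y ^ (p : ℝ) := by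
    by_cases hx : x ∈ insert o (s i)
    · by_cases hy : y ∈ insert o (s i)
      -- Product rule: move the point with the weight frozen, then change the weight at y.
      · have e : g x i - g y i =
            w i x • FreeSpace.atom p (⟨x, hx⟩ : ↥(insert o (s i))) ⟨y, hy⟩ +
            (w i x - w i y) • FreeSpace.atom p (⟨y, hy⟩ : ↥(insert o (s i))) ⟨o, Or.inl rfl⟩ := by
          rw [hg hx, hg hy, ← FreeSpace.atom_sub_atom (⟨x, hx⟩ : ↥(insert o (s i))) ⟨y, hy⟩
            ⟨o, Or.inl rfl⟩, smul_sub, sub_smul, sub_add_sub_cancel]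
        rw [e]
        refine (norm_add_le _ _).trans ?_
        rw [hsm, PNormed.norm_smul_eq (p := p), FreeSpace.norm_atom, Subtype.dist_eq]
        have h1 : |w i x| ^ (p : ℝ) ≤ 1 :=
          Real.rpow_le_one (abs_nonneg _) (by rw [abs_of_nonneg (hw0 i x)]; exact hw1 i x) hp.le
        have h2 := mul_le_mul_of_nonneg_right h1
          (Real.rpow_nonneg (dist_nonneg (x := x) (y := y)) (p : ℝ))
        have h3 := hdp i x y
        change _ * dist x y ^ (p : ℝ) + _ ≤ _
        linarith
      · rw [norm_sub_rev, dist_comm]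
        exact hout i y x hy
    · exact hout i x y hx
  obtain ⟨T, hT, e⟩ := FreeSpace.exists_lift (p := p) (c := 4 * (2 + L))
    (fun x => LpSum.mk (p := p) (g x) (hsum x)) (by positivity) fun x y => by
      refine LpSum.norm_le_of_sum_le fun F => ?_
      obtain ⟨Fx, hFx, hx⟩ := hfin x
      obtain ⟨Fy, hFy, hy⟩ := hfin y
      have hc : (Fx ∪ Fy).card ≤ 4 := (Finset.card_union_le _ _).trans (by omega)
      have hz : ∀ i ∈ F \ (Fx ∪ Fy), ‖g x i - g y i‖ = 0 := fun i hi => by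
        have hi' := (Finset.mem_sdiff.1 hi).2
        rw [Finset.mem_union, not_or] at hi'
        rw [hg0 (hx i hi'.1), hg0 (hy i hi'.2), sub_self, norm_zero]
      have h1 : ∑ i ∈ F, ‖g x i - g y i‖ ≤ ∑ i ∈ Fx ∪ Fy, ‖g x i - g y i‖ := by
        rw [← Finset.sum_inter_add_sum_sdiff F (Fx ∪ Fy), Finset.sum_eq_zero hz, add_zero]
        exact Finset.sum_le_sum_of_subset_of_nonneg Finset.inter_subset_right
          fun _ _ _ => norm_nonneg _
      have h2 := Finset.sum_le_card_nsmul (Fx ∪ Fy) _ _ fun i _ => hgd i x y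
      rw [nsmul_eq_mul] at h2
      have h3 : ((Fx ∪ Fy).card : ℝ) ≤ 4 := by exact_mod_cast hc
      have h4 := mul_le_mul_of_nonneg_right h3
        (show 0 ≤ (2 + L) * dist x y ^ (p : ℝ) by positivity)
      change ∑ i ∈ F, ‖g x i - g y i‖ ≤ _
      linarith
  have ec (x : M) (i : ι) : LpSum.coord (T (FreeSpace.atom p x o)) i = g x i := by
    rw [e]
    change g x i - g o i = g x i
    rw [hgo, sub_zero]
  exact ⟨T, hT, fun i x h => (ec x i).trans (hg0 h), fun i x hx => (ec x i).trans (hg hx)⟩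

end Weights

/-! ### Elementary facts -/

/-- Greedy choice along an enumeration of κ: at each stage only the finitely many earlier choices
must be respected, and symmetry of r makes the order of two indices irrelevant. -/
theorem exists_forall_pairwise {κ : Type*} [Countable κ] {J : Type*} {P : κ → J → Prop}
    {r : J → J → Prop} (hr : ∀ x y, r x y → r y x)
    (h : ∀ k (s : Finset J), ∃ x, P k x ∧ ∀ y ∈ s, r y x) :
    ∃ f : κ → J, (∀ k, P k (f k)) ∧ ∀ j k, j ≠ k → r (f j) (f k) := by
  classical
  obtain ⟨e, he⟩ := exists_injective_nat κ
  let Q (n : ℕ) (x : J) : Prop := ∀ k, e k = n → P k x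
  have hQ (n : ℕ) (s : Finset J) : (∃ k, e k = n) → ∃ x, Q n x ∧ ∀ y ∈ s, r y x := by
    rintro ⟨k, rfl⟩
    obtain ⟨x, hx, hxs⟩ := h k s
    exact ⟨x, fun k' hk' => he hk' ▸ hx, hxs⟩
  rcases isEmpty_or_nonempty κ with hκ | ⟨⟨k₀⟩⟩
  · exact ⟨fun k => hκ.elim k, fun k => hκ.elim k, fun k => hκ.elim k⟩
  -- Numbers that code no element of κ receive a dummy value, chosen for k₀; it enlarges the set to
  -- be respected but is never used.
  let c (n : ℕ) (s : Finset J) : J :=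
    if hn : ∃ k, e k = n then (hQ n s hn).choose else (h k₀ s).choose
  have hc (k : κ) (s : Finset J) : P k (c (e k) s) ∧ ∀ y ∈ s, r y (c (e k) s) := by
    have hn : ∃ k', e k' = e k := ⟨k, rfl⟩
    have hs := (hQ (e k) s hn).choose_spec
    have hce : c (e k) s = (hQ (e k) s hn).choose := dif_pos hn
    rw [hce]
    exact ⟨hs.1 k rfl, hs.2⟩
  let G (n : ℕ) : Finset J := Nat.rec ∅ (fun m s => insert (c m s) s) n
  have hG (n : ℕ) : G (n + 1) = insert (c n (G n)) (G n) := rfl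
  have hmono : Monotone G := monotone_nat_of_le_succ fun n => by
    rw [hG]
    exact Finset.subset_insert _ _
  have key (j k : κ) (hjk : e j < e k) : r (c (e j) (G (e j))) (c (e k) (G (e k))) := by
    refine (hc k _).2 _ (hmono (Nat.succ_le_of_lt hjk) ?_)
    rw [Nat.succ_eq_add_one, hG]
    exact Finset.mem_insert_self _ _
  refine ⟨fun k => c (e k) (G (e k)), fun k => (hc k _).1, fun j k hjk => ?_⟩
  rcases lt_or_gt_of_ne (he.ne hjk) with h | h
  · exact key j k h
  · exact hr _ _ (key k j h)

/-- This is `log t ≤ t - 1` at the ratio of the two numbers. It shows that Lipschitz functions of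
`log d(o, ·)` satisfy the condition of `exists_localization`. The convention `log 0 = 0` does no
harm, since the minimum is then 0. -/
theorem abs_log_sub_log_mul_min_le {r s : ℝ} (hr : 0 ≤ r) (hs : 0 ≤ s) :
    |Real.log r - Real.log s| * min r s ≤ |r - s| := by
  wlog h : r ≤ s generalizing r s
  · rw [abs_sub_comm, abs_sub_comm r, min_comm]
    exact this hs hr (le_of_not_ge h)
  rw [min_eq_left h]
  rcases hr.eq_or_lt with rfl | hr
  · simp
  have hs : 0 < s := hr.trans_le h
  have h1 := Real.log_le_sub_one_of_pos (div_pos hs hr)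
  rw [Real.log_div hs.ne' hr.ne'] at h1
  rw [abs_sub_comm, abs_of_nonneg (sub_nonneg.2 (Real.log_le_log hr h)), abs_sub_comm,
    abs_of_nonneg (sub_nonneg.2 h)]
  calc (Real.log s - Real.log r) * r ≤ (s / r - 1) * r := mul_le_mul_of_nonneg_right h1 hr.le
    _ = s - r := by field_simp

/-! ### Systems of annuli -/

/-- A family `a n ⊆ b n` of sets around `o` behaving like overlapping annuli. -/
structure AnnularSystem (p : Set.Ioc (0 : ℝ) 1) (L μ K K' : ℝ) {M : Type u} [MetricSpace M] (o : M)
    {I : Type} (a b : I → Set M) (le : I → I → Prop) : Prop where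
  nonneg : 0 ≤ L
  one_lt : 1 < μ
  one_le : 1 ≤ K
  one_le' : 1 ≤ K'
  far : ∀ n, ∃ r > 0, ∀ x ∈ a n, r ≤ dist o x
  near : ∀ n, ∀ x ∈ a n, ∀ y, y ≠ o →
    |Real.log (dist o x) - Real.log (dist o y)| < Real.log μ → y ∈ b n
  finite_not_disjoint : ∀ m, {n | ¬ Disjoint (b m) (b n)}.Finite
  finite_not_le : ∀ n, {m | ¬ le n m}.Finite
  complemented : ∀ n m, le n m → Complemented p K (FreeSpace p (a n)) (FreeSpace p (a m))
  finite_not_amenable : {n | ¬ ComplAmenable p K' (a n) (b n)}.Finite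
  weights : ∃ w : I → M → ℝ, (∀ n x, 0 ≤ w n x) ∧ (∀ n x, w n x ≤ 1) ∧
    (∀ n x, x ≠ o → w n x ≠ 0 → x ∈ a n) ∧
    (∀ n x y, |w n x - w n y| * min (dist o x) (dist o y) ≤ L * dist x y) ∧
    ∀ x, ∃ F : Finset I, F.card ≤ 2 ∧ (∀ n ∉ F, w n x = 0) ∧ (x ≠ o → ∑ n ∈ F, w n x = 1)

/-- The bound for the complementation constants of a system of annuli. -/
def annularConst (L μ K K' : ℝ) : ℝ :=
  4 * (2 + L) + 9 * K * ((K' * (1 + 2 * μ) + (1 + 2 * μ)) * (4 * (2 + (Real.log μ)⁻¹))) + 9 * K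

namespace AnnularSystem

variable {p : Set.Ioc (0 : ℝ) 1} {L μ K K' : ℝ} {M : Type u} [MetricSpace M] {o : M}
  {I : Type} {a b : I → Set M} {le : I → I → Prop}

theorem log_pos (h : AnnularSystem p L μ K K' o a b le) : 0 < Real.log μ := Real.log_pos h.one_lt

theorem le_annularConst (h : AnnularSystem p L μ K K' o a b le) :
    4 * (2 + L) ≤ annularConst L μ K K' ∧ 9 * K ≤ annularConst L μ K K' ∧
    9 * K * ((K' * (1 + 2 * μ) + (1 + 2 * μ)) * (4 * (2 + (Real.log μ)⁻¹))) ≤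
      annularConst L μ K K' := by
  have h0 := h.nonneg
  have h1 := h.one_lt
  have h2 := h.one_le
  have h3 := h.one_le'
  have h4 := h.log_pos
  have h5 : 0 ≤ 9 * K * ((K' * (1 + 2 * μ) + (1 + 2 * μ)) * (4 * (2 + (Real.log μ)⁻¹))) := by
    positivity
  unfold annularConst
  refine ⟨?_, ?_, ?_⟩ <;> linarith

theorem annularConst_nonneg (h : AnnularSystem p L μ K K' o a b le) :
    0 ≤ annularConst L μ K K' := by
  linarith [h.le_annularConst.2.1, h.one_le]

theorem subset (h : AnnularSystem p L μ K K' o a b le) (n : I) : a n ⊆ b n := fun x hx => by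
  obtain ⟨r, hr, hra⟩ := h.far n
  refine h.near n x hx x ?_ (by simpa using h.log_pos)
  rintro rfl
  have := hra x hx
  rw [dist_self] at this
  linarith

/-- The infimum of the distances to o is positive, so some point has distance below twice the
infimum. -/
theorem exists_nearest (h : AnnularSystem p L μ K K' o a b le) {n : I} (hn : (a n).Nonempty) :
    ∃ x₀ ∈ a n, 0 < dist o x₀ ∧ ∀ x ∈ a n, dist o x₀ ≤ 2 * dist o x := by
  obtain ⟨r, hr, hra⟩ := h.far n
  have hne : (dist o '' a n).Nonempty := hn.image _
  have hbd : BddBelow (dist o '' a n) := ⟨0, by rintro _ ⟨x, -, rfl⟩; exact dist_nonneg⟩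
  have hpos : 0 < sInf (dist o '' a n) :=
    hr.trans_le (le_csInf hne (by rintro _ ⟨x, hx, rfl⟩; exact hra x hx))
  obtain ⟨_, ⟨x₀, hx₀, rfl⟩, hlt⟩ :=
    exists_lt_of_csInf_lt hne (show sInf (dist o '' a n) < 2 * sInf (dist o '' a n) by linarith)
  refine ⟨x₀, hx₀, hr.trans_le (hra x₀ hx₀), fun x hx => ?_⟩
  linarith [csInf_le hbd (Set.mem_image_of_mem (dist o) hx)]

theorem normIso_star (h : AnnularSystem p L μ K K' o a b le) {n : I} (hn : (a n).Nonempty) :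
    NormIso 3 (FreeSpace p ↥(insert o (a n))) (FreeSpace p (a n) × Line p) := by
  obtain ⟨x₀, hx₀, h0, h2⟩ := h.exists_nearest hn
  exact normIso_insert hx₀ h0 h2

theorem subsingleton_star {n : I} (hn : ¬ (a n).Nonempty) :
    Subsingleton (FreeSpace p ↥(insert o (a n))) := by
  rw [Set.not_nonempty_iff_eq_empty] at hn
  refine FreeSpace.subsingleton fun x y => ?_
  have hx : ∀ z : ↥(insert o (a n)), (z : M) = o := fun z =>
    z.2.resolve_right fun hz => Set.notMem_empty (z : M) (hn ▸ hz)
  rw [Subtype.dist_eq, hx x, hx y, dist_self]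

theorem subsingleton_freeSpace {s : Set M} (hs : s.Subsingleton) :
    Subsingleton (FreeSpace p s) :=
  FreeSpace.subsingleton fun x y => by rw [Subtype.dist_eq, hs x.2 y.2, dist_self]

theorem normCompl_line {s : Set M} (hs : s.Nontrivial) : NormCompl 1 (Line p) (FreeSpace p s) := by
  obtain ⟨x, hx, y, hy, hxy⟩ := hs
  exact Line.normCompl (x := (⟨x, hx⟩ : s)) (y := ⟨y, hy⟩) 
    (dist_ne_zero.2 fun e => hxy (congrArg Subtype.val e))

theorem normCompl_of_le (h : AnnularSystem p L μ K K' o a b le) {n m : I}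
    (hnm : le n m ∨ (a n).Subsingleton) :
    NormCompl K (FreeSpace p (a n)) (FreeSpace p (a m)) := by
  rcases hnm with hnm | hn
  · exact ((h.complemented n m hnm).normCompl h.one_le).mono (rpow_le_self_of_one_le p h.one_le)
  · have := subsingleton_freeSpace (p := p) hn
    exact NormCompl.of_subsingleton (by linarith [h.one_le])

/-- Two distinct points make the free space nonzero, and a nonzero space is not complemented in the
trivial free space of a subsingleton. -/
theorem nontrivial_of_le (h : AnnularSystem p L μ K K' o a b le) {n m : I} (hnm : le n m)
    (hn : (a n).Nontrivial) : (a m).Nontrivial := by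
  by_contra hm
  have := subsingleton_freeSpace (p := p) (Set.not_nontrivial_iff.1 hm)
  have := (h.normCompl_of_le (Or.inl hnm)).subsingleton
  exact Line.not_subsingleton ((normCompl_line (p := p) hn).subsingleton)

/-- `F_p({o} ∪ a n)` is uniformly complemented in `F_p({o} ∪ a m)`. -/
theorem normCompl_star (h : AnnularSystem p L μ K K' o a b le) {n m : I} (hm : (a m).Nonempty)
    (hnm : le n m ∨ (a n).Subsingleton) :
    NormCompl (9 * K) (FreeSpace p ↥(insert o (a n))) (FreeSpace p ↥(insert o (a m))) := by
  have hK := h.one_le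
  by_cases hn : (a n).Nonempty
  -- Split off the line from both spaces, at the cost of 3 each, and compare the remaining parts
  -- with constant K. Nonemptiness of `a m` is what provides a line in the target.
  · have h1 := (h.normCompl_of_le hnm).prod (by linarith) ((NormCompl.refl (X := Line p)).mono hK)
    have h2 := (((h.normIso_star hn).compl.trans (by norm_num) (by linarith) h1).trans
      (by positivity) (by norm_num) (h.normIso_star hm).symm.compl)
    exact h2.mono (by linarith)
  · have := subsingleton_star (p := p) (o := o) hn
    exact NormCompl.of_subsingleton (by linarith)

/-- The target annuli lack the base point, so the line in `F_p({o} ∪ a n)` is placed in a second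
annulus with two points. -/
theorem normCompl_star_prod (h : AnnularSystem p L μ K K' o a b le) {n m m' : I}
    (hnm : le n m) (hm' : (a m').Nontrivial) :
    NormCompl (3 * K) (FreeSpace p ↥(insert o (a n))) (FreeSpace p (a m) × FreeSpace p (a m')) := by
  have hK := h.one_le
  by_cases hn : (a n).Nonempty
  · have h1 := (h.normCompl_of_le (Or.inl hnm)).prod (by linarith)
      ((normCompl_line (p := p) hm').mono hK)
    exact (h.normIso_star hn).compl.trans (by norm_num) (by linarith) h1
  · have := subsingleton_star (p := p) (o := o) hn
    exact NormCompl.of_subsingleton (by linarith)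

theorem normCompl_freeSpace_star (h : AnnularSystem p L μ K K' o a b le) (n : I) :
    NormCompl 3 (FreeSpace p (a n)) (FreeSpace p ↥(insert o (a n))) := by
  by_cases hn : (a n).Nonempty
  · have h1 := (NormCompl.prod_left (X := FreeSpace p (a n)) (Line p)).trans zero_le_one
      (by norm_num) (h.normIso_star hn).symm.compl
    rwa [one_mul] at h1
  · have := subsingleton_freeSpace (p := p)
      (Set.not_nonempty_iff_eq_empty.1 hn ▸ Set.subsingleton_empty : (a n).Subsingleton)
    exact NormCompl.of_subsingleton (by norm_num)

/-- The partition of unity shows that the annuli cover `M \ {o}`. If only finitely many were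
nonempty, one of them would be infinite; all but finitely many later annuli would inherit two points
from it, a contradiction. -/
theorem infinite_nonempty [Infinite M] [Infinite I] (h : AnnularSystem p L μ K K' o a b le) :
    {n | (a n).Nonempty}.Infinite := by
  intro hfin
  obtain ⟨w, -, -, hs, -, hF⟩ := h.weights
  have hcover : (Set.univ : Set M) ⊆ insert o (⋃ n ∈ {n | (a n).Nonempty}, a n) := fun x _ => by
    by_cases hx : x = o
    · exact Or.inl hx
    · obtain ⟨F, -, -, hsum⟩ := hF x
      obtain ⟨n, -, hn⟩ := Finset.exists_ne_zero_of_sum_ne_zero (by rw [hsum hx]; norm_num)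
      have hxn := hs n x hx hn
      exact Or.inr (Set.mem_biUnion (show n ∈ {n | (a n).Nonempty} from ⟨x, hxn⟩) hxn)
  have hk : ∃ k, (a k).Nontrivial := by
    by_contra! hk
    refine Set.infinite_univ ((Set.Finite.insert o (hfin.biUnion fun n _ => ?_)).subset hcover)
    exact (hk n).finite
  obtain ⟨k, hk⟩ := hk
  have h1 : {m | ¬ le k m}ᶜ.Infinite := (h.finite_not_le k).infinite_compl
  exact h1 (hfin.subset fun m hm => (h.nontrivial_of_le (not_not.1 hm) hk).nonempty)

/-- The whole space is complemented in the sum over all annuli. -/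
theorem normCompl_sum (h : AnnularSystem p L μ K K' o a b le) :
    NormCompl (4 * (2 + L)) (FreeSpace p M) (LpSum p fun n => FreeSpace p ↥(insert o (a n))) := by
  obtain ⟨w, h0, h1, hs, hL, hF⟩ := h.weights
  have hL0 := h.nonneg
  obtain ⟨T, hT, hTz, eT⟩ := exists_localization (p := p) h.nonneg h0 h1
    (fun n x hx => or_iff_not_imp_left.2 fun hxo => hs n x hxo hx) hL
    fun x => (hF x).imp fun F hF => ⟨hF.1, hF.2.1⟩
  obtain ⟨S, hS, eS⟩ := LpSum.exists_desc (p := p)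
    (fun n => normBound_inclUniv (p := p) (insert o (a n)))
  refine ⟨T, S, hT, hS.mono (by linarith), fun z => ?_⟩
  have key : S ∘ₗ T = LinearMap.id := by
    refine FreeSpace.hom_ext_of_base o (hS.comp zero_le_one hT) normBound_id fun x => ?_
    rw [LinearMap.comp_apply, LinearMap.id_apply]
    rcases eq_or_ne x o with rfl | hx
    · simp
    obtain ⟨F, -, hF0, hF1⟩ := hF x
    -- Only finitely many coordinates survive; S sends each to a multiple of the same atom, and the
    -- weights add up to 1.
    have hsum : T (FreeSpace.atom p x o) =
        ∑ n ∈ F, LpSum.single n (LpSum.coord (T (FreeSpace.atom p x o)) n) := by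
      refine (LpSum.hasSum_single _).unique (hasSum_sum_of_ne_finset_zero fun n hn => ?_)
      rw [hTz n x (hF0 n hn), map_zero]
    have hterm (n : I) : S (LpSum.single n (LpSum.coord (T (FreeSpace.atom p x o)) n)) =
        w n x • FreeSpace.atom p x o := by
      rw [eS]
      by_cases hw : w n x = 0
      · rw [hTz n x hw, hw, map_zero, zero_smul]
      · rw [eT n x (Or.inr (hs n x hx hw)), map_smul, inclUniv_atom]
    rw [hsum, map_sum, Finset.sum_congr rfl fun n _ => hterm n, ← Finset.sum_smul, hF1 hx, one_smul]
  exact LinearMap.congr_fun key z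

/-- A separated sum of amenable annuli is complemented in the whole space. -/
theorem normCompl_of_separated (h : AnnularSystem p L μ K K' o a b le) {κ : Type v} {m : κ → I}
    (hne : ∀ k, (a (m k)).Nonempty) (ham : ∀ k, ComplAmenable p K' (a (m k)) (b (m k)))
    (hsep : ∀ j k, j ≠ k → Disjoint (b (m j)) (b (m k))) :
    NormCompl ((K' * (1 + 2 * μ) + (1 + 2 * μ)) * (4 * (2 + (Real.log μ)⁻¹)))
      (LpSum p fun k => FreeSpace p ↥(insert o (a (m k)))) (FreeSpace p M) := by
  classical
  have hμ := h.one_lt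
  have hK' := h.one_le'
  have hlog := h.log_pos
  choose x₀ hx₀ h0 h2 using fun k => h.exists_nearest (hne k)
  choose hab R hR eR using fun k => (ham k).exists_retraction h.one_le'
  -- The condition in s is what `exists_retraction_insert` needs with κ = 2μ: a point within ratio μ
  -- of some y in the annulus satisfies `d(o, x₀) ≤ 2 d(o, y) ≤ 2μ d(o, x)`.
  let s (k : κ) : Set M := {x ∈ b (m k) | dist o (x₀ k) ≤ 2 * μ * dist o x}
  let A (k : κ) : Set ℝ := (fun x => Real.log (dist o x)) '' a (m k)
  -- The cutoff falls linearly from 1 on the annulus to 0 at logarithmic distance `log μ`. At o it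
  -- must be set to 0 separately, since the convention `log 0 = 0` would give a meaningless weight.
  let w (k : κ) (x : M) : ℝ :=
    if x = o then 0 else max 0 (1 - Metric.infDist (Real.log (dist o x)) (A k) / Real.log μ)
  have hw {k : κ} {x : M} (hx : x ≠ o) :
      w k x = max 0 (1 - Metric.infDist (Real.log (dist o x)) (A k) / Real.log μ) := if_neg hx
  have hwo (k : κ) : w k o = 0 := if_pos rfl
  have hw0 (k : κ) (x : M) : 0 ≤ w k x := by
    rcases eq_or_ne x o with rfl | hx
    · exact (hwo k).ge
    · rw [hw hx]
      exact le_max_left _ _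
  have hw1 (k : κ) (x : M) : w k x ≤ 1 := by
    rcases eq_or_ne x o with rfl | hx
    · rw [hwo]
      exact zero_le_one
    · rw [hw hx]
      refine max_le zero_le_one ?_
      have : 0 ≤ Metric.infDist (Real.log (dist o x)) (A k) / Real.log μ :=
        div_nonneg Metric.infDist_nonneg hlog.le
      linarith
  have hpos {x : M} (hx : x ≠ o) : 0 < dist o x := dist_pos.2 hx.symm
  have hane {k : κ} {x : M} (hx : x ∈ a (m k)) : x ≠ o := by
    rintro rfl
    have := h2 k x hx
    rw [dist_self] at this
    linarith [h0 k]
  have hws (k : κ) (x : M) (hx : w k x ≠ 0) : x ∈ s k := by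
    have hxo : x ≠ o := fun e => hx (e ▸ hwo k)
    have h1 : 0 < 1 - Metric.infDist (Real.log (dist o x)) (A k) / Real.log μ := by
      by_contra! h1
      exact hx (by rw [hw hxo, max_eq_left h1])
    have h3 : Metric.infDist (Real.log (dist o x)) (A k) < Real.log μ := by
      rw [sub_pos, div_lt_one hlog] at h1
      exact h1
    obtain ⟨_, ⟨y, hy, rfl⟩, hlt⟩ := (Metric.infDist_lt_iff ((hne k).image _)).1 h3
    rw [dist_comm, Real.dist_eq] at hlt
    refine ⟨h.near (m k) y hy x hxo hlt, ?_⟩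
    have hy0 := hpos (hane hy)
    have h4 : Real.log (dist o y) ≤ Real.log (μ * dist o x) := by
      rw [Real.log_mul (by linarith) (hpos hxo).ne']
      linarith [(abs_lt.1 hlt).2]
    have h5 := (Real.log_le_log_iff hy0 (mul_pos (by linarith) (hpos hxo))).1 h4
    linarith [h2 k y hy]
  have hwa (k : κ) (x : M) (hx : x ∈ a (m k)) : w k x = 1 := by
    rw [hw (hane hx), Metric.infDist_zero_of_mem
      (Set.mem_image_of_mem (fun x => Real.log (dist o x)) hx)]
    simp
  have hdisj (j k : κ) (hjk : j ≠ k) (x : M) (hx : w j x ≠ 0) : w k x = 0 := by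
    by_contra hk
    exact Set.disjoint_left.1 (hsep j k hjk) (hws j x hx).1 (hws k x hk).1
  have hLip (k : κ) (x y : M) :
      |w k x - w k y| * min (dist o x) (dist o y) ≤ (Real.log μ)⁻¹ * dist x y := by
    have hR : 0 ≤ (Real.log μ)⁻¹ * dist x y := by positivity
    rcases eq_or_ne x o with rfl | hx
    · rwa [dist_self, min_eq_left dist_nonneg, mul_zero]
    rcases eq_or_ne y o with rfl | hy
    · rwa [dist_self, min_eq_right dist_nonneg, mul_zero]
    rw [hw hx, hw hy]
    have h1 : |Metric.infDist (Real.log (dist o x)) (A k) -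
        Metric.infDist (Real.log (dist o y)) (A k)| ≤
        |Real.log (dist o x) - Real.log (dist o y)| := by
      have := (Metric.lipschitz_infDist_pt (A k)).dist_le_mul (Real.log (dist o x))
        (Real.log (dist o y))
      simpa [Real.dist_eq] using this
    have h3 := abs_max_sub_max_le_abs
      (1 - Metric.infDist (Real.log (dist o x)) (A k) / Real.log μ)
      (1 - Metric.infDist (Real.log (dist o y)) (A k) / Real.log μ) 0
    rw [max_comm, max_comm _ (0 : ℝ)] at h3
    have h4 : |1 - Metric.infDist (Real.log (dist o x)) (A k) / Real.log μ -
        (1 - Metric.infDist (Real.log (dist o y)) (A k) / Real.log μ)| =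
        (Real.log μ)⁻¹ * |Metric.infDist (Real.log (dist o x)) (A k) -
          Metric.infDist (Real.log (dist o y)) (A k)| := by
      rw [sub_sub_sub_cancel_left, ← sub_div, abs_div, abs_of_pos hlog, abs_sub_comm,
        div_eq_inv_mul]
    rw [h4] at h3
    have h5 := abs_log_sub_log_mul_min_le (dist_nonneg (x := o) (y := x))
      (dist_nonneg (x := o) (y := y))
    have h6 : |dist o x - dist o y| ≤ dist x y := by
      rw [dist_comm o x, dist_comm o y]
      exact abs_dist_sub_le x y o
    calc _ ≤ ((Real.log μ)⁻¹ * |Real.log (dist o x) - Real.log (dist o y)|) *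
          min (dist o x) (dist o y) := by
          refine mul_le_mul_of_nonneg_right (h3.trans ?_) (le_min dist_nonneg dist_nonneg)
          exact mul_le_mul_of_nonneg_left h1 (inv_pos.2 hlog).le
      _ ≤ (Real.log μ)⁻¹ * dist x y := by
          rw [mul_assoc]
          exact mul_le_mul_of_nonneg_left (h5.trans h6) (inv_pos.2 hlog).le
  obtain ⟨T, hT, eT0, eT⟩ := exists_localization (p := p) (inv_pos.2 hlog).le hw0 hw1
    (fun k x hx => Or.inr (hws k x hx)) hLip fun x => by
      by_cases hx : ∃ k, w k x ≠ 0
      · obtain ⟨k, hk⟩ := hx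
        refine ⟨{k}, by simp, fun j hj => hdisj k j ?_ x hk⟩
        rintro rfl
        exact hj (Finset.mem_singleton_self _)
      · push Not at hx
        exact ⟨∅, by simp, fun j _ => hx j⟩
  choose P hP eP using fun k => exists_retraction_insert (p := p) (s := s k) (κ := 2 * μ)
    (by linarith) (by linarith) (hx₀ k) (hab k) (fun x hx => hx.1) (fun x hx => hx.2) (h0 k)
    (hR k) (eR k)
  have has (k : κ) (x : M) (hx : x ∈ a (m k)) : x ∈ s k := hws k x (by rw [hwa k x hx]; norm_num)
  have hc : 0 ≤ K' * (1 + 2 * μ) + (1 + 2 * μ) := by nlinarith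
  have hTk (k : κ) : NormBound (4 * (2 + (Real.log μ)⁻¹)) (LpSum.coordL k ∘ₗ T) :=
    ((LpSum.normBound_coordL k).comp zero_le_one hT).mono (by rw [one_mul])
  refine LpSum.normCompl_of_biorthogonal (fun k => inclUniv p (insert o (a (m k))))
    (fun k => P k ∘ₗ LpSum.coordL k ∘ₗ T) (fun k => (normBound_inclUniv _).mono ?_)
    (fun z F => ?_) (fun k z => ?_) fun k j hjk z => ?_
  · have h1 : 1 ≤ 4 * (2 + (Real.log μ)⁻¹) := by linarith [inv_pos.2 hlog]
    have h2 : 1 ≤ K' * (1 + 2 * μ) + (1 + 2 * μ) := by nlinarith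
    exact one_le_mul_of_one_le_of_one_le h2 h1
  · refine (Finset.sum_le_sum fun k _ => hP k _).trans ?_
    rw [← Finset.mul_sum, mul_assoc]
    refine mul_le_mul_of_nonneg_left ?_ hc
    exact (LpSum.sum_norm_coord_le (T z) F).trans (hT z)
  · have key : (P k ∘ₗ LpSum.coordL k ∘ₗ T) ∘ₗ inclUniv p (insert o (a (m k))) =
        LinearMap.id := by
      refine FreeSpace.hom_ext_of_base ⟨o, Or.inl rfl⟩
        (((hP k).comp hc (hTk k)).comp (by positivity) (normBound_inclUniv _)) normBound_id ?_
      rintro ⟨x, hx | hx⟩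
      · subst hx
        simp
      · rw [LinearMap.comp_apply, inclUniv_atom, LinearMap.comp_apply, LinearMap.comp_apply,
          LpSum.coordL_apply, eT k x (Or.inr (has k x hx)), hwa k x hx, one_smul,
          eP k x hx (has k x hx)]
        rfl
    exact LinearMap.congr_fun key z
  -- Cross terms vanish: the j-th cutoff is 0 wherever the k-th one is nonzero, in particular on the
  -- k-th annulus.
  · have key : (P j ∘ₗ LpSum.coordL j ∘ₗ T) ∘ₗ inclUniv p (insert o (a (m k))) = 0 := by
      refine FreeSpace.hom_ext_of_base ⟨o, Or.inl rfl⟩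
        (((hP j).comp hc (hTk j)).comp (by positivity) (normBound_inclUniv _)) (d := 0)
        (fun z => by simp) ?_
      rintro ⟨x, hx | hx⟩
      · subst hx
        simp
      · rw [LinearMap.comp_apply, inclUniv_atom, LinearMap.comp_apply, LinearMap.comp_apply,
          LpSum.coordL_apply, eT0 j x (hdisj k j hjk.symm x (by rw [hwa k x hx]; norm_num)),
          map_zero]
        rfl
    exact LinearMap.congr_fun key z

/-- The universal model: countably many copies of every annulus. -/
abbrev model (p : Set.Ioc (0 : ℝ) 1) (o : M) (a : I → Set M) : Type u :=
  LpSum p fun q : ℕ × I => FreeSpace p ↥(insert o (a q.2))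

theorem normIso_model (p : Set.Ioc (0 : ℝ) 1) (o : M) (a : I → Set M) :
    NormIso 1 (model p o a) (LpSum p fun _ : ℕ => model p o a) :=
  LpSum.normIso_nat_prod fun n => FreeSpace p ↥(insert o (a n))

/-- One direction uses a single copy of each annulus in the model. For the other, each pair in `ℕ ×
I` picks a later, nonempty, amenable annulus whose neighbourhood misses those already picked; the
picks made so far and the bad indices exclude only finitely many. -/
theorem normIso_freeSpace [Infinite M] [Infinite I] [Countable I]
    (h : AnnularSystem p L μ K K' o a b le) :
    NormIso (pelczynskiConst (annularConst L μ K K')) (FreeSpace p M) (model p o a) := by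
  classical
  have hK := h.one_le
  have hK' := h.one_le'
  have hμ := h.one_lt
  have hlog := h.log_pos
  have hL := h.nonneg
  have hcl := h.le_annularConst
  refine NormIso.of_normCompl h.annularConst_nonneg (normIso_model p o a) ?_ ?_
  · have h1 := LpSum.normCompl_of_injective (p := p) zero_le_one
      (X := fun n => FreeSpace p ↥(insert o (a n)))
      (Y := fun q : ℕ × I => FreeSpace p ↥(insert o (a q.2))) (σ := fun n => (0, n))
      (fun m n e => congrArg Prod.snd e) fun n => NormCompl.refl
    exact (h.normCompl_sum.trans (by positivity) zero_le_one h1).mono (by linarith)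
  · obtain ⟨f, hf, hsep⟩ := exists_forall_pairwise (κ := ℕ × I) (J := I)
      (P := fun q m => ((a m).Nonempty ∧ le q.2 m) ∧ ComplAmenable p K' (a m) (b m))
      (r := fun m n => Disjoint (b m) (b n)) (fun m n e => e.symm) fun q s => by
        have hfin : ({m | ¬ le q.2 m} ∪ {m | ¬ ComplAmenable p K' (a m) (b m)} ∪
            ⋃ y ∈ s, {n | ¬ Disjoint (b y) (b n)}).Finite :=
          ((h.finite_not_le q.2).union h.finite_not_amenable).union
            (s.finite_toSet.biUnion fun y _ => h.finite_not_disjoint y)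
        obtain ⟨m, hm, hm'⟩ := (h.infinite_nonempty.sdiff hfin).nonempty
        simp only [Set.mem_union, Set.mem_ofPred_eq, Set.mem_iUnion, not_or, not_not,
          not_exists] at hm'
        exact ⟨m, ⟨⟨hm, hm'.1.1⟩, hm'.1.2⟩, hm'.2⟩
    have h1 := h.normCompl_of_separated (fun q => (hf q).1.1) (fun q => (hf q).2) hsep
    have h2 := LpSum.normCompl_of_injective (p := p) (c := 9 * K) (by positivity)
      (X := fun q : ℕ × I => FreeSpace p ↥(insert o (a q.2)))
      (Y := fun q : ℕ × I => FreeSpace p ↥(insert o (a (f q)))) Function.injective_id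
      fun q => h.normCompl_star (hf q).1.1 (Or.inl (hf q).1.2)
    exact (h2.trans (by positivity) (by positivity) h1).mono hcl.2.2

/-- An injection of N into ℕ sends repeated values of φ to different copies of the same annulus in
the model. Conversely, distinct indices of N are picked greedily. The alternative with
`Subsingleton` covers the systems in which no annulus has two points. -/
theorem normIso_sum_star [Countable I] (h : AnnularSystem p L μ K K' o a b le) {N : Type v}
    [Countable N] (φ : N → I)
    (hφ : ∀ n, {j | (a (φ j)).Nonempty ∧ (le n (φ j) ∨ (a n).Subsingleton)}.Infinite) :
    NormIso (pelczynskiConst (annularConst L μ K K'))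
      (LpSum p fun j => FreeSpace p ↥(insert o (a (φ j)))) (model p o a) := by
  have hK := h.one_le
  have hcl := h.le_annularConst
  obtain ⟨e, he⟩ := exists_injective_nat N
  refine NormIso.of_normCompl h.annularConst_nonneg (normIso_model p o a) ?_ ?_
  · have h1 := LpSum.normCompl_of_injective (p := p) zero_le_one
      (X := fun j => FreeSpace p ↥(insert o (a (φ j))))
      (Y := fun q : ℕ × I => FreeSpace p ↥(insert o (a q.2))) (σ := fun j => (e j, φ j))
      (fun i j hij => he (congrArg Prod.fst hij)) fun n => NormCompl.refl
    exact h1.mono (by linarith)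
  · obtain ⟨f, hf, hsep⟩ := exists_forall_pairwise (κ := ℕ × I) (J := N)
      (P := fun q j => (a (φ j)).Nonempty ∧ (le q.2 (φ j) ∨ (a q.2).Subsingleton))
      (r := fun i j => i ≠ j) (fun i j hij => hij.symm) fun q s => by
        obtain ⟨j, hj, hjs⟩ := (hφ q.2).exists_notMem_finset s
        exact ⟨j, hj, fun y hy hyj => hjs (hyj ▸ hy)⟩
    have h2 := LpSum.normCompl_of_injective (p := p) (c := 9 * K) (by positivity)
      (X := fun q : ℕ × I => FreeSpace p ↥(insert o (a q.2)))
      (Y := fun j => FreeSpace p ↥(insert o (a (φ j)))) (σ := f)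
      (fun i j hij => not_not.1 fun hne => hsep i j hne hij)
      fun q => h.normCompl_star (hf q).1 (hf q).2
    exact h2.mono hcl.2.1

/-- Each summand of the model is given two indices of N, labelled by `Bool`: one for the annulus
itself, one for the line contributed by the base point. -/
theorem normIso_sum [Countable I] (h : AnnularSystem p L μ K K' o a b le) {N : Type v}
    [Countable N] (φ : N → I) (hφ : ∀ n, {j | (a (φ j)).Nontrivial ∧ le n (φ j)}.Infinite) :
    NormIso (pelczynskiConst (annularConst L μ K K'))
      (LpSum p fun j => FreeSpace p (a (φ j))) (model p o a) := by
  have hK := h.one_le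
  have hcl := h.le_annularConst
  obtain ⟨e, he⟩ := exists_injective_nat N
  refine NormIso.of_normCompl h.annularConst_nonneg (normIso_model p o a) ?_ ?_
  · have h1 := LpSum.normCompl_of_injective (p := p) (c := 3) (by norm_num)
      (X := fun j => FreeSpace p (a (φ j)))
      (Y := fun q : ℕ × I => FreeSpace p ↥(insert o (a q.2))) (σ := fun j => (e j, φ j))
      (fun i j hij => he (congrArg Prod.fst hij)) fun n => h.normCompl_freeSpace_star (φ n)
    exact h1.mono (by linarith)
  · obtain ⟨f, hf, hsep⟩ := exists_forall_pairwise (κ := (ℕ × I) × Bool) (J := N)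
      (P := fun q j => (a (φ j)).Nontrivial ∧ le q.1.2 (φ j))
      (r := fun i j => i ≠ j) (fun i j hij => hij.symm) fun q s => by
        obtain ⟨j, hj, hjs⟩ := (hφ q.1.2).exists_notMem_finset s
        exact ⟨j, hj, fun y hy hyj => hjs (hyj ▸ hy)⟩
    have h2 := LpSum.normCompl_of_injective_prod (p := p) (c := 3 * K) (by positivity)
      (X := fun q : ℕ × I => FreeSpace p ↥(insert o (a q.2)))
      (Y := fun j => FreeSpace p (a (φ j))) (σ := f)
      (fun i j hij => not_not.1 fun hne => hsep i j hne hij)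
      fun q => h.normCompl_star_prod (hf (q, false)).2 (hf (q, true)).1
    exact h2.mono (by linarith)

end AnnularSystem

/-! ### Partitions of unity -/

/-- The ramp from `0` at `0` to `1` at `ε`. -/
def ramp (ε s : ℝ) : ℝ := max 0 (min 1 (s / ε))

theorem ramp_nonneg (ε s : ℝ) : 0 ≤ ramp ε s := le_max_left _ _

theorem ramp_le_one (ε s : ℝ) : ramp ε s ≤ 1 := max_le zero_le_one (min_le_left _ _)

theorem ramp_of_nonpos {ε s : ℝ} (hε : 0 < ε) (hs : s ≤ 0) : ramp ε s = 0 :=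
  max_eq_left ((min_le_right _ _).trans (div_nonpos_of_nonpos_of_nonneg hs hε.le))

theorem ramp_of_le {ε s : ℝ} (hε : 0 < ε) (hs : ε ≤ s) : ramp ε s = 1 := by
  rw [ramp, min_eq_left ((one_le_div hε).2 hs), max_eq_right zero_le_one]

theorem ramp_mono {ε : ℝ} (hε : 0 < ε) : Monotone (ramp ε) := fun _ _ h =>
  max_le_max_left _ (min_le_min_left _ (div_le_div_of_nonneg_right h hε.le))

theorem abs_ramp_sub_ramp_le {ε : ℝ} (hε : 0 < ε) (s t : ℝ) :
    |ramp ε s - ramp ε t| ≤ ε⁻¹ * |s - t| := by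
  have h1 := abs_max_sub_max_le_abs (min 1 (s / ε)) (min 1 (t / ε)) 0
  have h2 := abs_min_sub_min_le_max 1 (s / ε) 1 (t / ε)
  rw [max_comm, max_comm _ (0 : ℝ)] at h1
  rw [sub_self, abs_zero, max_eq_right (abs_nonneg _), ← sub_div, abs_div, abs_of_pos hε] at h2
  rw [← div_eq_inv_mul]
  exact h1.trans h2

/-- The weights are trapezoids in the coordinate τ, the n-th living on `(e n, e n + 1 + ε)`. Each is
a difference of two ramps of slope `ε⁻¹`, whence the factor `2 * ε⁻¹`. As ε ≤ 1, only the exponents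
`⌊τ x⌋` and `⌊τ x⌋ - 1` matter at x. -/
theorem exists_weights {M : Type u} [PseudoMetricSpace M] {o : M} {I : Type v} {a : I → Set M}
    {e : I → ℤ} (he : Function.Injective e) {τ : M → ℝ} {L ε : ℝ} (hε : 0 < ε) (hε1 : ε ≤ 1)
    (hτ : ∀ x y, |τ x - τ y| * min (dist o x) (dist o y) ≤ L * dist x y)
    (hfl : ∀ x, ⌊τ x⌋ ∈ Set.range e ∧ ⌊τ x⌋ - 1 ∈ Set.range e)
    (ha : ∀ n x, x ≠ o → (e n : ℝ) < τ x → τ x < e n + 1 + ε → x ∈ a n) :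
    ∃ w : I → M → ℝ, (∀ n x, 0 ≤ w n x) ∧ (∀ n x, w n x ≤ 1) ∧
      (∀ n x, x ≠ o → w n x ≠ 0 → x ∈ a n) ∧
      (∀ n x y, |w n x - w n y| * min (dist o x) (dist o y) ≤ 2 * ε⁻¹ * L * dist x y) ∧
      ∀ x, ∃ F : Finset I, F.card ≤ 2 ∧ (∀ n ∉ F, w n x = 0) ∧ (x ≠ o → ∑ n ∈ F, w n x = 1) := by
  classical
  let w (n : I) (x : M) : ℝ := ramp ε (τ x - e n) - ramp ε (τ x - e n - 1)
  have hsupp (n : I) (x : M) (h : w n x ≠ 0) : (e n : ℝ) < τ x ∧ τ x < e n + 1 + ε := by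
    constructor
    · by_contra! h1
      apply h
      change ramp ε (τ x - e n) - ramp ε (τ x - e n - 1) = 0
      rw [ramp_of_nonpos hε (by linarith), ramp_of_nonpos hε (by linarith), sub_self]
    · by_contra! h1
      apply h
      change ramp ε (τ x - e n) - ramp ε (τ x - e n - 1) = 0
      rw [ramp_of_le hε (by linarith), ramp_of_le hε (by linarith), sub_self]
  refine ⟨w, fun n x => sub_nonneg.2 (ramp_mono hε (by linarith)), fun n x => ?_,
    fun n x hx h => ha n x hx (hsupp n x h).1 (hsupp n x h).2, fun n x y => ?_, fun x => ?_⟩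
  · change ramp ε (τ x - e n) - ramp ε (τ x - e n - 1) ≤ 1
    linarith [ramp_le_one ε (τ x - e n), ramp_nonneg ε (τ x - e n - 1)]
  · have h1 : |w n x - w n y| ≤ 2 * ε⁻¹ * |τ x - τ y| := by
      have h2 := abs_ramp_sub_ramp_le hε (τ x - e n) (τ y - e n)
      have h3 := abs_ramp_sub_ramp_le hε (τ x - e n - 1) (τ y - e n - 1)
      rw [sub_sub_sub_cancel_right] at h2 h3
      rw [sub_sub_sub_cancel_right] at h3
      have h4 : w n x - w n y = (ramp ε (τ x - e n) - ramp ε (τ y - e n)) -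
          (ramp ε (τ x - e n - 1) - ramp ε (τ y - e n - 1)) := by
        simp only [w]
        ring
      rw [h4]
      refine (abs_sub _ _).trans ?_
      linarith
    refine (mul_le_mul_of_nonneg_right h1 (le_min dist_nonneg dist_nonneg)).trans ?_
    rw [mul_assoc, mul_assoc (2 * ε⁻¹)]
    exact mul_le_mul_of_nonneg_left (hτ x y) (by positivity)
  · obtain ⟨⟨i, hi⟩, ⟨j, hj⟩⟩ := hfl x
    have hij : i ≠ j := by
      rintro rfl
      omega
    refine ⟨{i, j}, Finset.card_le_two, fun n hn => ?_, fun _ => ?_⟩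
    · by_contra h
      obtain ⟨h1, h2⟩ := hsupp n x h
      have h3 : e n ≤ ⌊τ x⌋ := Int.le_floor.2 h1.le
      have h4 : ⌊τ x⌋ - 2 < e n := by
        have h5 := Int.floor_le (τ x)
        have h6 : ((⌊τ x⌋ - 2 : ℤ) : ℝ) < e n := by
          push_cast
          linarith
        exact_mod_cast h6
      refine hn ?_
      rw [Finset.mem_insert, Finset.mem_singleton]
      rcases eq_or_lt_of_le h3 with h5 | h5
      · exact Or.inl (he (h5.trans hi.symm))
      · exact Or.inr (he (by omega))
    -- The ramps telescope: the middle one cancels, the first is 1 and the last is 0.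
    · rw [Finset.sum_pair hij]
      simp only [w]
      rw [hi, hj]
      push_cast
      have h1 := Int.floor_le (τ x)
      have h2 := Int.lt_floor_add_one (τ x)
      rw [ramp_of_nonpos hε (s := τ x - ⌊τ x⌋ - 1) (by linarith),
        ramp_of_le hε (s := τ x - (⌊τ x⌋ - 1)) (by linarith),
        show τ x - (⌊τ x⌋ - 1) - 1 = τ x - ⌊τ x⌋ by ring]
      ring

/-! ### Geometric annuli -/

section Geometric

variable {p : Set.Ioc (0 : ℝ) 1} {M : Type u} [MetricSpace M] {o : M} {I : Type}

/-- In the coordinate `log_R(d(o, x) / c₁)` the n-th annulus is the interval from `e n` to `e n +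
log_R(c₂ / c₁)`. The 1-Lipschitz map f truncates this coordinate where the annuli stop, so that both
exponents needed by `exists_weights` belong to an annulus. The inclusions for B allow either
endpoint convention. -/
theorem annularSystem_of_geometric {R μ K K' ε c₁ c₂ : ℝ} (hR : 1 < R) (hμ : 1 < μ) (hK : 1 ≤ K)
    (hK' : 1 ≤ K') (hε : 0 < ε) (hε1 : ε ≤ 1) (hc₁ : 0 < c₁) (hc₂ : 0 < c₂) {e : I → ℤ}
    (he : Function.Injective e) {A B : I → Set ℝ}
    (hA : ∀ n, A n = Set.Ioc (c₁ * R ^ e n) (c₂ * R ^ e n))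
    (hB : ∀ n, Set.Ioo (c₁ * μ⁻¹ * R ^ e n) (c₂ * μ * R ^ e n) ⊆ B n)
    (hB' : ∀ n, B n ⊆ Set.Icc (c₁ * μ⁻¹ * R ^ e n) (c₂ * μ * R ^ e n))
    {le : I → I → Prop} (hle : ∀ n, {m | ¬ le n m}.Finite)
    (hcompl : ∀ n m, le n m →
      Complemented p K (FreeSpace p (annulus o (A n))) (FreeSpace p (annulus o (A m))))
    (hamen : {n | ¬ ComplAmenable p K' (annulus o (A n)) (annulus o (B n))}.Finite)
    {f : ℝ → ℝ} (hf : ∀ s t, |f s - f t| ≤ |s - t|)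
    (hfl : ∀ x : M, ⌊f (Real.logb R (dist o x / c₁))⌋ ∈ Set.range e ∧
      ⌊f (Real.logb R (dist o x / c₁))⌋ - 1 ∈ Set.range e)
    (hfe : ∀ n, ∀ x : M, x ≠ o → e n < f (Real.logb R (dist o x / c₁)) →
      f (Real.logb R (dist o x / c₁)) < e n + 1 + ε →
      e n < Real.logb R (dist o x / c₁) ∧
        Real.logb R (dist o x / c₁) ≤ e n + Real.logb R (c₂ / c₁)) :
    AnnularSystem p (2 * ε⁻¹ * (Real.log R)⁻¹) μ K K' o (fun n => annulus o (A n))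
      (fun n => annulus o (B n)) le := by
  have hR0 : 0 < R := by linarith
  have hμ0 : 0 < μ := by linarith
  have hlR := Real.log_pos hR
  have hρ (n : I) : 0 < R ^ e n := zpow_pos hR0 _
  refine ⟨by positivity, hμ, hK, hK', fun n => ⟨c₁ * R ^ e n, mul_pos hc₁ (hρ n), fun x hx => ?_⟩,
    fun n x hx y hy hxy => ?_, fun m => ?_, hle, hcompl, hamen, ?_⟩
  · rw [annulus, hA] at hx
    exact hx.1.le
  · rw [annulus, hA] at hx
    refine hB n ?_
    have hx0 : 0 < dist o x := (mul_pos hc₁ (hρ n)).trans hx.1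
    have hy0 : 0 < dist o y := dist_pos.2 hy.symm
    obtain ⟨h1, h2⟩ := abs_lt.1 hxy
    have h3 : dist o x < μ * dist o y := by
      rw [← Real.log_lt_log_iff hx0 (by positivity), Real.log_mul hμ0.ne' hy0.ne']
      linarith
    have h4 : dist o y < μ * dist o x := by
      rw [← Real.log_lt_log_iff hy0 (by positivity), Real.log_mul hμ0.ne' hx0.ne']
      linarith
    constructor
    · have h5 : c₁ * R ^ e n < μ * dist o y := hx.1.trans h3
      rw [mul_right_comm, ← div_eq_mul_inv, div_lt_iff₀ hμ0]
      linarith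
    · have h5 := mul_le_mul_of_nonneg_left hx.2 hμ0.le
      linarith
  -- G is the logarithmic width of every enlarged annulus, so two of them meet only if their
  -- exponents differ by at most G.
  · let G : ℝ := Real.logb R (c₂ * μ) - Real.logb R (c₁ * μ⁻¹)
    have key (m n : I) (r : ℝ) (hm : r ∈ B m) (hn : r ∈ B n) : (e n : ℝ) - e m ≤ G := by
      have h1 := (hB' n hn).1.trans (hB' m hm).2
      have h2 := Real.logb_le_logb_of_le hR (mul_pos (by positivity) (hρ n)) h1
      rw [Real.logb_mul (by positivity) (hρ n).ne', Real.logb_mul (by positivity) (hρ m).ne',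
        ← Real.rpow_intCast, ← Real.rpow_intCast, Real.logb_rpow hR0 hR.ne',
        Real.logb_rpow hR0 hR.ne'] at h2
      simp only [G]
      linarith
    refine ((Set.finite_Icc (e m - ⌈G⌉) (e m + ⌈G⌉)).preimage he.injOn).subset fun n hn => ?_
    obtain ⟨x, hxm, hxn⟩ := Set.not_disjoint_iff.1 hn
    have h1 := key m n _ hxm hxn
    have h2 := key n m _ hxn hxm
    have h3 : ((e n - e m : ℤ) : ℝ) ≤ ⌈G⌉ := by
      push_cast
      exact h1.trans (Int.le_ceil G)
    have h4 : ((e m - e n : ℤ) : ℝ) ≤ ⌈G⌉ := by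
      push_cast
      exact h2.trans (Int.le_ceil G)
    have h3' : e n - e m ≤ ⌈G⌉ := by exact_mod_cast h3
    have h4' : e m - e n ≤ ⌈G⌉ := by exact_mod_cast h4
    exact Set.mem_Icc.2 ⟨by omega, by omega⟩
  · refine exists_weights he hε hε1 (τ := fun x => f (Real.logb R (dist o x / c₁)))
      (fun x y => ?_) hfl fun n x hx h1 h2 => ?_
    · have h1 : |Real.logb R (dist o x / c₁) - Real.logb R (dist o y / c₁)| *
          min (dist o x) (dist o y) ≤ (Real.log R)⁻¹ * dist x y := by
        rcases eq_or_ne x o with rfl | hx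
        · rw [dist_self, min_eq_left dist_nonneg, mul_zero]
          positivity
        rcases eq_or_ne y o with rfl | hy
        · rw [dist_self, min_eq_right dist_nonneg, mul_zero]
          positivity
        have hx0 : 0 < dist o x := dist_pos.2 hx.symm
        have hy0 : 0 < dist o y := dist_pos.2 hy.symm
        have h2 : Real.logb R (dist o x / c₁) - Real.logb R (dist o y / c₁) =
            (Real.log R)⁻¹ * (Real.log (dist o x) - Real.log (dist o y)) := by
          rw [Real.logb, Real.logb, Real.log_div hx0.ne' hc₁.ne', Real.log_div hy0.ne' hc₁.ne']
          field_simp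
          ring
        have h6 : |dist o x - dist o y| ≤ dist x y := by
          rw [dist_comm o x, dist_comm o y]
          exact abs_dist_sub_le x y o
        rw [h2, abs_mul, abs_of_pos (inv_pos.2 hlR), mul_assoc]
        exact mul_le_mul_of_nonneg_left
          ((abs_log_sub_log_mul_min_le hx0.le hy0.le).trans h6) (inv_pos.2 hlR).le
      exact (mul_le_mul_of_nonneg_right (hf _ _) (le_min dist_nonneg dist_nonneg)).trans h1
    · obtain ⟨h3, h4⟩ := hfe n x hx h1 h2
      have hx0 : 0 < dist o x := dist_pos.2 hx.symm
      rw [Real.lt_logb_iff_rpow_lt hR (by positivity), Real.rpow_intCast, lt_div_iff₀ hc₁] at h3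
      rw [Real.logb_le_iff_le_rpow hR (by positivity), Real.rpow_add hR0, Real.rpow_intCast,
        Real.rpow_logb hR0 hR.ne' (by positivity), div_le_iff₀ hc₁] at h4
      change dist o x ∈ A n
      rw [hA]
      refine ⟨by linarith, h4.trans (le_of_eq ?_)⟩
      field_simp

end Geometric

/-! ### Conclusions -/

/-- The isomorphism constant for a system of annuli. -/
def isomConst (p : Set.Ioc (0 : ℝ) 1) (c : ℝ) : ℝ :=
  (pelczynskiConst c * pelczynskiConst c) ^ (1 / (p : ℝ)) *
    (pelczynskiConst c * pelczynskiConst c) ^ (1 / (p : ℝ))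

theorem one_le_isomConst (p : Set.Ioc (0 : ℝ) 1) {c : ℝ} (hc : 0 ≤ c) : 1 ≤ isomConst p c := by
  have h1 := one_le_pelczynskiConst hc
  have h2 := Real.one_le_rpow (one_le_mul_of_one_le_of_one_le h1 h1)
    (one_div_pos.2 p.2.1).le
  exact one_le_mul_of_one_le_of_one_le h2 h2

section Conclusions

variable {p : Set.Ioc (0 : ℝ) 1} {c : ℝ}
  {X : Type*} [NormedAddCommGroup X] [Module ℝ X] {Y : Type*} [NormedAddCommGroup Y] [Module ℝ Y]
  {V : Type*} [NormedAddCommGroup V] [Module ℝ V]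

theorem isom_of_normIso (hc : 0 ≤ c) (hX : NormIso (pelczynskiConst c) X V)
    (hY : NormIso (pelczynskiConst c) Y V) : Isom p (isomConst p c) X Y := by
  have h1 := one_le_pelczynskiConst hc
  exact (hX.trans (by linarith) (by linarith) hY.symm).isom p (by positivity) le_rfl

theorem normIso_lpSum [PNormed p X] [PNormed p V] (hc : 0 ≤ c)
    (hX : NormIso (pelczynskiConst c) X V) (hV : NormIso 1 V (LpSum p fun _ : ℕ => V)) :
    NormIso (pelczynskiConst c) (LpSum p fun _ : ℕ => X) V := by
  have h1 := one_le_pelczynskiConst hc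
  have h2 := (LpSum.normIso_congr (p := p) (ι := ℕ) (X := fun _ => X) (Y := fun _ => V)
    (by linarith) fun _ => hX).trans (by linarith) zero_le_one hV.symm
  rwa [mul_one] at h2

end Conclusions

theorem infinite_setOf_le {N : Type v} {φ : N → ℕ} (hφ : ¬ BddAbove (Set.range φ)) (k : ℕ) :
    {j | k ≤ φ j}.Infinite := fun hfin => by
  obtain ⟨b, hb⟩ := (hfin.image φ).bddAbove
  refine hφ ⟨max b k, ?_⟩
  rintro _ ⟨j, rfl⟩
  rcases le_or_gt k (φ j) with h | h
  · exact (hb ⟨j, h, rfl⟩).trans (le_max_left _ _)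
  · exact h.le.trans (le_max_right _ _)

/-- If some `a k` has two points, so have all later annuli, and unboundedness of φ suffices.
Otherwise every `F_p(a n)` is trivial, and infinitely many nonempty summands are all that is needed.
-/
theorem AnnularSystem.isom_nat {p : Set.Ioc (0 : ℝ) 1} {L μ K K' : ℝ} {M : Type u} [MetricSpace M]
    [Infinite M] {o : M} {a b : ℕ → Set M} (h : AnnularSystem p L μ K K' o a b (· ≤ ·))
    {N : Type v} [Countable N] {φ : N → ℕ} (hφ : ¬ BddAbove (Set.range φ)) :
    Isom p (isomConst p (annularConst L μ K K')) (FreeSpace p M)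
      (LpSum p fun _ : ℕ => FreeSpace p M) ∧
    ({n : N | (a (φ n)).Nonempty}.Infinite →
      Isom p (isomConst p (annularConst L μ K K')) (FreeSpace p M)
        (LpSum p fun n : N => FreeSpace p ↥(insert o (a (φ n))))) ∧
    ((∃ k : ℕ, (a k).Nontrivial) →
      Isom p (isomConst p (annularConst L μ K K'))
        (LpSum p fun n : N => FreeSpace p ↥(insert o (a (φ n))))
        (LpSum p fun n : N => FreeSpace p (a (φ n)))) := by
  have hc := h.annularConst_nonneg
  have hM := h.normIso_freeSpace
  have hnt {k : ℕ} (hk : (a k).Nontrivial) (n : ℕ) :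
      {j | (a (φ j)).Nontrivial ∧ n ≤ φ j}.Infinite :=
    (infinite_setOf_le hφ (max k n)).mono fun j hj =>
      ⟨h.nontrivial_of_le ((le_max_left k n).trans hj) hk, (le_max_right k n).trans hj⟩
  refine ⟨isom_of_normIso hc hM
    (normIso_lpSum hc hM (AnnularSystem.normIso_model p o a)), fun hne => ?_, ?_⟩
  · refine isom_of_normIso hc hM (h.normIso_sum_star φ fun n => ?_)
    by_cases hk : ∃ k, (a k).Nontrivial
    · obtain ⟨k, hk⟩ := hk
      exact (hnt hk n).mono fun j hj => ⟨hj.1.nonempty, Or.inl hj.2⟩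
    · exact hne.mono fun j hj => ⟨hj, Or.inr (Set.not_nontrivial_iff.1 fun h => hk ⟨n, h⟩)⟩
  · rintro ⟨k, hk⟩
    exact isom_of_normIso hc
      (h.normIso_sum_star φ fun n =>
        (hnt hk n).mono fun j hj => ⟨hj.1.nonempty, Or.inl hj.2⟩)
      (h.normIso_sum φ (hnt hk))

theorem AnnularSystem.isom_int {p : Set.Ioc (0 : ℝ) 1} {L μ K K' : ℝ} {M : Type u} [MetricSpace M]
    [Infinite M] {o : M} {a b : ℤ → Set M} (h : AnnularSystem p L μ K K' o a b fun _ _ => True) :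
    Isom p (isomConst p (annularConst L μ K K')) (FreeSpace p M)
      (LpSum p fun _ : ℕ => FreeSpace p M) ∧
    ((a 0).Nonempty → Isom p (isomConst p (annularConst L μ K K'))
      (LpSum p fun _ : ℕ => FreeSpace p M)
      (LpSum p fun _ : ℕ => FreeSpace p ↥(insert o (a 0)))) ∧
    ((a 0).Nontrivial → Isom p (isomConst p (annularConst L μ K K'))
      (LpSum p fun _ : ℕ => FreeSpace p ↥(insert o (a 0)))
      (LpSum p fun _ : ℕ => FreeSpace p (a 0))) := by
  have hc := h.annularConst_nonneg
  have hM := h.normIso_freeSpace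
  have hM' := normIso_lpSum hc hM (AnnularSystem.normIso_model p o a)
  have hstar (h0 : (a 0).Nonempty) := h.normIso_sum_star (fun _ : ℕ => (0 : ℤ)) fun n => by
    simpa [h0] using Set.infinite_univ (α := ℕ)
  refine ⟨isom_of_normIso hc hM hM', fun h0 => isom_of_normIso hc hM' (hstar h0), fun h0 => ?_⟩
  refine isom_of_normIso hc (hstar h0.nonempty) (h.normIso_sum (fun _ : ℕ => (0 : ℤ)) fun n => ?_)
  simpa [h0] using Set.infinite_univ (α := ℕ)

end LipFree

/-! ### The theorem: outward, inward and two-sided annuli -/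

theorem mainTheorem10 (p : Set.Ioc (0 : ℝ) 1) :
    -- annuli growing outward
    (∀ R lam μ K₁ K₂ K₃ α : ℝ, 1 < R → 1 < lam → 1 < μ → 1 < K₁ → 1 < K₂ → 1 < K₃ → 0 < α →
      ∃ C : ℝ, 1 ≤ C ∧
        ∀ (N : Type v) [Countable N] (φ : N → ℕ), ¬ BddAbove (Set.range φ) →
        ∀ c₁ c₂ c₃ : ℝ, 0 < c₁ → c₁ < c₃ → c₃ < c₂ →
          lam < Real.logb R (c₂ / c₁) → α < Real.logb R (c₃ / c₁) →
        ∀ (M : Type u) [MetricSpace M] [Infinite M] (o : M) (A B : ℕ → Set ℝ),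
          (∀ n, A n = Set.Ioc (c₁ * R ^ n) (c₂ * R ^ n)) →
          (∀ n, B n = Set.Ioc (c₁ * μ⁻¹ * R ^ n) (c₂ * μ * R ^ n)) →
          (∀ x : M, x ≠ o → c₁ < dist o x) →
          (∀ n m : ℕ, n ≤ m → LipFree.Complemented p K₁
            (LipFree.FreeSpace p (LipFree.annulus o (A n)))
            (LipFree.FreeSpace p (LipFree.annulus o (A m)))) →
          LipFree.Complemented p K₂
            (LipFree.FreeSpace p (LipFree.annulus o (Set.Ioc c₁ c₃)))
            (LipFree.FreeSpace p (LipFree.annulus o (A 0))) →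
          (∃ n₀ : ℕ, ∀ n ≥ n₀, LipFree.ComplAmenable p K₃
            (LipFree.annulus o (A n)) (LipFree.annulus o (B n))) →
          LipFree.Isom p C (LipFree.FreeSpace p M)
            (LipFree.LpSum p fun _ : ℕ => LipFree.FreeSpace p M) ∧
          ({n : N | (LipFree.annulus o (A (φ n))).Nonempty}.Infinite →
            LipFree.Isom p C (LipFree.FreeSpace p M)
              (LipFree.LpSum p fun n : N =>
                LipFree.FreeSpace p (LipFree.annulusStar o (A (φ n))))) ∧
          ((∃ k : ℕ, (LipFree.annulus o (A k)).Nontrivial) →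
            LipFree.Isom p C
              (LipFree.LpSum p fun n : N =>
                LipFree.FreeSpace p (LipFree.annulusStar o (A (φ n))))
              (LipFree.LpSum p fun n : N =>
                LipFree.FreeSpace p (LipFree.annulus o (A (φ n)))))) ∧
    -- annuli shrinking inward
    (∀ R lam μ K₁ K₂ K₃ α : ℝ, 1 < R → 1 < lam → 1 < μ → 1 < K₁ → 1 < K₂ → 1 < K₃ → 0 < α →
      ∃ C : ℝ, 1 ≤ C ∧
        ∀ (N : Type v) [Countable N] (φ : N → ℕ), ¬ BddAbove (Set.range φ) →
        ∀ c₁ c₂ c₃ : ℝ, 0 < c₁ → c₁ < c₃ → c₃ < c₂ →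
          lam < Real.logb R (c₂ / c₁) → α < Real.logb R (c₃ / c₁) →
        ∀ (M : Type u) [MetricSpace M] [Infinite M] (o : M) (A B : ℕ → Set ℝ),
          (∀ n, A n = Set.Ioc (c₁ * R ^ (-(n : ℤ))) (c₂ * R ^ (-(n : ℤ)))) →
          (∀ n, B n = Set.Ioc (c₁ * μ⁻¹ * R ^ (-(n : ℤ))) (c₂ * μ * R ^ (-(n : ℤ)))) →
          (∀ x : M, x ≠ o → dist o x ≤ c₂) →
          (∀ n m : ℕ, n ≤ m → LipFree.Complemented p K₁
            (LipFree.FreeSpace p (LipFree.annulus o (A n)))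
            (LipFree.FreeSpace p (LipFree.annulus o (A m)))) →
          LipFree.Complemented p K₂
            (LipFree.FreeSpace p (LipFree.annulus o (Set.Ioc c₃ c₂)))
            (LipFree.FreeSpace p (LipFree.annulus o (A 0))) →
          (∃ n₀ : ℕ, ∀ n ≥ n₀, LipFree.ComplAmenable p K₃
            (LipFree.annulus o (A n)) (LipFree.annulus o (B n))) →
          LipFree.Isom p C (LipFree.FreeSpace p M)
            (LipFree.LpSum p fun _ : ℕ => LipFree.FreeSpace p M) ∧
          ({n : N | (LipFree.annulus o (A (φ n))).Nonempty}.Infinite →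
            LipFree.Isom p C (LipFree.FreeSpace p M)
              (LipFree.LpSum p fun n : N =>
                LipFree.FreeSpace p (LipFree.annulusStar o (A (φ n))))) ∧
          ((∃ k : ℕ, (LipFree.annulus o (A k)).Nontrivial) →
            LipFree.Isom p C
              (LipFree.LpSum p fun n : N =>
                LipFree.FreeSpace p (LipFree.annulusStar o (A (φ n))))
              (LipFree.LpSum p fun n : N =>
                LipFree.FreeSpace p (LipFree.annulus o (A (φ n)))))) ∧
    -- two-sided
    (∀ R lam μ K₁ K₂ : ℝ, 1 < R → 1 < lam → 1 < μ → 1 < K₁ → 1 < K₂ →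
      ∃ C : ℝ, 1 ≤ C ∧
        ∀ c₁ c₂ : ℝ, 0 < c₁ → 0 < c₂ → lam ≤ Real.logb R (c₂ / c₁) →
        ∀ (M : Type u) [MetricSpace M] [Infinite M] (o : M) (A B : ℤ → Set ℝ),
          (∀ n, A n = Set.Ioc (c₁ * R ^ n) (c₂ * R ^ n)) →
          (∀ n, B n = Set.Ioo (c₁ * μ⁻¹ * R ^ n) (c₂ * μ * R ^ n)) →
          (∀ n : ℤ, LipFree.Isom p K₁
            (LipFree.FreeSpace p (LipFree.annulus o (A n)))
            (LipFree.FreeSpace p (LipFree.annulus o (A 0)))) →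
          (∀ n : ℤ, LipFree.ComplAmenable p K₂
            (LipFree.annulus o (A n)) (LipFree.annulus o (B n))) →
          LipFree.Isom p C (LipFree.FreeSpace p M)
            (LipFree.LpSum p fun _ : ℕ => LipFree.FreeSpace p M) ∧
          ((LipFree.annulus o (Set.Ioc c₁ c₂)).Nonempty →
            LipFree.Isom p C
              (LipFree.LpSum p fun _ : ℕ => LipFree.FreeSpace p M)
              (LipFree.LpSum p fun _ : ℕ =>
                LipFree.FreeSpace p (LipFree.annulusStar o (Set.Ioc c₁ c₂)))) ∧
          ((LipFree.annulus o (Set.Ioc c₁ c₂)).Nontrivial →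
            LipFree.Isom p C
              (LipFree.LpSum p fun _ : ℕ =>
                LipFree.FreeSpace p (LipFree.annulusStar o (Set.Ioc c₁ c₂)))
              (LipFree.LpSum p fun _ : ℕ =>
                LipFree.FreeSpace p (LipFree.annulus o (Set.Ioc c₁ c₂))))) := by
  -- The overlap is `ε = min (λ - 1) (1 / 2)`: the annuli have logarithmic width at least `λ ≥ 1 +
  -- ε`, and `ε < 1`.
  have hconst {R lam μ K K' : ℝ} (hR : 1 < R) (hlam : 1 < lam) (hμ : 1 < μ) (hK : 1 < K)
      (hK' : 1 < K') : 0 ≤ LipFree.annularConst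
        (2 * (min (lam - 1) (1 / 2))⁻¹ * (Real.log R)⁻¹) μ K K' := by
    have h1 : 0 < min (lam - 1) (1 / 2) := lt_min (by linarith) (by norm_num)
    have h2 := Real.log_pos hR
    have h3 := Real.log_pos hμ
    unfold LipFree.annularConst
    positivity
  refine ⟨fun R lam μ K₁ K₂ K₃ α hR hlam hμ hK₁ hK₂ hK₃ hα =>
      ⟨_, LipFree.one_le_isomConst p (hconst hR hlam hμ hK₁ hK₃), ?_⟩,
    fun R lam μ K₁ K₂ K₃ α hR hlam hμ hK₁ hK₂ hK₃ hα =>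
      ⟨_, LipFree.one_le_isomConst p (hconst hR hlam hμ hK₁ hK₃), ?_⟩,
    fun R lam μ K₁ K₂ hR hlam hμ hK₁ hK₂ =>
      ⟨_, LipFree.one_le_isomConst p
        (hconst hR hlam hμ (lt_trans hK₁ (lt_mul_self hK₁)) hK₂), ?_⟩⟩
  · intro N _ φ hφ c₁ c₂ c₃ hc₁ hc₁₃ hc₃₂ hlog _ M _ _ o A B hA hB hM hcompl _ ⟨n₀, hamen⟩
    have hε : 0 < min (lam - 1) (1 / 2) := lt_min (by linarith) (by norm_num)
    have hε1 : min (lam - 1) (1 / 2) ≤ lam - 1 := min_le_left _ _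
    have hε2 : min (lam - 1) (1 / 2) ≤ 1 / 2 := min_le_right _ _
    have hc₂ : 0 < c₂ := by linarith
    refine LipFree.AnnularSystem.isom_nat (LipFree.annularSystem_of_geometric hR hμ hK₁.le hK₃.le
      hε (by linarith) hc₁ hc₂ (B := B) (e := fun n : ℕ => (n : ℤ)) Nat.cast_injective
      (fun n => by rw [hA, zpow_natCast]) (fun n => ?_) (fun n => ?_) (fun n => ?_) hcompl
      ((Set.finite_lt_nat n₀).subset fun n hn => not_le.1 fun h => hn (hamen n h))
      -- Exponents start at 0, so the floor must be at least 1. The truncation gives the innermost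
      -- annulus full weight below coordinate 1, where all points other than o have positive
      -- coordinate because `d(o, x) > c₁`.
      (f := fun t => max t 1) (fun s t => abs_max_sub_max_le_abs s t 1) (fun x => ?_)
      fun n x hx h1 h2 => ?_) hφ
    · rw [hB, zpow_natCast]
      exact Set.Ioo_subset_Ioc_self
    · rw [hB, zpow_natCast]
      exact Set.Ioc_subset_Icc_self
    · simp only [not_le]
      exact Set.finite_lt_nat n
    · have h1 : 1 ≤ ⌊max (Real.logb R (dist o x / c₁)) 1⌋ :=
        Int.le_floor.2 (by simp)
      exact ⟨⟨_, Int.toNat_of_nonneg (by omega)⟩, ⟨_, Int.toNat_of_nonneg (by omega)⟩⟩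
    · have ht : 0 < Real.logb R (dist o x / c₁) :=
        Real.logb_pos hR ((one_lt_div hc₁).2 (hM x hx))
      push_cast at h1 h2 ⊢
      have h3 := (le_max_left _ _).trans_lt h2
      refine ⟨?_, by linarith⟩
      rcases Nat.eq_zero_or_pos n with rfl | hn
      · simpa using ht
      · have h4 : (1 : ℝ) ≤ n := by exact_mod_cast hn
        exact (lt_max_iff.1 h1).resolve_right (not_lt.2 h4)
  · intro N _ φ hφ c₁ c₂ c₃ hc₁ hc₁₃ hc₃₂ hlog _ M _ _ o A B hA hB hM hcompl _ ⟨n₀, hamen⟩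
    have hε : 0 < min (lam - 1) (1 / 2) := lt_min (by linarith) (by norm_num)
    have hε1 : min (lam - 1) (1 / 2) ≤ lam - 1 := min_le_left _ _
    have hε2 : min (lam - 1) (1 / 2) ≤ 1 / 2 := min_le_right _ _
    have hc₂ : 0 < c₂ := by linarith
    refine LipFree.AnnularSystem.isom_nat (LipFree.annularSystem_of_geometric hR hμ hK₁.le hK₃.le
      hε (by linarith) hc₁ hc₂ (B := B) (e := fun n : ℕ => -(n : ℤ))
      (neg_injective.comp Nat.cast_injective) hA (fun n => ?_) (fun n => ?_) (fun n => ?_) hcompl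
      ((Set.finite_lt_nat n₀).subset fun n hn => not_le.1 fun h => hn (hamen n h))
      -- Exponents are at most 0, so the truncated value must stay below 1. Truncating at ε makes
      -- the weights with n ≥ 1 vanish beyond ε, and there the outermost annulus contains all points
      -- because `d(o, x) ≤ c₂`.
      (f := fun t => min t (min (lam - 1) (1 / 2)))
      (fun s t => (abs_min_sub_min_le_max s _ t _).trans (by simp)) (fun x => ?_)
      fun n x hx h1 h2 => ?_) hφ
    · rw [hB]
      exact Set.Ioo_subset_Ioc_self
    · rw [hB]
      exact Set.Ioc_subset_Icc_self
    · simp only [not_le]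
      exact Set.finite_lt_nat n
    · have h1 : ⌊min (Real.logb R (dist o x / c₁)) (min (lam - 1) (1 / 2))⌋ < 1 :=
        Int.floor_lt.2 ((min_le_right _ _).trans_lt (by push_cast; linarith))
      refine ⟨⟨(-⌊min (Real.logb R (dist o x / c₁)) (min (lam - 1) (1 / 2))⌋).toNat, ?_⟩,
        ⟨(-(⌊min (Real.logb R (dist o x / c₁)) (min (lam - 1) (1 / 2))⌋ - 1)).toNat, ?_⟩⟩
      · simp only
        omega
      · simp only
        omega
    · have ht : Real.logb R (dist o x / c₁) ≤ Real.logb R (c₂ / c₁) :=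
        Real.logb_le_logb_of_le hR (div_pos (dist_pos.2 hx.symm) hc₁)
          (div_le_div_of_nonneg_right (hM x hx) hc₁.le)
      push_cast at h1 h2 ⊢
      refine ⟨h1.trans_le (min_le_left _ _), ?_⟩
      rcases Nat.eq_zero_or_pos n with rfl | hn
      · simpa using ht
      · have h4 : (1 : ℝ) ≤ n := by exact_mod_cast hn
        have h5 := (min_lt_iff.1 h2).resolve_right (by linarith)
        linarith
  · intro c₁ c₂ hc₁ hc₂ hlog M _ _ o A B hA hB hiso hamen
    have hε : 0 < min (lam - 1) (1 / 2) := lt_min (by linarith) (by norm_num)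
    have hε1 : min (lam - 1) (1 / 2) ≤ lam - 1 := min_le_left _ _
    have hε2 : min (lam - 1) (1 / 2) ≤ 1 / 2 := min_le_right _ _
    have hA0 : Set.Ioc c₁ c₂ = A 0 := by simp [hA]
    rw [hA0]
    refine LipFree.AnnularSystem.isom_int (LipFree.annularSystem_of_geometric hR hμ
      (hK₁.trans (lt_mul_self hK₁)).le hK₂.le hε (by linarith) hc₁ hc₂ (e := id) (B := B)
      Function.injective_id hA (fun n => ?_) (fun n => ?_) (fun n => ?_)
      -- Any two annuli are compared through the 0-th one, with constant `K₁ * K₁`.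
      (fun n m _ => LipFree.Complemented.trans (LipFree.Isom.complemented (hiso n))
        (LipFree.Isom.complemented (LipFree.Isom.symm (hiso m)))) ?_
      (f := id) (fun s t => le_rfl) (fun x => by simp) fun n x hx h1 h2 => ?_)
    · rw [hB]
      rfl
    · rw [hB]
      exact Set.Ioo_subset_Icc_self
    · simp
    · simp [hamen]
    · simp only [id_eq] at h1 h2 ⊢
      exact ⟨h1, by linarith⟩

end
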